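/- Let $p$ be a prime and $R$ a complete noetherian regular local ring of Krull dimension $\geq 1$, with maximal ideal $\mathfrak m_R$ and finite residue field of characteristic $p$. Let $F$ be a number field and let $F_\infty/F$ be a $\mathbb Z_p$-extension, unramified outside $p$ and totally ramified at every prime above $p$. Put $G_\infty=\mathrm{Gal}(F_\infty/F)$, let $F_n\subset F_\infty$ be the layer with $G_n=\mathrm{Gal}(F_n/F)\simeq\mathbb Z/p^n\mathbb Z$, and let $\Lambda_R=R[[G_\infty]]=\varprojlim_n R[G_n]$. A $\Lambda_R$-module is *pseudo-null* if its support contains only primes of height $\geq 2$. Write $(-)^\vee=\mathrm{Hom}_{\mathrm{cont}}(-,\mathbb Q_p/\mathbb Z_p)$. Let $T$ be a finite free $R$-module with a continuous $R$-linear action of $G_F$. For every prime $v\mid p$ of $F$ let $F_v^+(T)\subseteq T$ be an $R$-submodule stable under $G_v=\mathrm{Gal}(\bar F_v/F_v)$, and put $F_v^-(T)=T/F_v^+(T)$. Let $A=T\otimes_R R^\vee$ (discrete) and let $F_v^+(A)$ be the image of $F_v^+(T)\otimes_R R^\vee$ in $A$. Let $\Sigma$ be a finite set of primes of $F$ containing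 all those above $p$, and let $F_\Sigma$ be the maximal extension of $F$ unramified outside $\Sigma$. For each $n$ define $$\mathrm{Sel}_{\mathrm{str}}(F_n,A)=\ker\Big(H^1(F_n,A)\to\prod_{w\nmid p}H^1(I_{n,w},A)\times\prod_{w\mid p}H^1(F_{n,w},A/F_v^+(A))\Big),$$ where $w$ runs over the primes of $F_n$, $v$ is the prime of $F$ below $w$, and $I_{n,w}$ is the inertia group at $w$; let $\mathrm{Sel}_{\mathrm{str}}(F_\infty,A)=\varinjlim_n\mathrm{Sel}_{\mathrm{str}}(F_n,A)$. Fix $n\geq 0$ and assume: 1. $T$ is unramified outside $\Sigma$; 2. $H^0(F_\Sigma/F_n,A)^\vee$ is a pseudo-null $\Lambda_R$-module; 3. $F_v^+(T)$ and $F_v^-(T)$ are free $R$-modules for every $v\mid p$; 4. for every $v\mid p$ there are continuous characters $\delta_v,\theta_v:G_v\to R^\times$ such that $\delta_v$ is unramified and takes the Frobenius to an element $u_v$ with $u_v\not\equiv 1\pmod{\mathfrak m_R}$; $\theta_v$ factors through $\mathrm{Gal}(F_v(\mu_{p^\infty})/F_v)$ and satisfies $\theta_v(\varphi)\equiv1\pmod{\mathfrak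 m_R}$ for some Frobenius lift $\varphi\in G_v$ (this last condition is automatic if $F_v(\mu_{p^\infty})/F_v$ is totally ramified, for example if $F_v/\mathbb Q_p$ is unramified, or if $\theta_v$ factors through the cyclotomic $\mathbb Z_p$-extension of $F_v$); and $G_v$ acts on $F_v^-(T)$ by multiplication by $\delta_v\theta_v$. Then the Pontryagin duals of the kernel and of the cokernel of the restriction map $$\mathrm{res}_{F_\infty/F_n}:\mathrm{Sel}_{\mathrm{str}}(F_n,A)\to\mathrm{Sel}_{\mathrm{str}}(F_\infty,A)^{\mathrm{Gal}(F_\infty/F_n)}$$ are pseudo-null $\Lambda_R$-modules. Moreover the kernel and the cokernel are cotorsion $R[G_n]$-modules, i.e. every element of their Pontryagin duals is annihilated by a non-zero-divisor of $R[G_n]$. -/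

import Mathlib

open scoped TensorProduct NumberField
open IsDedekindDomain

noncomputable section

namespace SelmerControl

/-! ### Pontryagin duality with values in `ℚ_p / ℤ_p` -/

/-- The group `ℚ_p / ℤ_p`, with its quotient topology. -/
abbrev QpZp (p : ℕ) [Fact p.Prime] : Type := ℚ_[p] ⧸ (PadicInt.subring p).toAddSubgroup

/-- All additive maps `M → ℚ_p / ℤ_p`. This is the Pontryagin dual of a *discrete* module `M`. -/
def DiscreteDual (p : ℕ) [Fact p.Prime] (M : Type*) [AddCommGroup M] : Type _ := M →+ QpZp p

instance (p : ℕ) [Fact p.Prime] (M : Type*) [AddCommGroup M] : AddCommGroup (DiscreteDual p M) :=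
  inferInstanceAs (AddCommGroup (M →+ QpZp p))

instance (p : ℕ) [Fact p.Prime] (M : Type*) [AddCommGroup M] :
    FunLike (DiscreteDual p M) M (QpZp p) :=
  inferInstanceAs (FunLike (M →+ QpZp p) M (QpZp p))

instance (p : ℕ) [Fact p.Prime] (M : Type*) [AddCommGroup M] :
    AddMonoidHomClass (DiscreteDual p M) M (QpZp p) :=
  inferInstanceAs (AddMonoidHomClass (M →+ QpZp p) M (QpZp p))

/-- Scalars act on the dual by `(s • φ) x = φ (s • x)`. -/
instance (p : ℕ) [Fact p.Prime] (S M : Type*) [CommRing S] [AddCommGroup M] [Module S M] :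
    Module S (DiscreteDual p M) where
  smul s φ := AddMonoidHom.comp φ (DistribSMul.toAddMonoidHom M s)
  one_smul φ := AddMonoidHom.ext fun x => congrArg φ (one_smul S x)
  mul_smul s t φ := AddMonoidHom.ext fun x => congrArg φ (by
    change (s * t) • x = t • s • x
    rw [mul_comm, mul_smul])
  smul_zero _ := AddMonoidHom.ext fun _ => rfl
  smul_add _ _ _ := AddMonoidHom.ext fun _ => rfl
  add_smul s t φ := AddMonoidHom.ext fun x => by
    change φ ((s + t) • x) = φ (s • x) + φ (t • x)
    rw [add_smul, map_add]
  zero_smul φ := AddMonoidHom.ext fun x => by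
    change φ ((0 : S) • x) = 0
    rw [zero_smul, map_zero]

theorem DiscreteDual.smul_apply (p : ℕ) [Fact p.Prime] {S M : Type*} [CommRing S] [AddCommGroup M]
    [Module S M] (s : S) (φ : DiscreteDual p M) (x : M) : (s • φ) x = φ (s • x) := rfl

/-- The Pontryagin dual `R^∨ = Hom_cont(R, ℚ_p / ℤ_p)` of the topological ring `R`. -/
def ringDual (p : ℕ) [Fact p.Prime] (R : Type*) [CommRing R] [TopologicalSpace R]
    [IsTopologicalRing R] : Submodule R (DiscreteDual p R) where
  carrier := {f | Continuous f}
  add_mem' hf hg := Continuous.add hf hg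
  zero_mem' := continuous_const
  smul_mem' r f hf := by
    have h : Continuous fun x : R => f (r * x) := Continuous.comp hf (continuous_const_mul r)
    exact h

/-! ### Continuous cohomology in degree one, with discrete coefficients -/

section Cohomology

variable {R G H K M M' M'' : Type*} [CommRing R] [Group G] [TopologicalSpace G]
  [Group H] [TopologicalSpace H] [Group K] [TopologicalSpace K]
  [AddCommGroup M] [Module R M] [AddCommGroup M'] [Module R M'] [AddCommGroup M''] [Module R M'']

/-- Continuous (i.e. locally constant) 1-cocycles with values in the discrete module `M`. -/
def Z1 (ρ : Representation R G M) : Submodule R (G → M) where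
  carrier := {c | IsLocallyConstant c ∧ ∀ g h, c (g * h) = c g + ρ g (c h)}
  add_mem' := by
    rintro c d ⟨hc, hc'⟩ ⟨hd, hd'⟩
    refine ⟨hc.add hd, fun g h => ?_⟩
    simp only [Pi.add_apply, hc', hd', map_add]
    abel
  zero_mem' := ⟨IsLocallyConstant.const 0, fun g h => by simp⟩
  smul_mem' := by
    rintro r c ⟨hc, hc'⟩
    refine ⟨hc.comp (fun x => r • x), fun g h => ?_⟩
    simp only [Pi.smul_apply, hc', smul_add, map_smul]

/-- The 1-coboundaries `g ↦ g m - m` among the continuous 1-cocycles. -/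
def B1 (ρ : Representation R G M) : Submodule R (Z1 ρ) where
  carrier := {c | ∃ m : M, ∀ g, c.1 g = ρ g m - m}
  add_mem' := by
    rintro c d ⟨m, hm⟩ ⟨n, hn⟩
    refine ⟨m + n, fun g => ?_⟩
    simp only [Submodule.coe_add, Pi.add_apply, hm, hn, map_add]
    abel
  zero_mem' := ⟨0, fun g => by simp⟩
  smul_mem' := by
    rintro r c ⟨m, hm⟩
    refine ⟨r • m, fun g => ?_⟩
    simp only [Submodule.coe_smul, Pi.smul_apply, hm, map_smul, smul_sub]

/-- `H¹(G, M)`: continuous 1-cocycles modulo coboundaries. -/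
abbrev H1 (ρ : Representation R G M) : Type _ := Z1 ρ ⧸ B1 ρ

/-- The map on cocycles `c ↦ f ∘ c ∘ φ` induced by a compatible pair `(φ, f)`. -/
def Z1.map {ρ : Representation R G M} {ρ' : Representation R H M'} (φ : H →* G)
    (hφ : Continuous φ) (f : M →ₗ[R] M') (hf : ∀ h m, f (ρ (φ h) m) = ρ' h (f m)) :
    Z1 ρ →ₗ[R] Z1 ρ' where
  toFun c := ⟨fun h => f (c.1 (φ h)),
    (c.2.1.comp_continuous hφ).comp f, fun g h => by
      change f (c.1 (φ (g * h))) = f (c.1 (φ g)) + ρ' g (f (c.1 (φ h)))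
      rw [map_mul, c.2.2, map_add, hf]⟩
  map_add' c d := Subtype.ext (funext fun h => map_add f _ _)
  map_smul' r c := Subtype.ext (funext fun h => map_smul f _ _)

/-- The map on `H¹` induced by a continuous homomorphism `φ : H → G` and a linear map
`f : M → M'` that is compatible with the actions. -/
def H1.map {ρ : Representation R G M} {ρ' : Representation R H M'} (φ : H →* G)
    (hφ : Continuous φ) (f : M →ₗ[R] M') (hf : ∀ h m, f (ρ (φ h) m) = ρ' h (f m)) :
    H1 ρ →ₗ[R] H1 ρ' :=
  Submodule.mapQ (B1 ρ) (B1 ρ') (Z1.map φ hφ f hf) (by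
    rintro c ⟨m, hm⟩
    refine ⟨f m, fun h => ?_⟩
    change f (c.1 (φ h)) = _
    rw [hm, map_sub, hf])

theorem H1.map_map {ρ : Representation R G M} {ρ' : Representation R H M'}
    {ρ'' : Representation R K M''} (φ : H →* G)
    (hφ : Continuous φ) (f : M →ₗ[R] M') (hf : ∀ h m, f (ρ (φ h) m) = ρ' h (f m))
    (ψ : K →* H) (hψ : Continuous ψ) (f' : M' →ₗ[R] M'')
    (hf' : ∀ h m, f' (ρ' (ψ h) m) = ρ'' h (f' m)) (x : H1 ρ) :
    H1.map ψ hψ f' hf' (H1.map φ hφ f hf x) =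
      H1.map (φ.comp ψ) (hφ.comp hψ) (f'.comp f) (fun h m => by
        simp only [MonoidHom.comp_apply, LinearMap.comp_apply, hf, hf']) x := by
  induction x using Submodule.Quotient.induction_on with
  | H c => rfl

theorem H1.map_congr {ρ : Representation R G M} {ρ' : Representation R H M'} {φ ψ : H →* G}
    {hφ : Continuous φ} {hψ : Continuous ψ} {f f' : M →ₗ[R] M'}
    {hf : ∀ h m, f (ρ (φ h) m) = ρ' h (f m)} {hf' : ∀ h m, f' (ρ (ψ h) m) = ρ' h (f' m)}
    (h₁ : φ = ψ) (h₂ : f = f') (x : H1 ρ) : H1.map φ hφ f hf x = H1.map ψ hψ f' hf' x := by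
  subst h₁ h₂
  rfl

/-- Restriction of a representation to a subgroup. -/
abbrev resRep (ρ : Representation R G M) (N : Subgroup G) : Representation R N M :=
  ρ.comp N.subtype

/-- The restriction map `H¹(N, M) → H¹(N', M)` for subgroups `N' ≤ N`. -/
def H1.res (ρ : Representation R G M) {N N' : Subgroup G} (h : N' ≤ N) :
    H1 (resRep ρ N) →ₗ[R] H1 (resRep ρ N') :=
  H1.map (Subgroup.inclusion h) (continuous_inclusion h) LinearMap.id (fun _ _ => rfl)

variable [IsTopologicalGroup G]

/-- Conjugation by `g` on `H¹(N, M)` for a normal subgroup `N`: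
`(g · c)(h) = g c(g⁻¹ h g)`. -/
def H1.conj (ρ : Representation R G M) (N : Subgroup G) [N.Normal] (g : G) :
    H1 (resRep ρ N) →ₗ[R] H1 (resRep ρ N) :=
  H1.map (MulAut.conjNormal g⁻¹ : MulAut N).toMonoidHom
    (by
      refine Continuous.subtype_mk (f := fun h : N => g⁻¹ * (h : G) * g⁻¹⁻¹) ?_ _
      fun_prop)
    (ρ g) (fun h m => by
      change ρ g (ρ (g⁻¹ * (h : G) * g⁻¹⁻¹) m) = ρ (h : G) (ρ g m)
      rw [← Module.End.mul_apply, ← Module.End.mul_apply, ← map_mul, ← map_mul]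
      congr 2
      group)

/-- The conjugation action of `G` on `H¹(N, M)`. -/
def H1.conjRep (ρ : Representation R G M) (N : Subgroup G) [N.Normal] :
    Representation R G (H1 (resRep ρ N)) where
  toFun := H1.conj ρ N
  map_one' := LinearMap.ext fun x => by
    induction x using Submodule.Quotient.induction_on with
    | H c =>
      refine congrArg (Submodule.Quotient.mk (p := B1 (resRep ρ N))) (Subtype.ext (funext fun h => ?_))
      change ρ 1 (c.1 (MulAut.conjNormal (1 : G)⁻¹ h)) = c.1 h
      simp
  map_mul' g g' := LinearMap.ext fun x => by
    refine Eq.trans ?_ (H1.map_map _ _ _ _ _ _ _ _ x).symm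
    refine H1.map_congr ?_ (map_mul ρ g g') x
    ext h
    change ((g * g')⁻¹ * (h : G) * (g * g')⁻¹⁻¹) = g'⁻¹ * (g⁻¹ * (h : G) * g⁻¹⁻¹) * g'⁻¹⁻¹
    group

/-- `N` itself acts trivially on `H¹(N, M)`. -/
theorem H1.conjRep_of_mem (ρ : Representation R G M) (N : Subgroup G) [N.Normal] {g : G}
    (hg : g ∈ N) (x : H1 (resRep ρ N)) : H1.conjRep ρ N g x = x := by
  induction x using Submodule.Quotient.induction_on with
  | H c =>
    refine (Submodule.Quotient.eq (B1 (resRep ρ N))).2 ⟨c.1 ⟨g, hg⟩, fun h => ?_⟩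
    change ρ g (c.1 (MulAut.conjNormal g⁻¹ h)) - c.1 h = ρ h (c.1 ⟨g, hg⟩) - c.1 ⟨g, hg⟩
    have e : (⟨g, hg⟩ : N) * MulAut.conjNormal g⁻¹ h = h * ⟨g, hg⟩ := by
      ext
      simp [mul_assoc]
    have e' := congrArg c.1 e
    rw [c.2.2, c.2.2] at e'
    change c.1 ⟨g, hg⟩ + ρ g _ = c.1 h + ρ h _ at e'
    rw [sub_eq_sub_iff_add_eq_add, add_comm, e', add_comm]

end Cohomology

/-! ### Local Galois groups -/

section Local

variable {F : Type*} [Field F] [NumberField F]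

/-- An algebraic closure of the completion `F_v`. -/
abbrev LocalClosure (v : HeightOneSpectrum (𝓞 F)) : Type _ := AlgebraicClosure (v.adicCompletion F)

/-- The local Galois group `G_v = Gal(F̄_v / F_v)`. -/
abbrev LocalGal (v : HeightOneSpectrum (𝓞 F)) : Type _ :=
  Gal(LocalClosure v/(v.adicCompletion F))

/-- The global Galois group `G_F = Gal(F̄ / F)`. -/
abbrev GlobalGal (F : Type*) [Field F] : Type _ := Gal(AlgebraicClosure F/F)

/-- The ring of integers of `F̄_v`. -/
abbrev LocalIntegers (v : HeightOneSpectrum (𝓞 F)) :=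
  integralClosure (v.adicCompletionIntegers F) (LocalClosure v)

/-- The maximal ideal of the local ring of integers of `F̄_v`. -/
def localMaxIdeal (v : HeightOneSpectrum (𝓞 F)) : Ideal (LocalIntegers v) :=
  Ring.jacobson (LocalIntegers v)

/-- The inertia subgroup `I_v` of `G_v`. -/
def inertia (v : HeightOneSpectrum (𝓞 F)) : Subgroup (LocalGal v) :=
  (localMaxIdeal v).inertia (LocalGal v)

/-- `σ ∈ G_v` is a Frobenius: it acts as `x ↦ x ^ q_v` modulo the maximal ideal. -/
def IsFrobenius (v : HeightOneSpectrum (𝓞 F)) (σ : LocalGal v) : Prop :=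
  IsArithFrobAt (v.adicCompletionIntegers F) σ (localMaxIdeal v)

/-- A choice of `F`-embeddings `F̄ → F̄_v` for all finite places `v`. -/
abbrev Embeddings (F : Type*) [Field F] [NumberField F] : Type _ :=
  ∀ v : HeightOneSpectrum (𝓞 F), AlgebraicClosure F →ₐ[F] LocalClosure v

/-- The homomorphism `G_v → G_F` attached to an embedding `F̄ → F̄_v`: it restricts automorphisms
to (the image of) `F̄`. -/
def decomp (ι : Embeddings F) (v : HeightOneSpectrum (𝓞 F)) : LocalGal v →* GlobalGal F :=
  letI := (ι v).toRingHom.toAlgebra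
  haveI : IsScalarTower F (AlgebraicClosure F) (LocalClosure v) :=
    IsScalarTower.of_algebraMap_eq fun x => ((ι v).commutes x).symm
  (AlgEquiv.restrictNormalHom (F := F) (K₁ := LocalClosure v) (AlgebraicClosure F)).comp
    (MonoidHom.mk' (fun σ : LocalGal v => σ.restrictScalars F) fun _ _ => rfl)

theorem decomp_apply (ι : Embeddings F) (v : HeightOneSpectrum (𝓞 F)) (σ : LocalGal v)
    (x : AlgebraicClosure F) : ι v (decomp ι v σ x) = σ (ι v x) := by
  let _ := (ι v).toRingHom.toAlgebra
  have : IsScalarTower F (AlgebraicClosure F) (LocalClosure v) :=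
    IsScalarTower.of_algebraMap_eq fun x => ((ι v).commutes x).symm
  exact AlgEquiv.restrictNormal_commutes (σ.restrictScalars F) (AlgebraicClosure F) x

theorem continuous_decomp (ι : Embeddings F) (v : HeightOneSpectrum (𝓞 F)) :
    Continuous (decomp ι v) := by
  refine continuous_of_continuousAt_one _ ?_
  intro U hU
  rw [map_one] at hU
  obtain ⟨E, hE, hEU⟩ := (krullTopology_mem_nhds_one_iff F (AlgebraicClosure F) U).1 hU
  obtain ⟨s, hs⟩ := (IntermediateField.essFiniteType_iff (K := E)).1 inferInstance
  rw [Filter.mem_map]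
  have hopen : (⋂ x ∈ s, (MulAction.stabilizer (LocalGal v) (ι v x) : Set (LocalGal v))) ∈
      nhds (1 : LocalGal v) := by
    refine (Filter.biInter_finset_mem s).2 fun x _ => ?_
    exact (stabilizer_isOpen_of_isIntegral (K := v.adicCompletion F) (ι v x)).mem_nhds
      (one_mem (MulAction.stabilizer (LocalGal v) (ι v x)))
  refine Filter.mem_of_superset hopen fun σ hσ => hEU ?_
  simp only [Set.mem_iInter, SetLike.mem_coe, MulAction.mem_stabilizer_iff] at hσ
  have h1 : ∀ x ∈ (s : Set (AlgebraicClosure F)), decomp ι v σ • x = x := fun x hx =>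
    (ι v).injective ((decomp_apply ι v σ x).trans (hσ x hx))
  rw [SetLike.mem_coe, IntermediateField.mem_fixingSubgroup_iff]
  intro x hx
  rw [← hs] at hx
  exact (IntermediateField.forall_mem_adjoin_smul_eq_self_iff F (decomp ι v σ)).2 h1 x hx

/-- The finite place `v` of `F` divides `p`. -/
def Above (p : ℕ) (v : HeightOneSpectrum (𝓞 F)) : Prop := (p : 𝓞 F) ∈ v.asIdeal

end Local

/-! ### `ℤ_p`-extensions and Iwasawa algebras -/

/-- A `ℤ_p`-extension `F_∞ / F` inside `F̄`. -/
structure ZpExtension (p : ℕ) [Fact p.Prime] (F : Type*) [Field F] where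
  /-- the field `F_∞` -/
  top : IntermediateField F (AlgebraicClosure F)
  isGalois : IsGalois F top
  galois_iso : Nonempty (Gal(top/F) ≃ₜ* Multiplicative ℤ_[p])

namespace ZpExtension

variable {p : ℕ} [Fact p.Prime] {F : Type*} [Field F] (E : ZpExtension p F)

instance : IsGalois F E.top := E.isGalois

/-- The `n`-th layer `F_n`: the subfield of `F_∞` fixed by `G_∞ ^ (p ^ n)`. -/
def layer (n : ℕ) : IntermediateField F (AlgebraicClosure F) :=
  IntermediateField.lift (IntermediateField.fixedField
    (Subgroup.closure (Set.range fun g : Gal(E.top/F) => g ^ p ^ n)))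

/-- `G_{F_n} = Gal(F̄ / F_n)`, as a subgroup of `G_F`. -/
def N (n : ℕ) : Subgroup (GlobalGal F) := (E.layer n).fixingSubgroup

theorem mem_layer {n : ℕ} {x : AlgebraicClosure F} :
    x ∈ E.layer n ↔ ∃ h : x ∈ E.top, ∀ g : Gal(E.top/F), (g ^ p ^ n) ⟨x, h⟩ = ⟨x, h⟩ := by
  constructor
  · rintro ⟨y, hy, rfl⟩
    exact ⟨y.2, fun g => hy ⟨_, Subgroup.subset_closure ⟨g, rfl⟩⟩⟩
  · rintro ⟨h, hx⟩
    refine ⟨⟨x, h⟩, ?_, rfl⟩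
    rintro ⟨g, hg⟩
    change g ⟨x, h⟩ = ⟨x, h⟩
    induction hg using Subgroup.closure_induction with
    | mem g hg => obtain ⟨g, rfl⟩ := hg; exact hx g
    | one => rfl
    | mul a b _ _ ha hb => rw [AlgEquiv.mul_apply, hb, ha]
    | inv a _ ha =>
      calc a⁻¹ ⟨x, h⟩ = a⁻¹ (a ⟨x, h⟩) := by rw [ha]
        _ = _ := by rw [← AlgEquiv.mul_apply, inv_mul_cancel]; rfl

theorem apply_mem_layer {n : ℕ} (g : GlobalGal F) {x : AlgebraicClosure F} (hx : x ∈ E.layer n) :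
    g x ∈ E.layer n := by
  obtain ⟨h, hx⟩ := E.mem_layer.1 hx
  have e : g x = (AlgEquiv.restrictNormalHom E.top g ⟨x, h⟩ : E.top) :=
    (AlgEquiv.restrictNormalHom_apply E.top g ⟨x, h⟩).symm
  set τ := AlgEquiv.restrictNormalHom E.top g
  refine E.mem_layer.2 ⟨e ▸ (τ ⟨x, h⟩).2, fun k => ?_⟩
  have e' : (⟨g x, e ▸ (τ ⟨x, h⟩).2⟩ : E.top) = τ ⟨x, h⟩ := Subtype.ext e
  rw [e']
  have := congrArg τ (hx (τ⁻¹ * k * τ))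
  have hc := conj_pow (i := p ^ n) (a := τ⁻¹) (b := k)
  rw [inv_inv] at hc
  rw [hc, ← AlgEquiv.mul_apply, ← mul_assoc, ← mul_assoc, mul_inv_cancel, one_mul,
    AlgEquiv.mul_apply] at this
  exact this

instance (n : ℕ) : (E.N n).Normal where
  conj_mem h hh g := by
    refine (IntermediateField.mem_fixingSubgroup_iff _ _).2 fun x hx => ?_
    have := (IntermediateField.mem_fixingSubgroup_iff _ _).1 hh _ (E.apply_mem_layer g⁻¹ hx)
    change g (h (g⁻¹ x)) = x
    have e : h (g⁻¹ x) = g⁻¹ x := this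
    rw [e, ← AlgEquiv.mul_apply, mul_inv_cancel]
    rfl

theorem layer_mono {n m : ℕ} (h : n ≤ m) : E.layer n ≤ E.layer m := by
  intro x hx
  obtain ⟨hx', H⟩ := E.mem_layer.1 hx
  refine E.mem_layer.2 ⟨hx', fun g => ?_⟩
  obtain ⟨k, rfl⟩ := Nat.exists_eq_add_of_le h
  rw [pow_add, mul_comm, pow_mul]
  exact H (g ^ p ^ k)

theorem N_antitone {n m : ℕ} (h : n ≤ m) : E.N m ≤ E.N n :=
  IntermediateField.fixingSubgroup_antitone (E.layer_mono h)

/-- `G_n = Gal(F_n / F)`, realised as `Gal(F̄ / F) ⧸ Gal(F̄ / F_n)`. -/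
abbrev layerGal (n : ℕ) : Type _ := GlobalGal F ⧸ E.N n

instance (n : ℕ) : CommGroup (E.layerGal n) where
  __ := (inferInstance : Group (GlobalGal F ⧸ E.N n))
  mul_comm := by
    rintro ⟨a⟩ ⟨b⟩
    refine QuotientGroup.eq.2 ((IntermediateField.mem_fixingSubgroup_iff _ _).2 fun x hx => ?_)
    obtain ⟨h, -⟩ := E.mem_layer.1 hx
    obtain ⟨e⟩ := E.galois_iso
    have hab : AlgEquiv.restrictNormalHom E.top ((a * b)⁻¹ * (b * a)) = 1 := by
      have hcomm : ∀ s t : Gal(E.top/F), s * t = t * s := fun s t => e.injective (by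
        rw [map_mul, map_mul, mul_comm])
      rw [map_mul, map_inv, map_mul, map_mul, hcomm (AlgEquiv.restrictNormalHom E.top a),
        inv_mul_cancel]
    have := AlgEquiv.restrictNormalHom_apply E.top ((a * b)⁻¹ * (b * a)) ⟨x, h⟩
    rw [hab] at this
    exact this.symm

/-- The projection `R[G_m] → R[G_n]` for `n ≤ m`. -/
def groupRingProj (R : Type*) [CommRing R] {n m : ℕ} (h : n ≤ m) :
    MonoidAlgebra R (E.layerGal m) →+* MonoidAlgebra R (E.layerGal n) :=
  MonoidAlgebra.mapDomainRingHom R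
    (QuotientGroup.map (E.N m) (E.N n) (MonoidHom.id _) (E.N_antitone h))

/-- The Iwasawa algebra `Λ_R = R⟦G_∞⟧ = lim_n R[G_n]`. -/
def iwasawaAlgebra (R : Type*) [CommRing R] :
    Subring (∀ n : ℕ, MonoidAlgebra R (E.layerGal n)) where
  carrier := {x | ∀ n m (h : n ≤ m), E.groupRingProj R h (x m) = x n}
  mul_mem' hx hy n m h := by simp only [Pi.mul_apply, map_mul, hx n m h, hy n m h]
  one_mem' n m h := map_one _
  add_mem' hx hy n m h := by simp only [Pi.add_apply, map_add, hx n m h, hy n m h]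
  zero_mem' n m h := map_zero _
  neg_mem' hx n m h := by simp only [Pi.neg_apply, map_neg, hx n m h]

/-- The projection `Λ_R → R[G_n]`. -/
def iwasawaProj (R : Type*) [CommRing R] (n : ℕ) :
    E.iwasawaAlgebra R →+* MonoidAlgebra R (E.layerGal n) :=
  (Pi.evalRingHom _ n).comp (E.iwasawaAlgebra R).subtype

end ZpExtension

/-- `F_∞ / F` is unramified at all finite places not dividing `p`: inertia acts trivially. -/
def UnramifiedOutsideP {p : ℕ} [Fact p.Prime] {F : Type*} [Field F] [NumberField F]
    (E : ZpExtension p F) (ι : Embeddings F) : Prop :=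
  ∀ v : HeightOneSpectrum (𝓞 F), ¬ Above p v → ∀ σ ∈ inertia v,
    decomp ι v σ ∈ E.top.fixingSubgroup

/-- `F_∞ / F` is totally ramified at all places dividing `p`: inertia surjects onto
`Gal(F_∞ / F)`. -/
def TotallyRamifiedAtP {p : ℕ} [Fact p.Prime] {F : Type*} [Field F] [NumberField F]
    (E : ZpExtension p F) (ι : Embeddings F) : Prop :=
  ∀ v : HeightOneSpectrum (𝓞 F), Above p v → ∀ τ : Gal(E.top/F), ∃ σ ∈ inertia v,
    AlgEquiv.restrictNormalHom E.top (decomp ι v σ) = τ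

/-! ### Pseudo-null modules -/

/-- A `Λ`-module is pseudo-null if its support contains only primes of height at least `2`. -/
def IsPseudoNull (Λ : Type*) [CommRing Λ] (X : Type*) [AddCommGroup X] [Module Λ X] : Prop :=
  ∀ P ∈ Module.support Λ X, 2 ≤ P.asIdeal.height

/-- The `S`-module `X` is pseudo-null when regarded as a `Λ`-module through `π : Λ → S`. This is
used for `Λ_R → R[G_n]`: on a module on which `Gal(F_∞ / F_n)` acts trivially, `Λ_R` acts through
`R[G_n]`. -/
def IsPseudoNullVia {Λ S : Type*} [CommRing Λ] [Semiring S] (π : Λ →+* S)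
    (X : Type*) [AddCommGroup X] [Module S X] : Prop :=
  letI := Module.compHom X π
  IsPseudoNull Λ X

/-! ### The discrete Galois module `A` and its filtrations -/

section Selmer

variable {p : ℕ} [Fact p.Prime] {F : Type*} [Field F] [NumberField F]
  {R : Type*} [CommRing R] [TopologicalSpace R] [IsTopologicalRing R]
  {T : Type*} [AddCommGroup T] [Module R T]

variable (p R T) in
/-- `A = Φ(T) = T ⊗_R R^∨`, a discrete module. -/
abbrev DiscMod : Type _ := T ⊗[R] (ringDual p R)

variable (p) in
/-- The action on `A = T ⊗ R^∨` through `T`. -/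
def discRep {G : Type*} [Group G] (ρ : Representation R G T) :
    Representation R G (DiscMod p R T) where
  toFun g := (ρ g).rTensor (ringDual p R)
  map_one' := by rw [map_one]; exact LinearMap.rTensor_id _ _
  map_mul' g h := by rw [map_mul]; exact LinearMap.rTensor_mul _ _ _

variable (p) in
/-- Filtrations `0 → F_v^+(T) → T → F_v^-(T) → 0` of `G_v`-modules for all `v ∣ p`. Here
`G_v` acts on `T` through `G_v → G_F`. -/
structure Filtration (ρ : Representation R (GlobalGal F) T) (ι : Embeddings F) where
  /-- the submodule `F_v^+(T)` -/
  plus : ∀ v : HeightOneSpectrum (𝓞 F), Above p v → Submodule R T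
  stable : ∀ v hv (σ : LocalGal v), plus v hv ≤ (plus v hv).comap (ρ (decomp ι v σ))

variable {ρ : Representation R (GlobalGal F) T} {ι : Embeddings F}

/-- `F_v^+(A)`, the image of `F_v^+(T) ⊗ R^∨` in `A`. -/
def Filtration.plusA (Fil : Filtration p ρ ι) (v : HeightOneSpectrum (𝓞 F)) (hv : Above p v) :
    Submodule R (DiscMod p R T) :=
  LinearMap.range ((Fil.plus v hv).subtype.rTensor (ringDual p R))

theorem Filtration.plusA_stable (Fil : Filtration p ρ ι) (v : HeightOneSpectrum (𝓞 F))
    (hv : Above p v) (σ : LocalGal v) :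
    Fil.plusA v hv ≤ (Fil.plusA v hv).comap (((discRep p ρ).comp (decomp ι v)) σ) := by
  rintro _ ⟨y, rfl⟩
  refine ⟨((ρ (decomp ι v σ)).restrict (Fil.stable v hv σ)).rTensor (ringDual p R) y, ?_⟩
  change _ = ((ρ (decomp ι v σ)).rTensor _) _
  rw [← LinearMap.comp_apply, ← LinearMap.comp_apply, ← LinearMap.rTensor_comp,
    ← LinearMap.rTensor_comp]
  rfl

/-- The `G_v`-module `A / F_v^+(A)`. -/
def Filtration.minusRep (Fil : Filtration p ρ ι) (v : HeightOneSpectrum (𝓞 F)) (hv : Above p v) :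
    Representation R (LocalGal v) (DiscMod p R T ⧸ Fil.plusA v hv) :=
  Representation.quotient ((discRep p ρ).comp (decomp ι v)) (Fil.plusA v hv)
    (Fil.plusA_stable v hv)

/-! ### Strict Selmer groups

For a normal subgroup `N = Gal(F̄ / L)` of `G_F`, the Galois group of the completion of `L` at the
place given by `F̄ → F̄_v` is the preimage of `N` in `G_v`, and its inertia group is the
intersection of this preimage with `I_v`. The remaining places of `L` above `v` are
obtained by conjugation with the elements `g ∈ G_F`. -/

/-- `Gal(F̄_v / L_w)`, where `N = Gal(F̄ / L)`. -/
abbrev localSubgroup (ι : Embeddings F) (N : Subgroup (GlobalGal F))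
    (v : HeightOneSpectrum (𝓞 F)) : Subgroup (LocalGal v) :=
  N.comap (decomp ι v)

/-- The inertia subgroup of `Gal(F̄_v / L_w)`, where `N = Gal(F̄ / L)`. -/
abbrev localInertia (ι : Embeddings F) (N : Subgroup (GlobalGal F))
    (v : HeightOneSpectrum (𝓞 F)) : Subgroup (LocalGal v) :=
  inertia v ⊓ localSubgroup ι N v

/-- The homomorphism `H → N` induced by `G_v → G_F`, for `H` contained in the preimage of `N`. -/
def localToGlobal (ι : Embeddings F) (N : Subgroup (GlobalGal F)) (v : HeightOneSpectrum (𝓞 F))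
    (H : Subgroup (LocalGal v)) (hH : H ≤ localSubgroup ι N v) : H →* N :=
  ((decomp ι v).comp H.subtype).codRestrict N fun h => hH h.2

theorem continuous_localToGlobal (ι : Embeddings F) (N : Subgroup (GlobalGal F))
    (v : HeightOneSpectrum (𝓞 F)) (H : Subgroup (LocalGal v)) (hH : H ≤ localSubgroup ι N v) :
    Continuous (localToGlobal ι N v H hH) :=
  ((continuous_decomp ι v).comp continuous_subtype_val).subtype_mk _

variable (p ρ ι) in
/-- `H¹(L, A) → H¹(I_w, A)`, where `N = Gal(F̄ / L)`. -/
def resInertia (N : Subgroup (GlobalGal F)) (v : HeightOneSpectrum (𝓞 F)) :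
    H1 (resRep (discRep p ρ) N) →ₗ[R]
      H1 (resRep ((discRep p ρ).comp (decomp ι v)) (localInertia ι N v)) :=
  H1.map (localToGlobal ι N v _ inf_le_right) (continuous_localToGlobal ι N v _ _) LinearMap.id
    (fun _ _ => rfl)

/-- `H¹(L, A) → H¹(L_w, A / F_v^+(A))`, where `N = Gal(F̄ / L)`. -/
def Filtration.resMinus (Fil : Filtration p ρ ι) (N : Subgroup (GlobalGal F))
    (v : HeightOneSpectrum (𝓞 F)) (hv : Above p v) :
    H1 (resRep (discRep p ρ) N) →ₗ[R] H1 (resRep (Fil.minusRep v hv) (localSubgroup ι N v)) :=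
  H1.map (localToGlobal ι N v _ le_rfl) (continuous_localToGlobal ι N v _ _)
    (Fil.plusA v hv).mkQ (fun _ _ => rfl)

/-- The strict Greenberg Selmer group `Sel_str(L, A)`, where `N = Gal(F̄ / L)`. -/
def Filtration.sel (Fil : Filtration p ρ ι) (N : Subgroup (GlobalGal F)) [N.Normal] :
    Submodule R (H1 (resRep (discRep p ρ) N)) where
  carrier := {c | ∀ g : GlobalGal F,
    (∀ v, ¬ Above p v → resInertia p ρ ι N v (H1.conjRep (discRep p ρ) N g c) = 0) ∧
    (∀ v (hv : Above p v), Fil.resMinus N v hv (H1.conjRep (discRep p ρ) N g c) = 0)}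
  add_mem' hc hd g :=
    ⟨fun v hv => by rw [map_add, map_add, (hc g).1 v hv, (hd g).1 v hv, add_zero],
      fun v hv => by rw [map_add, map_add, (hc g).2 v hv, (hd g).2 v hv, add_zero]⟩
  zero_mem' g := ⟨fun v _ => by rw [map_zero, map_zero], fun v hv => by rw [map_zero, map_zero]⟩
  smul_mem' r c hc g :=
    ⟨fun v hv => by rw [map_smul, map_smul, (hc g).1 v hv, smul_zero],
      fun v hv => by rw [map_smul, map_smul, (hc g).2 v hv, smul_zero]⟩

/-- The action of `G_F` on `Sel_str(L, A)`, where `N = Gal(F̄ / L)`. -/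
def Filtration.selRep (Fil : Filtration p ρ ι) (N : Subgroup (GlobalGal F)) [N.Normal] :
    Representation R (GlobalGal F) (Fil.sel N) :=
  Representation.subrepresentation (H1.conjRep (discRep p ρ) N) (Fil.sel N) (by
    intro g c hc g'
    have e : H1.conjRep (discRep p ρ) N g' (H1.conjRep (discRep p ρ) N g c) =
        H1.conjRep (discRep p ρ) N (g' * g) c := by
      rw [map_mul, Module.End.mul_apply]
    rw [e]
    exact hc (g' * g))

instance (Fil : Filtration p ρ ι) (N : Subgroup (GlobalGal F)) [N.Normal] :
    Representation.IsTrivial ((Fil.selRep N).comp N.subtype) where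
  out g := LinearMap.ext fun c => Subtype.ext (H1.conjRep_of_mem (discRep p ρ) N g.2 c.1)

/-- Restriction commutes with conjugation. -/
theorem res_conjRep {F R T : Type*} [Field F] [CommRing R] [TopologicalSpace R]
    [IsTopologicalRing R] [AddCommGroup T] [Module R T]
    {ρ : Representation R (GlobalGal F) T} (N N' : Subgroup (GlobalGal F)) [N.Normal] [N'.Normal] (h : N' ≤ N)
    (g : GlobalGal F) (c : H1 (resRep (discRep p ρ) N)) :
    H1.res (discRep p ρ) h (H1.conjRep (discRep p ρ) N g c) =
      H1.conjRep (discRep p ρ) N' g (H1.res (discRep p ρ) h c) := by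
  induction c using Submodule.Quotient.induction_on with
  | H c => rfl

theorem resInertia_res (N N' : Subgroup (GlobalGal F)) (h : N' ≤ N)
    (v : HeightOneSpectrum (𝓞 F)) (c : H1 (resRep (discRep p ρ) N)) :
    resInertia p ρ ι N' v (H1.res (discRep p ρ) h c) =
      H1.res ((discRep p ρ).comp (decomp ι v)) (inf_le_inf_left _ (Subgroup.comap_mono h))
        (resInertia p ρ ι N v c) := by
  induction c using Submodule.Quotient.induction_on with
  | H c => rfl

theorem Filtration.resMinus_res (Fil : Filtration p ρ ι) (N N' : Subgroup (GlobalGal F))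
    (h : N' ≤ N) (v : HeightOneSpectrum (𝓞 F)) (hv : Above p v)
    (c : H1 (resRep (discRep p ρ) N)) :
    Fil.resMinus N' v hv (H1.res (discRep p ρ) h c) =
      H1.res (Fil.minusRep v hv) (Subgroup.comap_mono h) (Fil.resMinus N v hv c) := by
  induction c using Submodule.Quotient.induction_on with
  | H c => rfl

/-- The restriction map `Sel_str(L, A) → Sel_str(L', A)` for `L ⊆ L'`. -/
def Filtration.selRes (Fil : Filtration p ρ ι) (N N' : Subgroup (GlobalGal F)) [N.Normal]
    [N'.Normal] (h : N' ≤ N) : Fil.sel N →ₗ[R] Fil.sel N' :=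
  (H1.res (discRep p ρ) h).restrict (by
    intro c hc g
    rw [← res_conjRep]
    refine ⟨fun v hv => ?_, fun v hv => ?_⟩
    · rw [resInertia_res, (hc g).1 v hv, map_zero]
    · rw [Fil.resMinus_res, (hc g).2 v hv, map_zero])

theorem Filtration.selRep_selRes (Fil : Filtration p ρ ι) (N N' : Subgroup (GlobalGal F))
    [N.Normal] [N'.Normal] (h : N' ≤ N) (g : GlobalGal F) :
    Fil.selRep N' g ∘ₗ Fil.selRes N N' h = Fil.selRes N N' h ∘ₗ Fil.selRep N g :=
  LinearMap.ext fun c => Subtype.ext (res_conjRep N N' h g c.1).symm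

/-! ### The Selmer group over `F_∞` and the restriction map -/

variable (Fil : Filtration p ρ ι) (E : ZpExtension p F)

/-- `Sel_str(F_n, A)`. -/
abbrev Filtration.selLayer (n : ℕ) : Type _ := Fil.sel (E.N n)

/-- `Sel_str(F_∞, A) = colim_n Sel_str(F_n, A)`. -/
abbrev Filtration.selTop : Type _ :=
  Module.DirectLimit (fun n : ℕ => Fil.selLayer E n)
    (fun _ _ h => Fil.selRes _ _ (E.N_antitone h))

instance : AddCommGroup (Fil.selTop E) := Module.addCommMonoidToAddCommGroup R

/-- The canonical map `Sel_str(F_n, A) → Sel_str(F_∞, A)`. -/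
def Filtration.toSelTop (n : ℕ) : Fil.selLayer E n →ₗ[R] Fil.selTop E :=
  Module.DirectLimit.of R ℕ (fun n : ℕ => Fil.selLayer E n)
    (fun _ _ h => Fil.selRes _ _ (E.N_antitone h)) n

/-- The action of `G_F` (through `Gal(F_∞ / F)`) on `Sel_str(F_∞, A)`. -/
def Filtration.selTopRep : Representation R (GlobalGal F) (Fil.selTop E) where
  toFun g := Module.DirectLimit.map (fun n => Fil.selRep (E.N n) g) (fun n m h =>
    Fil.selRep_selRes (E.N n) (E.N m) (E.N_antitone h) g)
  map_one' := by
    refine Module.DirectLimit.hom_ext fun n => LinearMap.ext fun c => ?_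
    simp
  map_mul' g h := by
    refine Module.DirectLimit.hom_ext fun n => LinearMap.ext fun c => ?_
    simp

theorem Filtration.selTopRep_toSelTop (n : ℕ) (g : GlobalGal F) (c : Fil.selLayer E n) :
    Fil.selTopRep E g (Fil.toSelTop E n c) = Fil.toSelTop E n (Fil.selRep (E.N n) g c) :=
  Module.DirectLimit.map_apply_of (fun n => Fil.selRep (E.N n) g) (fun n m h =>
    Fil.selRep_selRes (E.N n) (E.N m) (E.N_antitone h) g) c

/-- `Sel_str(F_n, A)` as a representation of `G_n = Gal(F_n / F)`. -/
def Filtration.selLayerRep (n : ℕ) : Representation R (E.layerGal n) (Fil.selLayer E n) :=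
  Representation.ofQuotient (Fil.selRep (E.N n)) (E.N n)

/-- `Sel_str(F_∞, A)^{Gal(F_∞ / F_n)}` as a representation of `G_n = Gal(F_n / F)`. The group
`Gal(F_∞ / F_n)` is the image of `Gal(F̄ / F_n)` in `Gal(F_∞ / F)`, so its invariants are those
of `Gal(F̄ / F_n)`. -/
abbrev Filtration.selTopInvRep (n : ℕ) : Representation R (E.layerGal n)
    (Representation.invariants ((Fil.selTopRep E).comp (E.N n).subtype)) :=
  Representation.quotientToInvariants (Fil.selTopRep E) (E.N n)

instance (n : ℕ) : AddCommGroup (Fil.selLayerRep E n).asModule :=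
  Module.addCommMonoidToAddCommGroup R

instance (n : ℕ) : AddCommGroup (Fil.selTopInvRep E n).asModule :=
  Module.addCommMonoidToAddCommGroup R

/-- The restriction map `Sel_str(F_n, A) → Sel_str(F_∞, A)^{Gal(F_∞ / F_n)}`, as a
homomorphism of representations of `G_n`. -/
def Filtration.resTop (n : ℕ) :
    Representation.IntertwiningMap (Fil.selLayerRep E n) (Fil.selTopInvRep E n) where
  toLinearMap := (Fil.toSelTop E n).codRestrict _ (by
    rintro c g
    have e : Fil.selRep (E.N n) g c = c :=
      Subtype.ext (H1.conjRep_of_mem (discRep p ρ) (E.N n) g.2 c.1)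
    exact (Fil.selTopRep_toSelTop E n g c).trans (congrArg (Fil.toSelTop E n) e))
  isIntertwining' := by
    rintro ⟨g⟩
    refine LinearMap.ext fun c => Subtype.ext ?_
    exact (Fil.selTopRep_toSelTop E n g c).symm

/-- The restriction map `Sel_str(F_n, A) → Sel_str(F_∞, A)^{Gal(F_∞ / F_n)}`, as a
homomorphism of `R[G_n]`-modules. -/
def Filtration.resTopLinear (n : ℕ) :
    (Fil.selLayerRep E n).asModule →ₗ[MonoidAlgebra R (E.layerGal n)]
      (Fil.selTopInvRep E n).asModule :=
  Representation.IntertwiningMap.equivLinearMapAsModule _ _ (Fil.resTop E n)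

/-- The kernel of the restriction map, an `R[G_n]`-module. -/
abbrev Filtration.resKer (n : ℕ) : Type _ := LinearMap.ker (Fil.resTopLinear E n)

/-- The cokernel of the restriction map, an `R[G_n]`-module. -/
abbrev Filtration.resCoker (n : ℕ) : Type _ :=
  (Fil.selTopInvRep E n).asModule ⧸ LinearMap.range (Fil.resTopLinear E n)

variable (p ρ) in
/-- `H⁰(F_n, A)`, as an `R[G_n]`-module. If `T` is unramified outside `Σ`, then `Gal(F̄ / F_Σ)`
acts trivially on `A`, and this is `H⁰(F_Σ / F_n, A)`, the action of `Gal(F_Σ / F_n)` on `A` being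
induced from that of `Gal(F̄ / F_n)`. -/
abbrev H0Layer (n : ℕ) : Type _ :=
  (Representation.quotientToInvariants (discRep p ρ) (E.N n)).asModule

/-! ### Ordinary representations -/

/-- The character `θ` of `G_v` factors through `Gal(F_v(μ_{p^∞}) / F_v)`. -/
def FactorsThroughCyclotomic (p : ℕ) (v : HeightOneSpectrum (𝓞 F)) (θ : LocalGal v →* Rˣ) : Prop :=
  ∀ σ : LocalGal v, (∀ (k : ℕ) (ζ : LocalClosure v), ζ ^ p ^ k = 1 → σ ζ = ζ) → θ σ = 1

variable (p ρ ι) in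
/-- The running hypotheses on `(T, F_v^±(T))`, for the set of places `Sigma` and the layer `F_n`.
In `characters`, `δ = δ_v` is unramified with `δ_v(Frob_v) = u_v ≢ 1`, the character `θ = θ_v`
factors through `Gal(F_v(μ_{p^∞}) / F_v)`, and some Frobenius lift is residually trivial under
`θ_v`; the last condition is automatic if `F_v(μ_{p^∞}) / F_v` is totally ramified, or if `θ_v`
factors through the cyclotomic `ℤ_p`-extension. -/
structure IsOrdinary [IsLocalRing R] (Sigma : Set (HeightOneSpectrum (𝓞 F))) (n : ℕ) : Prop where
  /-- `T` is unramified outside `Sigma`. -/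
  unramified : ∀ v ∉ Sigma, ∀ σ ∈ inertia v, ρ (decomp ι v σ) = 1
  /-- the Pontryagin dual of `H⁰(F_Σ / F_n, A)` is pseudo-null over `Λ_R`. -/
  pseudoNull_H0 : IsPseudoNullVia (E.iwasawaProj R n) (DiscreteDual p (H0Layer p ρ E n))
  /-- `F_v^+(T)` and `F_v^-(T)` are free. -/
  free_plus : ∀ v hv, Module.Free R (Fil.plus v hv)
  free_minus : ∀ v hv, Module.Free R (T ⧸ Fil.plus v hv)
  /-- `G_v` acts on `F_v^-(T)` through `δ_v θ_v`. -/
  characters : ∀ v (hv : Above p v), ∃ δ θ : LocalGal v →* Rˣ, Continuous δ ∧ Continuous θ ∧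
    (∀ σ ∈ inertia v, δ σ = 1) ∧
    (∃ u : Rˣ, (∀ σ, IsFrobenius v σ → δ σ = u) ∧
      (u : R) - 1 ∉ IsLocalRing.maximalIdeal R) ∧
    FactorsThroughCyclotomic p v θ ∧
    (∃ σ, IsFrobenius v σ ∧ (θ σ : R) - 1 ∈ IsLocalRing.maximalIdeal R) ∧
    ∀ (σ : LocalGal v) (t : T), ρ (decomp ι v σ) t - ((δ σ * θ σ : Rˣ) : R) • t ∈ Fil.plus v hv

end Selmer

end SelmerControl

end

/-! Let γ lift a topological generator of Gal(F_∞/F), let B be the union of the H⁰(F_m, A) inside A,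
and let D = γ^(p^n) - 1 on B. The kernel of restriction is killed by a single nonzero r in R, and
the cokernel is zero.

Kernel. A class over F_n that dies over some F_m is, up to a coboundary, determined by its value at
γ^(p^n), which lies in B and matters only modulo D B. So it is enough that some r ≠ 0 kills coker D
(`ZpExtension.smul_eq_zero_of_res_eq_zero`). Pontryagin duality for R makes the dual of B a finitely
generated R-module. The dual of D acts on it with cokernel dual to ker D = H⁰(F_n, A) and kernel
dual to coker D. These two have the same rank, so if the first is torsion, so is the second, and one
r kills all of it (`exists_forall_smul_mem_range`).

Pseudo-nullity. R is a domain because it is regular, ω = γ^(p^n) - 1 is a non-zero-divisor of Λ_R,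
and Λ_R/(ω) = R[G_n] is integral over R and R-torsion-free. Hence an R[G_n]-module is pseudo-null
over Λ_R exactly when each of its elements is killed by a nonzero element of R. One direction
(`torsion_of_isPseudoNullVia`) uses Krull's principal ideal theorem, hence that Λ_R is noetherian,
and translates the hypothesis on H⁰. The other (`isPseudoNullVia_of_torsion`) builds a chain of
primes and translates back. Nonzero elements of R are non-zero-divisors of R[G_n], so the same r
gives the cotorsion statement.

Cokernel. The obstruction to descending an invariant class from F_m to F_n is an H² class of a
procyclic group with p-primary coefficients; it disappears over a higher layer
(`ZpExtension.exists_res_eq`). The descended class is still Selmer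
(`Filtration.mem_sel_of_res_mem`): away from p the inertia groups do not change along the tower, and
above p some element of G_v that fixes F_∞ acts on A/F_v^+(A) by a scalar w with w - 1 a unit, which
makes local restriction injective. That element is a Frobenius lift corrected by a suitable power of
an inertia element (`IsOrdinary.exists_minusRep_eq_smul`). -/

noncomputable section

/-! ### Regular local rings are domains -/

namespace IsRegularLocalRing

open IsLocalRing

/-- An element of `𝔪 ∖ 𝔪²` can be completed to a minimal system of generators of `𝔪`. -/
theorem exists_span_insert_eq_maximalIdeal {R : Type*} [CommRing R] [IsLocalRing R]
    [IsNoetherianRing R] {x : R} (hx : x ∈ maximalIdeal R) (hx2 : x ∉ maximalIdeal R ^ 2) :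
    ∃ t : Set R, t.Finite ∧ Ideal.span (insert x t) = maximalIdeal R ∧
      t.ncard + 1 = (maximalIdeal R).spanFinrank := by
  set V := CotangentSpace R
  set v : V := (maximalIdeal R).toCotangent ⟨x, hx⟩
  have hv : v ≠ 0 := fun h => hx2 (((maximalIdeal R).toCotangent_eq_zero ⟨x, hx⟩).1 h)
  have hli : LinearIndepOn (ResidueField R) id ({v} : Set V) :=
    LinearIndepOn.singleton hv
  set B : Set V := hli.extend (Set.subset_univ _)
  have hB : ({v} : Set V) ⊆ B := hli.subset_extend _
  let b : Module.Basis B (ResidueField R) V := Module.Basis.extend hli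
  have hBfin : B.Finite := Module.Finite.finite_basis b
  have hcard : B.ncard = (maximalIdeal R).spanFinrank := by
    rw [spanFinrank_maximalIdeal_eq_finrank_cotangentSpace, Module.finrank_eq_nat_card_basis b]
    rfl
  choose l hl using (maximalIdeal R).toCotangent_surjective
  set s : Set (maximalIdeal R) := l '' (B \ {v})
  -- Nakayama: lifts of a basis of the cotangent space generate 𝔪.
  have hs : Submodule.span R (insert ⟨x, hx⟩ s) = ⊤ := by
    rw [← CotangentSpace.span_image_eq_top_iff, Set.image_insert_eq]
    have h1 : (maximalIdeal R).toCotangent '' s = B \ {v} := by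
      rw [Set.image_image]
      simp [hl]
    rw [h1]
    change Submodule.span (ResidueField R) (insert v (B \ {v})) = ⊤
    rw [Set.insert_sdiff_singleton, Set.insert_eq_of_mem (hB rfl)]
    have := b.span_eq
    rwa [Module.Basis.range_extend] at this
  refine ⟨Subtype.val '' s, ((hBfin.sdiff).image _).image _, ?_, ?_⟩
  · have h2 := congrArg (Submodule.map (maximalIdeal R).subtype) hs
    rw [Submodule.map_span, Submodule.map_top, Submodule.range_subtype, Set.image_insert_eq] at h2
    exact h2
  · rw [Set.ncard_image_of_injective _ Subtype.val_injective,
      Set.ncard_image_of_injective _ (Function.LeftInverse.injective hl),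
      Set.ncard_sdiff_singleton_add_one (hB rfl) hBfin, hcard]

end IsRegularLocalRing

open IsLocalRing in
/-- A local ring with a prime principal ideal that contains a minimal prime, but no generator
of which lies in this minimal prime, is a domain. -/
theorem IsLocalRing.isDomain_of_span_singleton_isPrime {R : Type*} [CommRing R] [IsLocalRing R]
    [IsNoetherianRing R] {x : R} (hx : x ∈ maximalIdeal R) [hp : (Ideal.span {x}).IsPrime]
    (h : ∀ q ∈ minimalPrimes R, x ∉ q) : IsDomain R := by
  obtain ⟨q, hq, hqx⟩ := Ideal.exists_minimalPrimes_le (bot_le (a := Ideal.span {x}))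
  have hqp : q.IsPrime := hq.1.1
  have hbot : q = ⊥ := by
    -- An element of q is z x, and x ∉ q forces z ∈ q. Thus q = x q, and Nakayama gives q = 0.
    refine Submodule.eq_bot_of_le_smul_of_le_jacobson_bot (Ideal.span {x}) q
      (IsNoetherian.noetherian q) (fun y hy => ?_) ?_
    · obtain ⟨z, rfl⟩ := Ideal.mem_span_singleton'.1 (hqx hy)
      have hz : z ∈ q := (hqp.mem_or_mem hy).resolve_right (h q hq)
      rw [mul_comm]
      exact Submodule.smul_mem_smul (Ideal.mem_span_singleton_self x) hz
    · rw [IsLocalRing.jacobson_eq_maximalIdeal ⊥ bot_ne_top, Ideal.span_le,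
        Set.singleton_subset_iff]
      exact hx
  have hprime : (⊥ : Ideal R).IsPrime := hbot ▸ hqp
  exact MulEquiv.isDomain (R ⧸ (⊥ : Ideal R)) (RingEquiv.quotientBot R).symm.toMulEquiv

-- Induction on the embedding dimension. For x in 𝔪 outside 𝔪² and outside every minimal prime, R/x
-- is again regular and needs one generator fewer. So (x) is prime, and the previous lemma applies.
open IsLocalRing in
theorem IsRegularLocalRing.isDomain_of_spanFinrank_eq (d : ℕ) :
    ∀ (R : Type*) [CommRing R] [IsRegularLocalRing R], (maximalIdeal R).spanFinrank = d →
      IsDomain R := by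
  induction d with
  | zero =>
    intro R _ _ hd
    have hbot : maximalIdeal R = ⊥ :=
      (Submodule.spanFinrank_eq_zero_iff_eq_bot (IsNoetherian.noetherian _)).1 hd
    exact (IsLocalRing.isField_iff_maximalIdeal_eq.2 hbot).isDomain
  | succ d ih =>
    intro R _ _ hd
    have hdim : ((d + 1 : ℕ) : WithBot ℕ∞) = ringKrullDim R :=
      hd ▸ IsRegularLocalRing.spanFinrank_maximalIdeal
    have hsq : ¬ maximalIdeal R ≤ maximalIdeal R ^ 2 := fun hle => by
      have : maximalIdeal R = ⊥ := by
        refine Submodule.eq_bot_of_le_smul_of_le_jacobson_bot (maximalIdeal R) _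
          (IsNoetherian.noetherian _) ?_ (IsLocalRing.jacobson_eq_maximalIdeal ⊥ bot_ne_top).ge
        rwa [smul_eq_mul, ← pow_two]
      rw [this] at hd
      simp at hd
    have hmin : ∀ q ∈ minimalPrimes R, ¬ maximalIdeal R ≤ q := fun q hq hle => by
      have := hq.1.1
      have hqe : q = maximalIdeal R :=
        le_antisymm (IsLocalRing.le_maximalIdeal this.ne_top) hle
      have h0 : (maximalIdeal R).height = 0 := by
        rw [← hqe]
        exact Ideal.height_eq_zero_iff.2 hq
      rw [← maximalIdeal_height_eq_ringKrullDim, h0] at hdim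
      norm_cast at hdim
    obtain ⟨x, hx, hx2, hxq⟩ : ∃ x ∈ maximalIdeal R, x ∉ maximalIdeal R ^ 2 ∧
        ∀ q ∈ minimalPrimes R, x ∉ q := by
      classical
      by_contra! hcon
      have hfin := minimalPrimes.finite_of_isNoetherianRing R
      -- Prime avoidance over the minimal primes, which tolerates the non-prime ideal 𝔪² as an
      -- exception.
      obtain ⟨q, hq, hle⟩ := (Ideal.subset_union_prime
        (s := insert (maximalIdeal R ^ 2) hfin.toFinset) (f := id) (maximalIdeal R ^ 2)
        (maximalIdeal R ^ 2) (fun i hi h1 _ => by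
          rw [Finset.mem_insert, Set.Finite.mem_toFinset] at hi
          exact (hi.resolve_left h1).1.1)).1 (show (maximalIdeal R : Set R) ⊆ _ from fun x hx => by
            simp only [Set.mem_iUnion]
            by_cases h : x ∈ maximalIdeal R ^ 2
            · exact ⟨_, by simp, h⟩
            · obtain ⟨q, hq, hxq⟩ := hcon x hx h
              exact ⟨q, by simp [hq], hxq⟩)
      rw [Finset.mem_insert, Set.Finite.mem_toFinset] at hq
      rcases hq with rfl | hq
      · exact hsq hle
      · exact hmin q hq hle
    obtain ⟨t, htfin, hspan, hcard⟩ :=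
      IsRegularLocalRing.exists_span_insert_eq_maximalIdeal hx hx2
    let I : Ideal R := Ideal.span {x}
    have hI : I ≠ ⊤ := fun h => (maximalIdeal.isMaximal R).ne_top (top_le_iff.1 (h ▸
      (Ideal.span_singleton_le_iff_mem _).2 hx))
    have : Nontrivial (R ⧸ I) := Ideal.Quotient.nontrivial_iff.2 hI
    have hloc : IsLocalRing (R ⧸ I) :=
      IsLocalRing.of_surjective' (Ideal.Quotient.mk I) Ideal.Quotient.mk_surjective
    have hmax : maximalIdeal (R ⧸ I) = Ideal.span (Ideal.Quotient.mk I '' t) := by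
      rw [← IsLocalRing.map_maximalIdeal_of_surjective (Ideal.Quotient.mk I)
        Ideal.Quotient.mk_surjective, ← hspan, Ideal.map_span, Set.image_insert_eq,
        Ideal.Quotient.eq_zero_iff_mem.2 (Ideal.mem_span_singleton_self x),
        Ideal.span_insert_zero]
    have hle : (maximalIdeal (R ⧸ I)).spanFinrank ≤ d := by
      rw [hmax]
      refine (Submodule.spanFinrank_span_le_ncard_of_finite (htfin.image _)).trans
        ((Set.ncard_image_le htfin).trans ?_)
      omega
    have hdimle : ringKrullDim R ≤ ringKrullDim (R ⧸ I) + 1 := by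
      have := ringKrullDim_le_ringKrullDim_quotient_add_card ({x} : Finset R) (by
        rw [Finset.coe_singleton, Set.singleton_subset_iff,
          IsLocalRing.ringJacobson_eq_maximalIdeal]
        exact hx)
      rw [Finset.coe_singleton] at this
      simpa using this
    rw [← hdim, Nat.cast_add, Nat.cast_one] at hdimle
    have hdle : (d : WithBot ℕ∞) ≤ ringKrullDim (R ⧸ I) :=
      ENat.WithBot.add_le_add_one_right_iff.1 hdimle
    -- At most d generators, and dimension at least d.
    have hreg : IsRegularLocalRing (R ⧸ I) :=
      IsRegularLocalRing.of_spanFinrank_maximalIdeal_le _ ((Nat.cast_le.2 hle).trans hdle)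
    have hspan_eq : (maximalIdeal (R ⧸ I)).spanFinrank = d := by
      refine le_antisymm hle ?_
      rw [← IsRegularLocalRing.spanFinrank_maximalIdeal] at hdle
      exact_mod_cast hdle
    have := ih (R ⧸ I) hspan_eq
    have : I.IsPrime := (Ideal.Quotient.isDomain_iff_prime I).1 this
    exact IsLocalRing.isDomain_of_span_singleton_isPrime hx hxq

/-- A regular local ring is a domain. -/
theorem IsRegularLocalRing.isDomain (R : Type*) [CommRing R] [IsRegularLocalRing R] :
    IsDomain R :=
  IsRegularLocalRing.isDomain_of_spanFinrank_eq _ R rfl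

namespace SelmerControl

/-! ### The group `ℚ_p / ℤ_p` -/

namespace QpZp

variable (p : ℕ) [hp : Fact p.Prime]

/-- Divisibility gives injectivity by Baer's criterion, which is how characters are extended from
subgroups. -/
instance : DivisibleBy (QpZp p) ℤ :=
  divisibleByOfSMulRightSurj (QpZp p) ℤ fun {n} hn x => by
    obtain ⟨y, rfl⟩ := QuotientAddGroup.mk_surjective x
    refine ⟨((y / n : ℚ_[p]) : QpZp p), ?_⟩
    change n • ((y / n : ℚ_[p]) : QpZp p) = _
    rw [← QuotientAddGroup.mk_zsmul, zsmul_eq_mul, mul_div_cancel₀ _ (Int.cast_ne_zero.2 hn)]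

theorem isOpen_subring : IsOpen ((PadicInt.subring p).toAddSubgroup : Set ℚ_[p]) := by
  have : ((PadicInt.subring p).toAddSubgroup : Set ℚ_[p]) = Metric.closedBall 0 1 := by
    ext x
    simp [PadicInt.mem_subring_iff]
  rw [this]
  exact IsUltrametricDist.isOpen_closedBall 0 one_ne_zero

instance : DiscreteTopology (QpZp p) := QuotientAddGroup.discreteTopology (isOpen_subring p)

variable {p}

theorem mk_eq_zero_iff {x : ℚ_[p]} : (x : QpZp p) = 0 ↔ ‖x‖ ≤ 1 := by
  rw [QuotientAddGroup.eq_zero_iff]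
  exact PadicInt.mem_subring_iff p

theorem mk_natCast (k : ℕ) : ((k : ℚ_[p]) : QpZp p) = 0 := by
  rw [mk_eq_zero_iff]
  exact_mod_cast Padic.norm_int_le_one (p := p) (k : ℤ)

/-- A character of a subgroup extends to the whole group. -/
theorem exists_extension {M N : Type*} [AddCommGroup M] [AddCommGroup N] (f : M →+ N)
    (hf : Function.Injective f) (g : M →+ QpZp p) : ∃ h : N →+ QpZp p, h.comp f = g :=
  (Module.Baer.of_divisible (QpZp p)).extension_property_addMonoidHom f hf g

/-- If `ker f ≤ ker g`, then the character `g` factors through `f`. -/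
theorem exists_factor {M N : Type*} [AddCommGroup M] [AddCommGroup N] (f : M →+ N)
    (g : M →+ QpZp p) (hfg : ∀ x, f x = 0 → g x = 0) : ∃ h : N →+ QpZp p, h.comp f = g := by
  obtain ⟨h, hh⟩ := exists_extension (QuotientAddGroup.kerLift f)
    (QuotientAddGroup.kerLift_injective f) (QuotientAddGroup.lift f.ker g fun x hx => hfg x hx)
  exact ⟨h, AddMonoidHom.ext fun x => DFunLike.congr_fun hh (x : M ⧸ f.ker)⟩

/-- Characters separate the elements of order a power of `p` from `0`. -/
theorem exists_apply_ne_zero {M : Type*} [AddCommGroup M] {x : M} (hx : x ≠ 0) {k : ℕ}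
    (hk : p ^ k • x = 0) : ∃ f : M →+ QpZp p, f x ≠ 0 := by
  have hdvd := addOrderOf_dvd_of_nsmul_eq_zero hk
  obtain ⟨j, -, hj⟩ := (Nat.dvd_prime_pow hp.out).1 hdvd
  have hp0 : (p : ℚ_[p]) ≠ 0 := Nat.cast_ne_zero.2 hp.out.ne_zero
  let f : ZMod (p ^ j) →+ M := ZMod.lift (p ^ j) ⟨zmultiplesHom M x, by
    rw [zmultiplesHom_apply, natCast_zsmul, ← hj]
    exact addOrderOf_nsmul_eq_zero x⟩
  -- On the cyclic group generated by x, of order p^j, the character sends x to 1/p^j. It is nonzero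
  -- at x because |1/p^j| = p^j > 1 when j > 0.
  let g : ZMod (p ^ j) →+ QpZp p := ZMod.lift (p ^ j)
    ⟨zmultiplesHom _ (((1 / (p : ℚ_[p]) ^ j : ℚ_[p])) : QpZp p), by
      rw [zmultiplesHom_apply, natCast_zsmul, ← QuotientAddGroup.mk_nsmul, nsmul_eq_mul,
        Nat.cast_pow, mul_one_div_cancel (pow_ne_zero _ hp0)]
      exact_mod_cast mk_natCast (p := p) 1⟩
  have hf : Function.Injective f := (ZMod.lift_injective _).2 fun m hm => by
    rw [zmultiplesHom_apply] at hm
    rw [ZMod.intCast_zmod_eq_zero_iff_dvd, ← hj]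
    exact addOrderOf_dvd_iff_zsmul_eq_zero.2 hm
  obtain ⟨h, hh⟩ := exists_extension f hf g
  refine ⟨h, fun h0 => ?_⟩
  have h1 := DFunLike.congr_fun hh 1
  have hf1 : f 1 = x := by
    have := ZMod.lift_coe (p ^ j) ⟨zmultiplesHom M x, by
      rw [zmultiplesHom_apply, natCast_zsmul, ← hj]
      exact addOrderOf_nsmul_eq_zero x⟩ 1
    simpa using this
  have hg1 : g 1 = ((1 / (p : ℚ_[p]) ^ j : ℚ_[p]) : QpZp p) := by
    have : (1 : ZMod (p ^ j)) = ((1 : ℤ) : ZMod (p ^ j)) := by simp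
    rw [this]
    refine (ZMod.lift_coe _ _ _).trans ?_
    rw [zmultiplesHom_apply, one_zsmul]
  rw [AddMonoidHom.comp_apply, hf1, h0, hg1, eq_comm, mk_eq_zero_iff, norm_div, norm_one, norm_pow,
    Padic.norm_p, one_div, inv_pow, inv_inv] at h1
  have hj0 : j ≠ 0 := by
    rintro rfl
    rw [pow_zero] at hj
    exact hx (AddMonoid.addOrderOf_eq_one_iff.1 hj)
  have : 1 < p ^ j := Nat.one_lt_pow hj0 hp.out.one_lt
  have : (1 : ℝ) < (p : ℝ) ^ j := by exact_mod_cast this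
  linarith

/-- The `n`-torsion of `ℚ_p / ℤ_p` consists of multiples of the class of `1 / n`. -/
theorem exists_nsmul_eq {n : ℕ} (hn : n ≠ 0) {x : QpZp p} (hx : n • x = 0) :
    ∃ k < n, x = k • ((1 / n : ℚ_[p]) : QpZp p) := by
  obtain ⟨y, rfl⟩ := QuotientAddGroup.mk_surjective x
  rw [← QuotientAddGroup.mk_nsmul, mk_eq_zero_iff, nsmul_eq_mul] at hx
  have hn' : (n : ℚ_[p]) ≠ 0 := Nat.cast_ne_zero.2 hn
  let z : ℤ_[p] := ⟨n * y, hx⟩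
  -- Only the p-part of n affects the norm, so it suffices to approximate z modulo the exact power
  -- of p dividing n.
  obtain ⟨a, ha⟩ : ∃ a : ℕ, ‖(z - a : ℤ_[p])‖ ≤ ‖(n : ℚ_[p])‖ := by
    obtain ⟨a, u, hu, rfl⟩ := Nat.exists_eq_pow_mul_and_not_dvd hn p hp.out.ne_one
    refine ⟨z.appr a, ?_⟩
    have h1 := PadicInt.appr_spec a z
    rw [← PadicInt.norm_le_pow_iff_mem_span_pow] at h1
    have hu' : ‖(u : ℚ_[p])‖ = 1 := by
      have := Padic.norm_natCast_eq_one_iff (p := p) (n := u)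
      exact this.2 ((Nat.Prime.coprime_iff_not_dvd hp.out).2 hu)
    rw [Nat.cast_mul, norm_mul, hu', mul_one, Nat.cast_pow, norm_pow, Padic.norm_p]
    simpa [zpow_neg] using h1
  refine ⟨a % n, Nat.mod_lt _ (Nat.pos_of_ne_zero hn), ?_⟩
  change ((y : ℚ_[p]) : QpZp p) = _
  rw [← sub_eq_zero, ← QuotientAddGroup.mk_nsmul, ← QuotientAddGroup.mk_sub, mk_eq_zero_iff]
  have key : y - (a % n) • (1 / n : ℚ_[p]) =
      ((z - a : ℤ_[p]) : ℚ_[p]) / n + ((a / n : ℕ) : ℚ_[p]) := by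
    have h2 : (a : ℚ_[p]) = n * (a / n : ℕ) + (a % n : ℕ) := by
      exact_mod_cast (Nat.div_add_mod a n).symm
    have hz : ((z - a : ℤ_[p]) : ℚ_[p]) = n * y - a := by
      rw [PadicInt.coe_sub, PadicInt.coe_natCast]
    rw [hz, nsmul_eq_mul, h2]
    field_simp
    ring
  rw [key]
  refine (Padic.nonarchimedean _ _).trans (max_le ?_ ?_)
  · rw [norm_div, div_le_one (norm_pos_iff.2 hn')]
    exact ha
  · exact_mod_cast Padic.norm_int_le_one (p := p) ((a / n : ℕ) : ℤ)

/-- A character of ℤ/n is determined by its value at 1, an n-torsion element with at most n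
possibilities. -/
theorem finite_addMonoidHom_zmod {n : ℕ} (hn : n ≠ 0) :
    Finite (ZMod n →+ QpZp p) ∧ Nat.card (ZMod n →+ QpZp p) ≤ n := by
  have h : ∀ f : ZMod n →+ QpZp p, ∃ k : Fin n, f 1 = (k : ℕ) • ((1 / n : ℚ_[p]) : QpZp p) := by
    intro f
    obtain ⟨k, hk, hk'⟩ := exists_nsmul_eq hn (x := f 1) (by
      rw [← map_nsmul, nsmul_one, ZMod.natCast_self, map_zero])
    exact ⟨⟨k, hk⟩, hk'⟩
  choose c hc using h
  have hinj : Function.Injective c := fun f g hfg => by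
    refine AddMonoidHom.ext fun x => ?_
    obtain ⟨m, rfl⟩ := ZMod.intCast_surjective x
    have : (m : ZMod n) = m • 1 := by simp
    rw [this, map_zsmul, map_zsmul, hc f, hc g, hfg]
  refine ⟨Finite.of_injective c hinj, ?_⟩
  simpa using Nat.card_le_card_of_injective c hinj

/-- A finite group has at most as many characters as elements. -/
theorem finite_addMonoidHom (G : Type*) [AddCommGroup G] [Finite G] :
    Finite (G →+ QpZp p) ∧ Nat.card (G →+ QpZp p) ≤ Nat.card G := by
  classical
  obtain ⟨ι, _, n, hn, ⟨e⟩⟩ := AddCommGroup.equiv_directSum_zmod_of_finite' G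
  have hn0 : ∀ i, n i ≠ 0 := fun i => (zero_lt_one.trans (hn i)).ne'
  have := fun i => (finite_addMonoidHom_zmod (p := p) (hn0 i)).1
  have : ∀ i, NeZero (n i) := fun i => ⟨hn0 i⟩
  let e' : (G →+ QpZp p) ≃ ∀ i, (ZMod (n i) →+ QpZp p) :=
    (e.addMonoidHomCongrLeftEquiv).trans
      (DFinsupp.liftAddHom (β := fun i => ZMod (n i))).symm.toEquiv
  refine ⟨Finite.of_equiv _ e'.symm, ?_⟩
  rw [Nat.card_congr e', Nat.card_congr e.toEquiv, Nat.card_pi]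
  have : Nat.card (DirectSum ι fun i => ZMod (n i)) = ∏ i, n i := by
    rw [Nat.card_congr (DirectSum.addEquivProd fun i => ZMod (n i)).toEquiv, Nat.card_pi]
    simp
  rw [this]
  exact Finset.prod_le_prod' fun i _ => (finite_addMonoidHom_zmod (p := p) (hn0 i)).2

/-- Every character of the group of characters of a finite `p`-primary group is an evaluation. -/
theorem exists_eval_eq {G : Type*} [AddCommGroup G] [Finite G] {k : ℕ} (hk : ∀ x : G, p ^ k • x = 0)
    (ψ : (G →+ QpZp p) →+ QpZp p) : ∃ x : G, ∀ f, ψ f = f x := by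
  have := (finite_addMonoidHom (p := p) G).1
  have := (finite_addMonoidHom (p := p) (G →+ QpZp p)).1
  let ev : G → ((G →+ QpZp p) →+ QpZp p) := fun x => AddMonoidHom.eval x
  have hinj : Function.Injective ev := fun x y hxy => by
    by_contra hne
    obtain ⟨f, hf⟩ := exists_apply_ne_zero (sub_ne_zero.2 hne) (hk _)
    rw [map_sub] at hf
    exact hf (sub_eq_zero.2 (DFunLike.congr_fun hxy f))
  -- Counting: evaluation is injective, and dualising twice does not increase the cardinality.
  have hbij : Function.Bijective ev := (Nat.bijective_iff_injective_and_card ev).2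
    ⟨hinj, le_antisymm (Nat.card_le_card_of_injective ev hinj)
      ((finite_addMonoidHom (p := p) _).2.trans (finite_addMonoidHom (p := p) G).2)⟩
  obtain ⟨x, hx⟩ := hbij.2 ψ
  exact ⟨x, fun f => (DFunLike.congr_fun hx f).symm⟩

end QpZp

/-! ### The double dual of a complete local ring with finite residue field -/

section Duality

open IsLocalRing

variable {p : ℕ} [Fact p.Prime] {R : Type*} [CommRing R] [TopologicalSpace R] [IsTopologicalRing R]
  [IsLocalRing R]

/-- An element of `R^∨` vanishes on a power of the maximal ideal. -/
theorem ringDual.exists_pow_le (hR : IsAdic (maximalIdeal R)) (f : ringDual p R) :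
    ∃ k, ∀ x ∈ maximalIdeal R ^ k, f.1 x = 0 := by
  have hf : Continuous f.1 := f.2
  have h0 : f.1 ⁻¹' {0} ∈ nhds (0 : R) :=
    ((isOpen_discrete _).preimage hf).mem_nhds (map_zero f.1)
  obtain ⟨k, hk⟩ := (isAdic_iff.1 hR).2 _ h0
  exact ⟨k, fun x hx => hk hx⟩

omit [TopologicalSpace R] [IsTopologicalRing R] [Fact p.Prime] in
theorem natCast_prime_mem_maximalIdeal [CharP (ResidueField R) p] : (p : R) ∈ maximalIdeal R := by
  rw [← residue_eq_zero_iff, map_natCast]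
  exact CharP.cast_eq_zero _ p

/-- `R^∨` is `p`-primary. -/
theorem ringDual.exists_pow_smul_eq_zero [CharP (ResidueField R) p] (hR : IsAdic (maximalIdeal R))
    (f : ringDual p R) : ∃ k, p ^ k • f = 0 := by
  obtain ⟨k, hk⟩ := ringDual.exists_pow_le hR f
  refine ⟨k, Subtype.ext (AddMonoidHom.ext fun x => ?_)⟩
  change p ^ k • f.1 x = 0
  rw [← map_nsmul, nsmul_eq_mul, Nat.cast_pow]
  exact hk _ (Ideal.mul_mem_right _ _ (Ideal.pow_mem_pow natCast_prime_mem_maximalIdeal k))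

variable [IsNoetherianRing R] [Finite (ResidueField R)]

instance finite_quotient_maximalIdeal_pow (k : ℕ) : Finite (R ⧸ maximalIdeal R ^ k) := by
  have : Finite (R ⧸ maximalIdeal R) := inferInstanceAs (Finite (ResidueField R))
  exact Ideal.finite_quotient_pow (IsNoetherian.noetherian _) k

/-- The character of `R` defined by a character of `R / 𝔪^k`. -/
def ringDual.ofQuotient (hR : IsAdic (maximalIdeal R)) (k : ℕ) :
    ((R ⧸ maximalIdeal R ^ k) →+ QpZp p) →+ ringDual p R where
  toFun f := ⟨f.comp (Ideal.Quotient.mk (maximalIdeal R ^ k)).toAddMonoidHom, by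
    refine continuous_of_continuousAt_zero
      (f.comp (Ideal.Quotient.mk (maximalIdeal R ^ k)).toAddMonoidHom) ?_
    refine Filter.Tendsto.congr' ?_ tendsto_const_nhds
    refine Filter.mem_of_superset (((isAdic_iff.1 hR).1 k).mem_nhds (zero_mem _)) fun x hx => ?_
    have h1 : Ideal.Quotient.mk (maximalIdeal R ^ k) x = 0 := Ideal.Quotient.eq_zero_iff_mem.2 hx
    change _ = f (Ideal.Quotient.mk (maximalIdeal R ^ k) x)
    rw [h1, map_zero, map_zero]⟩
  map_zero' := rfl
  map_add' _ _ := rfl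

variable [IsAdicComplete (maximalIdeal R) R] [CharP (ResidueField R) p]

/-- Pontryagin duality for `R`: every character of the discrete group `R^∨` is an evaluation. -/
theorem ringDual.exists_eval_eq (hR : IsAdic (maximalIdeal R)) (ψ : ringDual p R →+ QpZp p) :
    ∃ r : R, ∀ f, ψ f = f.1 r := by
  have hpow : ∀ k (x : R ⧸ maximalIdeal R ^ k), p ^ k • x = 0 := by
    intro k x
    obtain ⟨y, rfl⟩ := Ideal.Quotient.mk_surjective x
    rw [← map_nsmul, Ideal.Quotient.eq_zero_iff_mem, nsmul_eq_mul, Nat.cast_pow]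
    exact Ideal.mul_mem_right _ _ (Ideal.pow_mem_pow natCast_prime_mem_maximalIdeal k)
  have h : ∀ k, ∃ r : R, ∀ f : ringDual p R, (∀ x ∈ maximalIdeal R ^ k, f.1 x = 0) →
      ψ f = f.1 r := by
    intro k
    obtain ⟨x, hx⟩ := QpZp.exists_eval_eq (hpow k) (ψ.comp (ringDual.ofQuotient hR k))
    obtain ⟨r, rfl⟩ := Ideal.Quotient.mk_surjective x
    refine ⟨r, fun f hf => ?_⟩
    let f₀ : (R ⧸ maximalIdeal R ^ k) →+ QpZp p :=
      QuotientAddGroup.lift (maximalIdeal R ^ k).toAddSubgroup f.1 hf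
    have : ringDual.ofQuotient hR k f₀ = f := Subtype.ext (AddMonoidHom.ext fun x => rfl)
    rw [← this]
    exact hx f₀
  choose r hr using h
  -- Characters separate the points of R/𝔪^k, so the evaluation points found at the finite levels
  -- are compatible; completeness provides their limit.
  have hstep : ∀ {k l}, k ≤ l → r k - r l ∈ maximalIdeal R ^ k := by
    intro k l hkl
    by_contra hne
    rw [← Ideal.Quotient.eq_zero_iff_mem] at hne
    obtain ⟨f, hf⟩ := QpZp.exists_apply_ne_zero hne (hpow k _)
    have h0 : ∀ x ∈ maximalIdeal R ^ k, (ringDual.ofQuotient hR k f).1 x = 0 := by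
      intro x hx
      change f (Ideal.Quotient.mk (maximalIdeal R ^ k) x) = 0
      rw [Ideal.Quotient.eq_zero_iff_mem.2 hx, map_zero]
    apply hf
    change (ringDual.ofQuotient hR k f).1 (r k - r l) = 0
    rw [map_sub, ← hr k _ h0, ← hr l _ fun x hx => h0 x (Ideal.pow_le_pow_right hkl hx), sub_self]
  obtain ⟨L, hL⟩ := IsPrecomplete.prec' (I := maximalIdeal R) r fun {k l} hkl => by
    rw [SModEq.sub_mem, smul_eq_mul, Ideal.mul_top]
    exact hstep hkl
  refine ⟨L, fun f => ?_⟩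
  obtain ⟨k, hk⟩ := ringDual.exists_pow_le hR f
  have := hL k
  rw [SModEq.sub_mem, smul_eq_mul, Ideal.mul_top] at this
  rw [hr k f hk, ← sub_eq_zero, ← map_sub]
  exact hk _ this

end Duality

/-! ### The discrete module A = T ⊗ R^∨ and its dual -/

section DiscMod

open IsLocalRing

variable {p : ℕ} [Fact p.Prime] {R : Type*} [CommRing R] [TopologicalSpace R] [IsTopologicalRing R]
  [IsLocalRing R] [CharP (ResidueField R) p]
  {T : Type*} [AddCommGroup T] [Module R T]

/-- `A = T ⊗ R^∨` is `p`-primary. -/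
theorem DiscMod.exists_pow_smul_eq_zero (hR : IsAdic (maximalIdeal R)) (x : DiscMod p R T) :
    ∃ k, p ^ k • x = 0 := by
  induction x using TensorProduct.induction_on with
  | zero => exact ⟨0, smul_zero _⟩
  | tmul t f =>
    obtain ⟨k, hk⟩ := ringDual.exists_pow_smul_eq_zero hR f
    refine ⟨k, ?_⟩
    rw [← Nat.cast_smul_eq_nsmul R, ← TensorProduct.tmul_smul, Nat.cast_smul_eq_nsmul, hk,
      TensorProduct.tmul_zero]
  | add x y hx hy =>
    obtain ⟨k, hk⟩ := hx
    obtain ⟨l, hl⟩ := hy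
    refine ⟨k + l, ?_⟩
    rw [smul_add, pow_add, mul_smul, mul_smul, hl, smul_comm, hk, smul_zero, smul_zero, add_zero]

variable (p R T) in
/-- The character `x ↦ f_i(1)` of `A`, where `f_i` is the `i`-th coordinate of `x`. -/
def DiscMod.coordChar {ι : Type*} (b : Module.Basis ι R T) (i : ι) :
    DiscreteDual p (DiscMod p R T) :=
  (AddMonoidHom.comp (AddMonoidHom.eval (1 : R)) (ringDual p R).subtype.toAddMonoidHom).comp
    (TensorProduct.lid R (ringDual p R) ∘ₗ (b.coord i).rTensor (ringDual p R)).toAddMonoidHom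

omit [IsLocalRing R] [CharP (ResidueField R) p] in
theorem DiscMod.coordChar_tmul {ι : Type*} (b : Module.Basis ι R T) (i : ι) (t : T)
    (f : ringDual p R) : DiscMod.coordChar p R T b i (t ⊗ₜ f) = f.1 (b.repr t i) := by
  change (b.repr t i • f).1 1 = _
  change f.1 (b.repr t i • 1) = _
  rw [smul_eq_mul, mul_one]

variable [IsNoetherianRing R] [Finite (ResidueField R)] [IsAdicComplete (maximalIdeal R) R]
  [Module.Finite R T] [Module.Free R T]

/-- The Pontryagin dual of `A = T ⊗ R^∨` is a finitely generated `R`-module. -/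
theorem DiscMod.finite_discreteDual (hR : IsAdic (maximalIdeal R)) :
    Module.Finite R (DiscreteDual p (DiscMod p R T)) := by
  let b := Module.Free.chooseBasis R T
  refine ⟨Submodule.fg_def.2 ⟨Set.range (DiscMod.coordChar p R T b), Set.finite_range _, ?_⟩⟩
  refine top_le_iff.1 fun ψ _ => ?_
  have h : ∀ i, ∃ r : R, ∀ f : ringDual p R, ψ (b i ⊗ₜ f) = f.1 r := fun i =>
    ringDual.exists_eval_eq hR
      (AddMonoidHom.comp ψ (TensorProduct.mk R T (ringDual p R) (b i)).toAddMonoidHom)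
  choose r hr using h
  -- A is the sum of the b i ⊗ R^∨, and on each summand ψ is evaluation at r i.
  have key : ψ = ∑ i, r i • DiscMod.coordChar p R T b i := by
    refine AddMonoidHom.ext fun x => ?_
    have hsum : ∀ y, (∑ i, r i • DiscMod.coordChar p R T b i : DiscreteDual p (DiscMod p R T)) y =
        ∑ i, DiscMod.coordChar p R T b i (r i • y) := fun y =>
      AddMonoidHom.finsetSum_apply (M := DiscMod p R T) (N := QpZp p)
        (fun i => r i • DiscMod.coordChar p R T b i) Finset.univ y
    refine Eq.trans ?_ (hsum x).symm
    change ψ x = _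
    induction x using TensorProduct.induction_on with
    | zero => simp
    | tmul t f =>
      conv_lhs => rw [← b.sum_repr t, TensorProduct.sum_tmul, map_sum]
      refine Finset.sum_congr rfl fun i _ => ?_
      rw [TensorProduct.smul_tmul, hr, ← TensorProduct.tmul_smul, DiscMod.coordChar_tmul]
      change f.1 (b.repr t i * r i) = f.1 (r i * b.repr t i)
      rw [mul_comm]
    | add x y hx hy =>
      rw [map_add, hx, hy, ← Finset.sum_add_distrib]
      exact Finset.sum_congr rfl fun i _ => by rw [smul_add, map_add]
  rw [key]
  exact Submodule.sum_mem _ fun i _ => Submodule.smul_mem _ _ (Submodule.subset_span ⟨i, rfl⟩)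

/-- The Pontryagin dual of a submodule of `A` is a finitely generated `R`-module. -/
theorem DiscMod.finite_discreteDual_submodule (hR : IsAdic (maximalIdeal R))
    (B : Submodule R (DiscMod p R T)) : Module.Finite R (DiscreteDual p B) := by
  have := DiscMod.finite_discreteDual (p := p) (R := R) (T := T) hR
  let res : DiscreteDual p (DiscMod p R T) →ₗ[R] DiscreteDual p B :=
    { toFun := fun ψ => AddMonoidHom.comp ψ B.subtype.toAddMonoidHom
      map_add' := fun _ _ => rfl
      map_smul' := fun _ _ => rfl }
  refine Module.Finite.of_surjective res fun ψ => ?_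
  exact QpZp.exists_extension B.subtype.toAddMonoidHom B.subtype_injective ψ

end DiscMod

/-! ### The layers of a `ℤ_p`-extension -/

namespace ZpExtension

variable {p : ℕ} [hp : Fact p.Prime] {F : Type*} [Field F] (E : ZpExtension p F)

/-- The projection `G_F → Gal(F_∞ / F) ≃ ℤ_p`. -/
def toZp : GlobalGal F →* Multiplicative ℤ_[p] :=
  (E.galois_iso.some : Gal(E.top/F) →* Multiplicative ℤ_[p]).comp (AlgEquiv.restrictNormalHom E.top)

theorem toZp_apply (σ : GlobalGal F) :
    E.toZp σ = E.galois_iso.some (AlgEquiv.restrictNormalHom E.top σ) := rfl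

theorem toZp_surjective : Function.Surjective E.toZp :=
  E.galois_iso.some.surjective.comp (AlgEquiv.restrictNormalHom_surjective (AlgebraicClosure F))

/-- The closed subgroup `p^n ℤ_p` of `ℤ_p`, seen in `Gal(F_∞ / F)`. -/
def powSubgroup (n : ℕ) : ClosedSubgroup Gal(E.top/F) where
  carrier := {τ | (p : ℤ_[p]) ^ n ∣ (E.galois_iso.some τ).toAdd}
  mul_mem' ha hb := by
    rw [Set.mem_ofPred_eq, map_mul, toAdd_mul]
    exact dvd_add ha hb
  one_mem' := by simp
  inv_mem' ha := by
    rw [Set.mem_ofPred_eq, map_inv, toAdd_inv]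
    exact (dvd_neg).2 ha
  isClosed' := by
    have h : IsClosed {y : ℤ_[p] | (p : ℤ_[p]) ^ n ∣ y} := by
      have : {y : ℤ_[p] | (p : ℤ_[p]) ^ n ∣ y} = {y | ‖y‖ ≤ (p : ℝ) ^ (-n : ℤ)} := by
        ext y
        rw [Set.mem_ofPred_eq, Set.mem_ofPred_eq, PadicInt.norm_le_pow_iff_mem_span_pow,
          Ideal.mem_span_singleton]
      rw [this]
      exact isClosed_le continuous_norm continuous_const
    exact h.preimage (continuous_toAdd.comp E.galois_iso.some.continuous)

theorem mem_powSubgroup {n : ℕ} {τ : Gal(E.top/F)} :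
    τ ∈ (E.powSubgroup n).toSubgroup ↔ (p : ℤ_[p]) ^ n ∣ (E.galois_iso.some τ).toAdd := Iff.rfl

/-- Every element of p^n ℤ_p is already a p^n-th power, so the generated subgroup is topologically
closed, as the infinite Galois correspondence requires. -/
theorem closure_range_pow (n : ℕ) :
    Subgroup.closure (Set.range fun g : Gal(E.top/F) => g ^ p ^ n) =
      (E.powSubgroup n).toSubgroup := by
  apply le_antisymm
  · rw [Subgroup.closure_le]
    rintro _ ⟨g, rfl⟩
    refine E.mem_powSubgroup.2 ?_
    rw [map_pow, toAdd_pow, nsmul_eq_mul, Nat.cast_pow]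
    exact dvd_mul_right _ _
  · intro τ hτ
    obtain ⟨y, hy⟩ := E.mem_powSubgroup.1 hτ
    refine Subgroup.subset_closure ⟨E.galois_iso.some.symm (Multiplicative.ofAdd y), ?_⟩
    apply E.galois_iso.some.injective
    apply Multiplicative.toAdd.injective
    simp only [map_pow, ContinuousMulEquiv.apply_symm_apply, toAdd_pow, toAdd_ofAdd]
    rw [hy, nsmul_eq_mul, Nat.cast_pow]

/-- Galois correspondence for the closed subgroup p^n ℤ_p. It turns questions about layers into
divisibility in ℤ_p. -/
theorem mem_N {n : ℕ} {σ : GlobalGal F} :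
    σ ∈ E.N n ↔ (p : ℤ_[p]) ^ n ∣ (E.toZp σ).toAdd := by
  rw [toZp_apply, ← mem_powSubgroup, ← InfiniteGalois.fixingSubgroup_fixedField,
    ← closure_range_pow, N, layer, IntermediateField.mem_fixingSubgroup_iff,
    IntermediateField.mem_fixingSubgroup_iff]
  constructor
  · intro h x hx
    refine Subtype.ext ((AlgEquiv.restrictNormalHom_apply E.top σ x).trans ?_)
    exact h x ⟨x, hx, rfl⟩
  · rintro h _ ⟨x, hx, rfl⟩
    refine (AlgEquiv.restrictNormalHom_apply E.top σ x).symm.trans ?_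
    exact congrArg Subtype.val (h x hx)

theorem fixingSubgroup_top_le_N (m : ℕ) : E.top.fixingSubgroup ≤ E.N m :=
  IntermediateField.fixingSubgroup_antitone fun _ hx => (E.mem_layer.1 hx).1

/-- The projection `G_F → ℤ / p^m`. -/
def toZMod (m : ℕ) : GlobalGal F →* Multiplicative (ZMod (p ^ m)) :=
  (AddMonoidHom.toMultiplicative
    (PadicInt.toZModPow m : ℤ_[p] →+* ZMod (p ^ m)).toAddMonoidHom).comp E.toZp

theorem ker_toZMod (m : ℕ) : (E.toZMod m).ker = E.N m := by
  ext σ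
  rw [E.mem_N, ← Ideal.mem_span_singleton, ← PadicInt.ker_toZModPow]
  rfl

theorem toZMod_surjective (m : ℕ) : Function.Surjective (E.toZMod m) :=
  Function.Surjective.comp (g := AddMonoidHom.toMultiplicative
    (PadicInt.toZModPow m : ℤ_[p] →+* ZMod (p ^ m)).toAddMonoidHom)
    (ZMod.ringHom_surjective (PadicInt.toZModPow m)) E.toZp_surjective

theorem card_layerGal (m : ℕ) : Nat.card (E.layerGal m) = p ^ m := by
  change (E.N m).index = _
  rw [← ker_toZMod, Subgroup.index_ker, MonoidHom.range_eq_top.2 (E.toZMod_surjective m)]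
  rw [Nat.card_congr Subgroup.topEquiv.toEquiv]
  exact Nat.card_zmod _

instance (m : ℕ) : Finite (E.layerGal m) :=
  Nat.finite_of_card_ne_zero (E.card_layerGal m ▸ pow_ne_zero m hp.out.ne_zero)

theorem isOpen_N (m : ℕ) : IsOpen (E.N m : Set (GlobalGal F)) := by
  have : (E.N m).FiniteIndex := ⟨by
    change Nat.card (E.layerGal m) ≠ 0
    rw [card_layerGal]
    exact pow_ne_zero m hp.out.ne_zero⟩
  refine Subgroup.isOpen_of_isClosed_of_finiteIndex _ ?_
  have h := (E.powSubgroup m).isClosed'.preimage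
    (InfiniteGalois.restrictNormalHom_continuous (K := AlgebraicClosure F) E.top)
  convert! h using 1
  ext σ
  exact E.mem_N

/-- A lift to `G_F` of a topological generator of `Gal(F_∞ / F)`. -/
def gen : GlobalGal F := (E.toZp_surjective (Multiplicative.ofAdd 1)).choose

theorem toZp_gen : E.toZp E.gen = Multiplicative.ofAdd 1 :=
  (E.toZp_surjective (Multiplicative.ofAdd 1)).choose_spec

theorem toZp_gen_pow (i : ℕ) : (E.toZp (E.gen ^ i)).toAdd = i := by
  rw [map_pow, toZp_gen, toAdd_pow, toAdd_ofAdd, nsmul_one]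

theorem gen_pow_mem_N {m i : ℕ} : E.gen ^ i ∈ E.N m ↔ p ^ m ∣ i := by
  rw [mem_N, toZp_gen_pow, ← Nat.cast_pow]
  constructor
  · intro h
    have := (PadicInt.norm_le_pow_iff_mem_span_pow (i : ℤ_[p]) m).2
      (Ideal.mem_span_singleton.2 (by exact_mod_cast h))
    have h2 := (PadicInt.norm_int_le_pow_iff_dvd (p := p) (k := (i : ℤ)) (n := m)).1
      (by exact_mod_cast this)
    exact_mod_cast h2
  · rintro ⟨k, rfl⟩
    rw [Nat.cast_mul]
    exact dvd_mul_right _ _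

/-- `γ ^ (p ^ n)` generates `Gal(F̄ / F_n)` modulo `Gal(F̄ / F_m)`. -/
theorem exists_gen_pow_inv_mul_mem (n m : ℕ) {σ : GlobalGal F} (hσ : σ ∈ E.N n) :
    ∃ i : ℕ, ((E.gen ^ p ^ n) ^ i)⁻¹ * σ ∈ E.N m := by
  obtain ⟨y, hy⟩ := E.mem_N.1 hσ
  obtain ⟨z, hz⟩ := Ideal.mem_span_singleton.1 (PadicInt.appr_spec m y)
  -- σ corresponds to p^n y, and replacing y by its approximation modulo p^m changes this by a
  -- multiple of p^(n+m).
  refine ⟨y.appr m, E.mem_N.2 ?_⟩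
  rw [map_mul, map_inv, ← pow_mul, toAdd_mul, toAdd_inv, toZp_gen_pow, hy, Nat.cast_mul,
    Nat.cast_pow, neg_add_eq_sub, ← mul_sub, hz]
  exact ⟨_, mul_left_comm _ _ _⟩

end ZpExtension

/-! ### Compact rings -/

section Compact

open IsLocalRing

variable {R : Type*} [CommRing R] [TopologicalSpace R] [IsTopologicalRing R] [IsLocalRing R]

theorem t2Space_of_isAdic [IsAdicComplete (maximalIdeal R) R] (hR : IsAdic (maximalIdeal R)) :
    T2Space R := by
  let := IsTopologicalAddGroup.rightUniformSpace R
  have : IsUniformAddGroup R := isUniformAddGroup_of_addCommGroup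
  exact (hR.isAdicComplete_iff.1 inferInstance).2

/-- Complete and totally bounded, since every 𝔪^k has finite index. -/
theorem compactSpace_of_isAdic [IsNoetherianRing R] [Finite (ResidueField R)]
    [IsAdicComplete (maximalIdeal R) R] (hR : IsAdic (maximalIdeal R)) : CompactSpace R := by
  let := IsTopologicalAddGroup.rightUniformSpace R
  have : IsUniformAddGroup R := isUniformAddGroup_of_addCommGroup
  have : CompleteSpace R := (hR.isAdicComplete_iff.1 inferInstance).1
  refine isCompact_univ_iff.1 (isCompact_iff_totallyBounded_isComplete.2 ⟨?_, isComplete_univ⟩)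
  refine totallyBounded_iff_subset_finite_iUnion_nhds_zero.2 fun U hU => ?_
  obtain ⟨k, hk⟩ := (isAdic_iff.1 hR).2 U hU
  have := finite_quotient_maximalIdeal_pow (R := R) k
  refine ⟨Set.range (Quotient.out : R ⧸ maximalIdeal R ^ k → R), Set.finite_range _,
    fun x _ => ?_⟩
  refine Set.mem_biUnion ⟨Ideal.Quotient.mk _ x, rfl⟩ ?_
  rw [Set.mem_vadd_set_iff_neg_vadd_mem, vadd_eq_add]
  refine hk ?_
  rw [neg_add_eq_sub, SetLike.mem_coe, ← Ideal.Quotient.mk_eq_mk_iff_sub_mem]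
  exact (Ideal.Quotient.mk_out _).symm

/-- A compact Hausdorff ring `A` is noetherian if, for some `t`, the ring `A / t` is noetherian and
the powers of `t` intersect trivially. -/
theorem isNoetherianRing_of_compactSpace {A B : Type*} [CommRing A] [TopologicalSpace A]
    [IsTopologicalRing A] [CompactSpace A] [T2Space A] [CommRing B] [IsNoetherianRing B]
    (π : A →+* B) (hπ : Function.Surjective π) (t : A) (ht : RingHom.ker π = Ideal.span {t})
    (hsep : ∀ x : A, (∀ n, t ^ n ∣ x) → x = 0) : IsNoetherianRing A := by
  have hclosed : ∀ n, IsClosed {x : A | t ^ n ∣ x} := fun n => by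
    have : {x : A | t ^ n ∣ x} = Set.range fun y => t ^ n * y := by
      ext x
      exact ⟨fun ⟨y, hy⟩ => ⟨y, hy.symm⟩, fun ⟨y, hy⟩ => ⟨y, hy.symm⟩⟩
    rw [this]
    exact (isCompact_range (continuous_const_mul _)).isClosed
  -- Cohen's criterion: only prime ideals need be finitely generated.
  refine IsNoetherianRing.of_prime fun P hP => ?_
  obtain ⟨s, hs⟩ := IsNoetherian.noetherian (P.map π)
  have hlift : ∀ b : s, ∃ a ∈ P, π a = b := fun b =>
    (Ideal.mem_map_iff_of_surjective π hπ).1 (hs ▸ Submodule.subset_span b.2)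
  choose l hlP hl using hlift
  set J : Ideal A := Ideal.span (Set.range l)
  have hJP : J ≤ P := Ideal.span_le.2 (by rintro _ ⟨b, rfl⟩; exact hlP b)
  have hJfg : J.FG := Submodule.fg_span (Set.finite_range l)
  have hmap : P.map π ≤ J.map π := by
    rw [← hs, Ideal.map_span]
    refine Ideal.span_mono fun b hb => ⟨l ⟨b, hb⟩, ⟨_, rfl⟩, hl ⟨b, hb⟩⟩
  have hdecomp : ∀ x ∈ P, ∃ j ∈ J, ∃ y, x = j + t * y := fun x hx => by
    obtain ⟨j, hj, hjx⟩ := (Ideal.mem_map_iff_of_surjective π hπ).1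
      (hmap (Ideal.mem_map_of_mem π hx))
    have : x - j ∈ RingHom.ker π := by rw [RingHom.mem_ker, map_sub, hjx, sub_self]
    rw [ht] at this
    obtain ⟨y, hy⟩ := Ideal.mem_span_singleton.1 this
    exact ⟨j, hj, y, by rw [← hy]; ring⟩
  by_cases htP : t ∈ P
  · have : P = J ⊔ Ideal.span {t} := by
      refine le_antisymm (fun x hx => ?_)
        (sup_le hJP ((Ideal.span_singleton_le_iff_mem _).2 htP))
      obtain ⟨j, hj, y, rfl⟩ := hdecomp x hx
      exact add_mem (Ideal.mem_sup_left hj)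
        (Ideal.mem_sup_right (Ideal.mem_span_singleton.2 ⟨y, rfl⟩))
    rw [this]
    exact Submodule.FG.sup hJfg (Submodule.fg_span_singleton t)
  -- Here t ∉ P, so t z ∈ P gives z ∈ P and the approximation of x by elements of J can be iterated.
  · have hstep : ∀ n, ∀ x ∈ P, ∃ j ∈ J, ∃ y ∈ P, x = j + t ^ n * y := by
      intro n
      induction n with
      | zero => exact fun x hx => ⟨0, zero_mem _, x, hx, by simp⟩
      | succ n ih =>
        intro x hx
        obtain ⟨j, hj, y, hy, rfl⟩ := ih x hx
        obtain ⟨j', hj', z, rfl⟩ := hdecomp y hy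
        have hz : t * z ∈ P := (Ideal.add_mem_iff_right _ (hJP hj')).1 hy
        refine ⟨j + t ^ n * j', add_mem hj (Ideal.mul_mem_left _ _ hj'), z,
          (hP.mem_or_mem hz).resolve_left htP, by ring⟩
    have hJcl : IsClosed (J : Set A) := by
      have : (J : Set A) = Set.range fun c : s → A => ∑ i, c i * l i := by
        ext x
        rw [SetLike.mem_coe, Ideal.mem_span_range_iff_exists_fun]
        rfl
      rw [this]
      exact (isCompact_range (by fun_prop)).isClosed
    suffices P = J by rwa [this]
    refine le_antisymm (fun x hx => ?_) hJP
    -- J is closed, so compactness yields one j in J with x - j divisible by every power of t.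
    obtain ⟨j, hj⟩ := IsCompact.nonempty_iInter_of_sequence_nonempty_isCompact_isClosed
      (fun n => (J : Set A) ∩ {j | t ^ n ∣ x - j}) (fun n j hj => ⟨hj.1, by
        exact (pow_dvd_pow t n.le_succ).trans hj.2⟩) (fun n => by
        obtain ⟨j, hj, y, -, rfl⟩ := hstep n x hx
        exact ⟨j, hj, ⟨y, by ring⟩⟩)
      ((hJcl.inter ((hclosed 0).preimage (continuous_const.sub continuous_id))).isCompact)
      (fun n => hJcl.inter ((hclosed n).preimage (continuous_const.sub continuous_id)))
    rw [Set.mem_iInter] at hj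
    have := hsep (x - j) fun n => (hj n).2
    rw [sub_eq_zero.1 this]
    exact (hj 0).1

end Compact

/-! ### The topology of a group ring of a finite group -/

namespace GroupRing

variable {R G H : Type*} [CommRing R]

theorem sum_single [Fintype G] (x : MonoidAlgebra R G) :
    ∑ a, MonoidAlgebra.single a (x.coeff a) = x := by
  classical
  ext b
  simp [MonoidAlgebra.coeff_sum]

theorem coeff_injective : Function.Injective fun (x : MonoidAlgebra R G) (a : G) => x.coeff a :=
  fun _ _ h => MonoidAlgebra.ext (Finsupp.ext fun a => congrFun h a)

variable [TopologicalSpace R]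

/-- The topology of `R[G]` defined by the coefficients. -/
instance : TopologicalSpace (MonoidAlgebra R G) :=
  .induced (fun x a => x.coeff a) Pi.topologicalSpace

theorem isInducing_coeff : Topology.IsInducing fun (x : MonoidAlgebra R G) (a : G) => x.coeff a :=
  ⟨rfl⟩

theorem continuous_coeff (a : G) : Continuous fun x : MonoidAlgebra R G => x.coeff a :=
  (continuous_apply a).comp isInducing_coeff.continuous

instance [T2Space R] : T2Space (MonoidAlgebra R G) :=
  (Topology.IsEmbedding.mk isInducing_coeff coeff_injective).t2Space

theorem continuous_single (a : G) :
    Continuous (MonoidAlgebra.single a : R → MonoidAlgebra R G) := by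
  classical
  refine isInducing_coeff.continuous_iff.2 (continuous_pi fun b => ?_)
  by_cases h : a = b
  · subst h
    simpa using continuous_id'
  · simpa [Function.comp_def, Finsupp.single_apply, h] using continuous_const

variable [IsTopologicalRing R] [Group G] [Group H]

instance [Finite G] : IsTopologicalRing (MonoidAlgebra R G) := by
  have hadd : ContinuousAdd (MonoidAlgebra R G) := ⟨isInducing_coeff.continuous_iff.2
    (continuous_pi fun a => ((continuous_coeff a).comp continuous_fst).add
      ((continuous_coeff a).comp continuous_snd))⟩
  have hneg : ContinuousNeg (MonoidAlgebra R G) := ⟨isInducing_coeff.continuous_iff.2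
    (continuous_pi fun a => (continuous_coeff a).neg)⟩
  have hmul : ContinuousMul (MonoidAlgebra R G) := ⟨by
    have := Fintype.ofFinite G
    have h : (fun z : MonoidAlgebra R G × MonoidAlgebra R G => z.1 * z.2) = fun z =>
        ∑ a, ∑ b, MonoidAlgebra.single (a * b) (z.1.coeff a * z.2.coeff b) := by
      funext z
      conv_lhs => rw [← sum_single z.1, ← sum_single z.2]
      simp_rw [Finset.sum_mul_sum, MonoidAlgebra.single_mul_single]
    rw [h]
    refine continuous_finsetSum _ fun a _ => continuous_finsetSum _ fun b _ => ?_
    exact (continuous_single _).comp (((continuous_coeff a).comp continuous_fst).mul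
      ((continuous_coeff b).comp continuous_snd))⟩
  exact { }

theorem continuous_mapDomainRingHom [Finite G] [Finite H] (f : G →* H) :
    Continuous (MonoidAlgebra.mapDomainRingHom R f) := by
  have := Fintype.ofFinite G
  have h : (MonoidAlgebra.mapDomainRingHom R f : MonoidAlgebra R G → MonoidAlgebra R H) = fun x =>
      ∑ a, MonoidAlgebra.single (f a) (x.coeff a) := by
    funext x
    conv_lhs => rw [← sum_single x]
    rw [map_sum]
    exact Finset.sum_congr rfl fun a _ => MonoidAlgebra.mapDomain_single
  rw [h]
  exact continuous_finsetSum _ fun a _ => (continuous_single _).comp (continuous_coeff a)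

instance [Finite G] [CompactSpace R] : CompactSpace (MonoidAlgebra R G) := by
  have := Fintype.ofFinite G
  have h : Function.Surjective fun c : G → R => ∑ a, MonoidAlgebra.single a (c a) := fun x =>
    ⟨fun a => x.coeff a, sum_single x⟩
  refine h.compactSpace (continuous_finsetSum _ fun a _ => ?_)
  exact (continuous_single a).comp (continuous_apply a)

end GroupRing

namespace ZpExtension

variable {p : ℕ} [hp : Fact p.Prime] {F : Type*} [Field F] (E : ZpExtension p F)

/-! ### The Iwasawa algebra -/

section Algebra

variable (R : Type*) [CommRing R]

/-- The natural homomorphism `R[G_F] → Λ_R`. -/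
def ofGroupRing : MonoidAlgebra R (GlobalGal F) →+* E.iwasawaAlgebra R :=
  (RingHom.pi fun m => MonoidAlgebra.mapDomainRingHom R (QuotientGroup.mk' (E.N m))).codRestrict
    (E.iwasawaAlgebra R) fun x n m h => by
      change ((MonoidAlgebra.mapDomainRingHom R _).comp (MonoidAlgebra.mapDomainRingHom R _)) x = _
      rw [← MonoidAlgebra.mapDomainRingHom_comp]
      rfl

theorem iwasawaProj_ofGroupRing (m : ℕ) (x : MonoidAlgebra R (GlobalGal F)) :
    E.iwasawaProj R m (E.ofGroupRing R x) =
      MonoidAlgebra.mapDomainRingHom R (QuotientGroup.mk' (E.N m)) x := rfl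

theorem groupRingProj_iwasawaProj {n m : ℕ} (h : n ≤ m) (x : E.iwasawaAlgebra R) :
    E.groupRingProj R h (E.iwasawaProj R m x) = E.iwasawaProj R n x := x.2 n m h

theorem iwasawaAlgebra_ext {x y : E.iwasawaAlgebra R}
    (h : ∀ m, E.iwasawaProj R m x = E.iwasawaProj R m y) : x = y :=
  Subtype.ext (funext h)

theorem iwasawaProj_surjective (m : ℕ) : Function.Surjective (E.iwasawaProj R m) := by
  have : Function.Surjective
      (MonoidAlgebra.mapDomainRingHom R (QuotientGroup.mk' (E.N m))) := by
    intro x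
    induction x using MonoidAlgebra.induction_linear with
    | zero => exact ⟨0, map_zero _⟩
    | add x y hx hy =>
      obtain ⟨x, rfl⟩ := hx
      obtain ⟨y, rfl⟩ := hy
      exact ⟨x + y, map_add _ _ _⟩
    | single a r =>
      obtain ⟨σ, rfl⟩ := QuotientGroup.mk_surjective a
      exact ⟨MonoidAlgebra.single σ r, MonoidAlgebra.mapDomain_single⟩
  intro x
  obtain ⟨y, rfl⟩ := this x
  exact ⟨E.ofGroupRing R y, rfl⟩

/-- The element `γ^(p^n) - 1` of `Λ_R`. -/
def omega (n : ℕ) : E.iwasawaAlgebra R :=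
  E.ofGroupRing R (MonoidAlgebra.of R _ (E.gen ^ p ^ n) - 1)

theorem iwasawaProj_omega (n m : ℕ) : E.iwasawaProj R m (E.omega R n) =
    MonoidAlgebra.of R _ ((E.gen ^ p ^ n : GlobalGal F) : E.layerGal m) - 1 := by
  rw [omega, iwasawaProj_ofGroupRing, map_sub, map_one]
  congr 1
  exact MonoidAlgebra.mapDomain_single

theorem iwasawaProj_omega_eq_zero {n m : ℕ} (h : m ≤ n) :
    E.iwasawaProj R m (E.omega R n) = 0 := by
  have : ((E.gen ^ p ^ n : GlobalGal F) : E.layerGal m) = 1 :=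
    (QuotientGroup.eq_one_iff _).2 (E.gen_pow_mem_N.2 (pow_dvd_pow p h))
  rw [iwasawaProj_omega, this, map_one, sub_self]

/-- The kernel of `R[G_m] → R[G_n]` is generated by `γ^(p^n) - 1`. -/
theorem exists_eq_omega_mul {n m : ℕ} (h : n ≤ m) {x : MonoidAlgebra R (E.layerGal m)}
    (hx : E.groupRingProj R h x = 0) :
    ∃ y, x = E.iwasawaProj R m (E.omega R n) * y := by
  set g : E.layerGal m := ((E.gen ^ p ^ n : GlobalGal F) : E.layerGal m)
  set I : Ideal (MonoidAlgebra R (E.layerGal m)) :=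
    Ideal.span {MonoidAlgebra.of R _ g - 1}
  set q := Ideal.Quotient.mk I
  have hg : q (MonoidAlgebra.of R _ g) = 1 := by
    rw [← sub_eq_zero, ← map_one q, ← map_sub]
    exact Ideal.Quotient.eq_zero_iff_mem.2 (Ideal.mem_span_singleton_self _)
  -- Modulo γ^(p^n) - 1 the elements of Gal(F̄/F_n) become 1, so the quotient map factors through
  -- R[G_n], and the kernel of the projection lies in I.
  let φ : GlobalGal F →* MonoidAlgebra R (E.layerGal m) ⧸ I :=
    (q : _ →* _).comp ((MonoidAlgebra.of R (E.layerGal m)).comp (QuotientGroup.mk' (E.N m)))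
  have hφ : ∀ σ ∈ E.N n, φ σ = 1 := fun σ hσ => by
    obtain ⟨i, hi⟩ := E.exists_gen_pow_inv_mul_mem n m hσ
    have : (σ : E.layerGal m) = g ^ i := by
      rw [eq_comm, ← QuotientGroup.mk_pow]
      exact QuotientGroup.eq.2 hi
    change q (MonoidAlgebra.of R _ (σ : E.layerGal m)) = 1
    rw [this, map_pow, map_pow, hg, one_pow]
  let ψ : MonoidAlgebra R (E.layerGal n) →ₐ[R] MonoidAlgebra R (E.layerGal m) ⧸ I :=
    MonoidAlgebra.lift R _ _ (QuotientGroup.lift (E.N n) φ hφ)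
  have hψ : ∀ y, ψ (E.groupRingProj R h y) = q y := by
    intro y
    induction y using MonoidAlgebra.induction_linear with
    | zero => rw [map_zero, map_zero, map_zero]
    | add x y hx hy => rw [map_add, map_add, map_add, hx, hy]
    | single a r =>
      obtain ⟨σ, rfl⟩ := QuotientGroup.mk_surjective a
      have h1 : E.groupRingProj R h (MonoidAlgebra.single (σ : E.layerGal m) r) =
          MonoidAlgebra.single (σ : E.layerGal n) r := MonoidAlgebra.mapDomain_single
      rw [h1, MonoidAlgebra.lift_single]
      change r • q (MonoidAlgebra.of R _ (σ : E.layerGal m)) = _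
      rw [MonoidAlgebra.of_apply]
      change q (r • MonoidAlgebra.single (σ : E.layerGal m) 1) = _
      rw [MonoidAlgebra.smul_single, smul_eq_mul, mul_one]
  have hmem : x ∈ I := by
    rw [← Ideal.Quotient.eq_zero_iff_mem]
    change q x = 0
    rw [← hψ, hx, map_zero]
  rw [iwasawaProj_omega]
  exact Ideal.mem_span_singleton.1 hmem

end Algebra

section Topology

variable {R : Type*} [CommRing R] [TopologicalSpace R] [IsTopologicalRing R]

omit [IsTopologicalRing R] in
theorem continuous_iwasawaProj (m : ℕ) : Continuous (E.iwasawaProj R m) :=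
  (continuous_apply m).comp continuous_subtype_val

instance [T2Space R] [CompactSpace R] : CompactSpace (E.iwasawaAlgebra R) := by
  refine isCompact_iff_compactSpace.1 (IsClosed.isCompact ?_)
  have : ((E.iwasawaAlgebra R : Set (∀ n : ℕ, MonoidAlgebra R (E.layerGal n)))) =
      ⋂ (n) (m) (h : n ≤ m), {x | E.groupRingProj R h (x m) = x n} := by
    ext x
    simp only [Set.mem_iInter]
    rfl
  rw [this]
  refine isClosed_iInter fun n => isClosed_iInter fun m => isClosed_iInter fun h => ?_
  exact isClosed_eq ((GroupRing.continuous_mapDomainRingHom _).comp (continuous_apply m))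
    (continuous_apply n)

/-- The kernel of `Λ_R → R[G_n]` is generated by `γ^(p^n) - 1`. -/
theorem ker_iwasawaProj [T2Space R] [CompactSpace R] (n : ℕ) :
    RingHom.ker (E.iwasawaProj R n) = Ideal.span {E.omega R n} := by
  refine le_antisymm (fun x hx => ?_) ((Ideal.span_singleton_le_iff_mem _).2
    (E.iwasawaProj_omega_eq_zero R le_rfl))
  rw [RingHom.mem_ker] at hx
  -- A cofactor of ω exists at each finite level but is not unique there. The solution sets are
  -- closed, nested and nonempty, so compactness gives a common solution.
  let C : ℕ → Set (E.iwasawaAlgebra R) := fun m =>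
    {y | E.iwasawaProj R m (E.omega R n * y) = E.iwasawaProj R m x}
  have hC : ∀ m, IsClosed (C m) := fun m =>
    isClosed_eq ((E.continuous_iwasawaProj m).comp (continuous_const_mul _)) continuous_const
  have hmono : ∀ {m k}, m ≤ k → C k ⊆ C m := fun {m k} h y hy => by
    change E.iwasawaProj R m _ = _
    rw [← E.groupRingProj_iwasawaProj R h, ← E.groupRingProj_iwasawaProj R h x]
    exact congrArg _ hy
  have hne : ∀ m, (C m).Nonempty := fun m => by
    have h0 : E.groupRingProj R (le_max_left n m) (E.iwasawaProj R (max n m) x) = 0 := by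
      rw [groupRingProj_iwasawaProj, hx]
    obtain ⟨y, hy⟩ := E.exists_eq_omega_mul R (le_max_left n m) h0
    obtain ⟨z, rfl⟩ := E.iwasawaProj_surjective R _ y
    refine ⟨z, hmono (le_max_right n m) ?_⟩
    change E.iwasawaProj R _ _ = _
    rw [map_mul, hy]
  obtain ⟨y, hy⟩ := IsCompact.nonempty_iInter_of_sequence_nonempty_isCompact_isClosed C
    (fun m => hmono m.le_succ) hne (hC 0).isCompact hC
  rw [Set.mem_iInter] at hy
  exact Ideal.mem_span_singleton.2 ⟨y, E.iwasawaAlgebra_ext R fun m => (hy m).symm⟩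

end Topology

/-! ### Coefficients along the tower, and non-zero-divisors -/

section Fiber

variable {R : Type*} [CommRing R]

/-- The projection `G_m → G_n` for `n ≤ m`. -/
def layerProj {n m : ℕ} (h : n ≤ m) : E.layerGal m →* E.layerGal n :=
  QuotientGroup.map (E.N m) (E.N n) (MonoidHom.id _) (E.N_antitone h)

/-- All fibres of a surjective homomorphism have the same size, here p^(k+j) / p^k. -/
theorem card_fiber {k j : ℕ} [Fintype (E.layerGal (k + j))] [DecidableEq (E.layerGal k)]
    (h : k ≤ k + j) (a : E.layerGal k) :
    (Finset.univ.filter fun b : E.layerGal (k + j) => E.layerProj h b = a).card = p ^ j := by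
  have := Fintype.ofFinite (E.layerGal k)
  set π := E.layerProj h
  have hπ : Function.Surjective π := fun b => by
    obtain ⟨σ, rfl⟩ := QuotientGroup.mk_surjective b
    exact ⟨σ, rfl⟩
  have hsum : (Finset.univ : Finset (E.layerGal (k + j))).card =
      ∑ b : E.layerGal k, (Finset.univ.filter fun c => π c = b).card :=
    Finset.card_eq_sum_card_fiberwise fun _ _ => Finset.mem_univ _
  have hconst : ∀ b, (Finset.univ.filter fun c => π c = b).card =
      (Finset.univ.filter fun c => π c = a).card := fun b =>
    MonoidHom.card_fiber_eq_of_mem_range π (hπ b) (hπ a)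
  rw [Finset.sum_congr rfl fun b _ => hconst b, Finset.sum_const, Finset.card_univ,
    Finset.card_univ, ← Nat.card_eq_fintype_card, ← Nat.card_eq_fintype_card, card_layerGal,
    card_layerGal, pow_add, smul_eq_mul] at hsum
  exact (Nat.eq_of_mul_eq_mul_left (pow_pos hp.out.pos k) hsum).symm

theorem coeff_groupRingProj {n m : ℕ} (h : n ≤ m) [Fintype (E.layerGal m)]
    [DecidableEq (E.layerGal n)] (x : MonoidAlgebra R (E.layerGal m)) (a : E.layerGal n) :
    (E.groupRingProj R h x).coeff a = ∑ b with E.layerProj h b = a, x.coeff b := by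
  conv_lhs => rw [← GroupRing.sum_single x, map_sum]
  rw [MonoidAlgebra.coeff_sum, Finsupp.finsetSum_apply, Finset.sum_filter]
  refine Finset.sum_congr rfl fun b _ => ?_
  have h1 : E.groupRingProj R h (MonoidAlgebra.single b (x.coeff b)) =
      MonoidAlgebra.single (E.layerProj h b) (x.coeff b) := MonoidAlgebra.mapDomain_single
  rw [h1, MonoidAlgebra.coeff_single, Finsupp.single_apply]

/-- If γ^(p^n) fixes y, the coefficients of y over G_(k+j) are constant on the fibres over G_k, and
projection sums over these fibres of size p^j. As j is arbitrary, y vanishes once the powers of p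
intersect trivially. -/
theorem pow_dvd_coeff_of_omega_mul_eq_zero {n k : ℕ} (hnk : n ≤ k) (j : ℕ)
    {y : E.iwasawaAlgebra R} (hy : E.omega R n * y = 0) (a : E.layerGal k) :
    (p : R) ^ j ∣ (E.iwasawaProj R k y).coeff a := by
  classical
  have := Fintype.ofFinite (E.layerGal (k + j))
  have hle : k ≤ k + j := Nat.le_add_right k j
  set z := E.iwasawaProj R (k + j) y
  set g : E.layerGal (k + j) := ((E.gen ^ p ^ n : GlobalGal F) : E.layerGal (k + j))
  have hz : MonoidAlgebra.of R _ g * z = z := by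
    have := congrArg (E.iwasawaProj R (k + j)) hy
    rw [map_mul, iwasawaProj_omega, map_zero, sub_mul, one_mul, sub_eq_zero] at this
    exact this
  have hinv : ∀ b, z.coeff (g * b) = z.coeff b := fun b => by
    conv_lhs => rw [← hz]
    rw [MonoidAlgebra.of_apply, MonoidAlgebra.coeff_single_mul_apply, inv_mul_cancel_left, one_mul]
  have hinv_pow : ∀ (i : ℕ) b, z.coeff (g ^ i * b) = z.coeff b := fun i => by
    induction i with
    | zero => intro b; rw [pow_zero, one_mul]
    | succ i ih => intro b; rw [pow_succ, mul_assoc, ih, hinv]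
  obtain ⟨σ, rfl⟩ := QuotientGroup.mk_surjective a
  have hfib : ∀ b : E.layerGal (k + j), E.layerProj hle b = (σ : E.layerGal k) →
      z.coeff b = z.coeff (σ : E.layerGal (k + j)) := by
    intro b hb
    obtain ⟨τ, rfl⟩ := QuotientGroup.mk_surjective b
    have hmem : σ⁻¹ * τ ∈ E.N k := QuotientGroup.eq.1 hb.symm
    obtain ⟨i, hi⟩ := E.exists_gen_pow_inv_mul_mem n (k + j) (E.N_antitone hnk hmem)
    have h1 : g ^ i = (σ : E.layerGal (k + j))⁻¹ * (τ : E.layerGal (k + j)) :=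
      (QuotientGroup.eq.2 hi)
    have h2 : (τ : E.layerGal (k + j)) = g ^ i * σ := by
      rw [h1, mul_comm, mul_inv_cancel_left]
    rw [h2, hinv_pow]
  rw [← E.groupRingProj_iwasawaProj R hle, coeff_groupRingProj,
    Finset.sum_congr rfl fun b hb => hfib b (Finset.mem_filter.1 hb).2, Finset.sum_const,
    card_fiber, nsmul_eq_mul, Nat.cast_pow]
  exact dvd_mul_right _ _

end Fiber

section Separation

variable {R : Type*} [CommRing R] (hR : ∀ r : R, (∀ k, (p : R) ^ k ∣ r) → r = 0)
include hR

/-- If `p` is topologically nilpotent, the powers of `γ - 1` intersect trivially. -/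
theorem eq_zero_of_omega_zero_pow_dvd {x : E.iwasawaAlgebra R}
    (hx : ∀ k, E.omega R 0 ^ k ∣ x) : x = 0 := by
  refine E.iwasawaAlgebra_ext R fun m => MonoidAlgebra.ext (Finsupp.ext fun a => hR _ fun k => ?_)
  -- With t = γ - 1 at level m, (t + 1)^(p^m) = 1, and the binomial expansion shows that p divides
  -- t^(p^m).
  have hpow : (p : MonoidAlgebra R (E.layerGal m)) ∣ E.iwasawaProj R m (E.omega R 0) ^ p ^ m := by
    set t := E.iwasawaProj R m (E.omega R 0) with ht
    obtain ⟨r, hr⟩ := exists_add_pow_prime_pow_eq hp.out t 1 m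
    have h1 : (t + 1) ^ p ^ m = 1 := by
      rw [ht, iwasawaProj_omega, sub_add_cancel, ← map_pow, ← QuotientGroup.mk_pow, pow_zero,
        pow_one, (QuotientGroup.eq_one_iff _).2 (E.gen_pow_mem_N.2 dvd_rfl), map_one]
    rw [h1, one_pow] at hr
    refine ⟨-(t * 1 * r), ?_⟩
    linear_combination -hr
  obtain ⟨y, hy⟩ := hx (p ^ m * k)
  have hdvd : ((p : MonoidAlgebra R (E.layerGal m))) ^ k ∣ E.iwasawaProj R m x := by
    rw [hy, map_mul, map_pow, pow_mul]
    exact (pow_dvd_pow_of_dvd hpow k).mul_right _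
  obtain ⟨z, hz⟩ := hdvd
  have hcast : (p : MonoidAlgebra R (E.layerGal m)) ^ k * z = (p ^ k) • z := by
    rw [nsmul_eq_mul, Nat.cast_pow]
  rw [hz, hcast, MonoidAlgebra.coeff_smul, Finsupp.smul_apply, nsmul_eq_mul, Nat.cast_pow]
  exact dvd_mul_right _ _

/-- If `p` is topologically nilpotent, `γ^(p^n) - 1` is not a zero divisor. -/
theorem omega_mem_nonZeroDivisors (n : ℕ) : E.omega R n ∈ nonZeroDivisors (E.iwasawaAlgebra R) := by
  refine mem_nonZeroDivisors_iff_left.2 fun y hy => ?_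
  suffices h : ∀ k, n ≤ k → E.iwasawaProj R k y = 0 by
    refine E.iwasawaAlgebra_ext R fun m => ?_
    rw [← E.groupRingProj_iwasawaProj R (le_max_right n m), h _ (le_max_left n m), map_zero,
      map_zero]
  intro k hnk
  refine MonoidAlgebra.ext (Finsupp.ext fun a => hR _ fun j => ?_)
  exact E.pow_dvd_coeff_of_omega_mul_eq_zero hnk j hy a

end Separation

end ZpExtension

/-! ### Pseudo-nullity over Λ_R and torsion over R -/

theorem GroupRing.algebraMap_mem_nonZeroDivisors {R G : Type*} [CommRing R] [IsDomain R]
    [CommGroup G] {r : R} (hr : r ≠ 0) :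
    algebraMap R (MonoidAlgebra R G) r ∈ nonZeroDivisors (MonoidAlgebra R G) := by
  refine mem_nonZeroDivisors_iff_left.2 fun x hx => MonoidAlgebra.ext (Finsupp.ext fun a => ?_)
  rw [← Algebra.smul_def] at hx
  have := congrArg (fun y => y.coeff a) hx
  rw [MonoidAlgebra.coeff_smul, Finsupp.smul_apply, smul_eq_mul] at this
  exact (mul_eq_zero.1 this).resolve_left hr

/-- Any prime that contains the annihilator of one element lies in the support. -/
theorem IsPseudoNullVia.two_le_height {Λ S : Type*} [CommRing Λ] [CommRing S] {π : Λ →+* S}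
    {X : Type*} [AddCommGroup X] [Module S X] (hX : IsPseudoNullVia π X) (P : Ideal Λ)
    [hP : P.IsPrime] (x : X) (hx : ∀ s, π s • x = 0 → s ∈ P) : 2 ≤ P.height := by
  let := Module.compHom X π
  have hX' : IsPseudoNull Λ X := hX
  refine hX' ⟨P, hP⟩ (Module.mem_support_iff_exists_annihilator.2 ⟨x, fun s hs => ?_⟩)
  exact hx s ((Submodule.mem_annihilator_span_singleton x s).1 hs)

/-- Let `Λ → S` be a surjection with principal kernel, where `Λ` is noetherian and `S` is integral
over the domain `R`. Every element of an `S`-module that is pseudo-null over `Λ` is killed by a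
nonzero element of `R`. -/
theorem exists_smul_eq_zero_of_isPseudoNullVia {R S Λ : Type*} [CommRing R] [IsDomain R]
    [CommRing S] [Algebra R S] [Algebra.IsIntegral R S] [CommRing Λ] [IsNoetherianRing Λ]
    (π : Λ →+* S) (hπ : Function.Surjective π) {t : Λ} (ht : RingHom.ker π = Ideal.span {t})
    {X : Type*} [AddCommGroup X] [Module S X] (hX : IsPseudoNullVia π X) (x : X) :
    ∃ r : R, r ≠ 0 ∧ algebraMap R S r • x = 0 := by
  by_contra! hcon
  have hann : ∀ s, s ∈ (Submodule.span S {x}).annihilator ↔ s • x = 0 := fun s =>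
    Submodule.mem_annihilator_span_singleton _ _
  have hdisj : Disjoint ((Submodule.span S {x}).annihilator : Set S)
      ((nonZeroDivisors R).map (algebraMap R S) : Submonoid S) := by
    rw [Set.disjoint_left]
    rintro _ hs ⟨r, hr, rfl⟩
    exact hcon r (nonZeroDivisors.ne_zero hr) ((hann _).1 hs)
  -- A prime over the annihilator of x that contracts to 0 in R.
  obtain ⟨Q, hQ, hIQ, hQd⟩ := Ideal.exists_le_prime_disjoint _ _ hdisj
  have hQR : Q.comap (algebraMap R S) = ⊥ := by
    refine (eq_bot_iff).2 fun r hr => ?_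
    by_contra hne
    exact Set.disjoint_left.1 hQd hr ⟨r, mem_nonZeroDivisors_of_ne_zero hne, rfl⟩
  have h2 := hX.two_le_height (Q.comap π) x fun s hs => hIQ ((hann _).2 hs)
  have hmin : Q.comap π ∈ (Ideal.span {t}).minimalPrimes := by
    rw [← ht]
    refine ⟨⟨inferInstance, Ideal.ker_le_comap _⟩, fun P ⟨hP, hkP⟩ hPQ => ?_⟩
    have hP' : (P.map π).IsPrime := Ideal.map_isPrime_of_surjective hπ hkP
    have hle : P.map π ≤ Q := Ideal.map_le_iff_le_comap.2 hPQ
    -- Incomparability for the integral extension R → S: a strictly smaller prime would contract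
    -- strictly below 0.
    have heq : P.map π = Q := by
      by_contra hne
      have := Ideal.IsIntegral.comap_lt_comap (R := R) (lt_of_le_of_ne hle hne)
      rw [hQR] at this
      exact not_lt_bot this
    rw [← heq, Ideal.comap_map_of_surjective' _ hπ, sup_eq_left.2 hkP]
  -- Krull's principal ideal theorem, against height at least 2.
  have h1 := Ideal.height_le_one_of_isPrincipal_of_mem_minimalPrimes _ _ hmin
  exact absurd (h2.trans h1) (by norm_num)

namespace ZpExtension

variable {p : ℕ} [hp : Fact p.Prime] {F : Type*} [Field F] (E : ZpExtension p F)
  {R : Type*} [CommRing R]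

/-- If every element of the `R[G_n]`-module `X` is killed by a nonzero element of the domain `R`,
then `X` is pseudo-null over `Λ_R`. -/
theorem isPseudoNullVia_of_torsion [IsDomain R] (hR : ∀ r : R, (∀ k, (p : R) ^ k ∣ r) → r = 0)
    (n : ℕ) {X : Type*} [AddCommGroup X] [Module (MonoidAlgebra R (E.layerGal n)) X]
    (hX : ∀ x : X, ∃ r : R, r ≠ 0 ∧ algebraMap R (MonoidAlgebra R (E.layerGal n)) r • x = 0) :
    IsPseudoNullVia (E.iwasawaProj R n) X := by
  let := Module.compHom X (E.iwasawaProj R n)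
  intro P hP
  obtain ⟨x, hx⟩ := Module.mem_support_iff_exists_annihilator.1 hP
  have hann : ∀ s : E.iwasawaAlgebra R, E.iwasawaProj R n s • x = 0 → s ∈ P.asIdeal := fun s hs =>
    hx ((Submodule.mem_annihilator_span_singleton _ _).2 hs)
  have hPp := P.isPrime
  have hsurj := E.iwasawaProj_surjective R n
  have hker : RingHom.ker (E.iwasawaProj R n) ≤ P.asIdeal := fun s hs =>
    hann s (by rw [RingHom.mem_ker.1 hs, zero_smul])
  have hQ : (P.asIdeal.map (E.iwasawaProj R n)).IsPrime :=
    Ideal.map_isPrime_of_surjective hsurj hker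
  have hcomap : (P.asIdeal.map (E.iwasawaProj R n)).comap (E.iwasawaProj R n) = P.asIdeal := by
    rw [Ideal.comap_map_of_surjective' _ hsurj, sup_eq_left.2 hker]
  set Q := P.asIdeal.map (E.iwasawaProj R n)
  obtain ⟨r, hr, hrx⟩ := hX x
  have hrQ : algebraMap R _ r ∈ Q := by
    obtain ⟨s, hs⟩ := hsurj (algebraMap R _ r)
    rw [← hs]
    exact Ideal.mem_map_of_mem _ (hann s (by rw [hs, hrx]))
  -- Two steps below P: a minimal prime Q' ⊆ Q misses the non-zero-divisor r, so it is strictly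
  -- smaller than Q; its preimage in Λ_R contains the non-zero-divisor ω, so it is not minimal.
  obtain ⟨Q', hQ', hle⟩ := Ideal.exists_minimalPrimes_le (bot_le (a := Q))
  have hQ'p : Q'.IsPrime := hQ'.1.1
  have hrQ' : algebraMap R _ r ∉ Q' := fun h => notMem_nonZeroDivisors_of_mem_mem_minimalPrimes
    h hQ' (GroupRing.algebraMap_mem_nonZeroDivisors hr)
  have hlt : Q'.comap (E.iwasawaProj R n) < P.asIdeal := by
    rw [← hcomap]
    refine lt_of_le_of_ne (Ideal.comap_mono hle) fun h => hrQ' ?_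
    rw [Ideal.comap_injective_of_surjective _ hsurj h]
    exact hrQ
  have h1 : 1 ≤ (Q'.comap (E.iwasawaProj R n)).height := by
    rw [Order.one_le_iff_ne_zero, Ne, Ideal.height_eq_zero_iff]
    intro h
    refine notMem_nonZeroDivisors_of_mem_mem_minimalPrimes (x := E.omega R n) ?_ h
      (E.omega_mem_nonZeroDivisors hR n)
    rw [Ideal.mem_comap, E.iwasawaProj_omega_eq_zero R le_rfl]
    exact zero_mem _
  calc (2 : ℕ∞) = 1 + 1 := one_add_one_eq_two.symm
    _ ≤ (Q'.comap (E.iwasawaProj R n)).height + 1 := by gcongr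
    _ ≤ P.asIdeal.height := Ideal.height_add_one_le_of_lt_of_isPrime hlt

variable [TopologicalSpace R] [IsTopologicalRing R] [T2Space R] [CompactSpace R]
  [IsNoetherianRing R]

/-- The compactness criterion with t = γ - 1, whose quotient R[G_0] is finite over R. -/
theorem isNoetherianRing_iwasawaAlgebra (hR : ∀ r : R, (∀ k, (p : R) ^ k ∣ r) → r = 0) :
    IsNoetherianRing (E.iwasawaAlgebra R) := by
  have : IsNoetherianRing (MonoidAlgebra R (E.layerGal 0)) := IsNoetherianRing.of_finite R _
  exact isNoetherianRing_of_compactSpace (E.iwasawaProj R 0) (E.iwasawaProj_surjective R 0)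
    (E.omega R 0) (E.ker_iwasawaProj 0) fun x hx => E.eq_zero_of_omega_zero_pow_dvd hR hx

/-- Every element of an `R[G_n]`-module that is pseudo-null over `Λ_R` is killed by a nonzero
element of the domain `R`. -/
theorem torsion_of_isPseudoNullVia [IsDomain R] (hR : ∀ r : R, (∀ k, (p : R) ^ k ∣ r) → r = 0)
    (n : ℕ) {X : Type*} [AddCommGroup X] [Module (MonoidAlgebra R (E.layerGal n)) X]
    (hX : IsPseudoNullVia (E.iwasawaProj R n) X) (x : X) :
    ∃ r : R, r ≠ 0 ∧ algebraMap R (MonoidAlgebra R (E.layerGal n)) r • x = 0 := by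
  have := E.isNoetherianRing_iwasawaAlgebra hR
  exact exists_smul_eq_zero_of_isPseudoNullVia _ (E.iwasawaProj_surjective R n)
    (E.ker_iwasawaProj n) hX x

end ZpExtension

/-! ### Cocycles on subgroups -/

section Cocycles

variable {R G M : Type*} [CommRing R] [Group G] [AddCommGroup M] [Module R M]

/-- The function `f` on `G` satisfies the cocycle relation on the subgroup `N`. -/
def IsCocycleOn (ρ : Representation R G M) (N : Subgroup G) (f : G → M) : Prop :=
  ∀ x ∈ N, ∀ y ∈ N, f (x * y) = f x + ρ x (f y)

/-- The value at `g ^ i` of a cocycle with value `a` at `g`. -/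
def powCocycle (ρ : Representation R G M) (g : G) (a : M) (i : ℕ) : M :=
  ∑ j ∈ Finset.range i, ρ (g ^ j) a

variable {ρ : Representation R G M} {N N' : Subgroup G} {f f' : G → M} {g : G} {a : M}

theorem powCocycle_zero : powCocycle ρ g a 0 = 0 := Finset.sum_range_zero _

theorem powCocycle_one : powCocycle ρ g a 1 = a := by simp [powCocycle]

theorem powCocycle_add (i j : ℕ) :
    powCocycle ρ g a (i + j) = powCocycle ρ g a i + ρ (g ^ i) (powCocycle ρ g a j) := by
  simp only [powCocycle, Finset.sum_range_add, map_sum, pow_add, map_mul, Module.End.mul_apply]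

theorem IsCocycleOn.mono (hf : IsCocycleOn ρ N f) (h : N' ≤ N) : IsCocycleOn ρ N' f :=
  fun x hx y hy => hf x (h hx) y (h hy)

theorem IsCocycleOn.map_one (hf : IsCocycleOn ρ N f) : f 1 = 0 := by
  have := hf 1 N.one_mem 1 N.one_mem
  rw [mul_one, _root_.map_one, Module.End.one_apply] at this
  exact left_eq_add.1 this

theorem IsCocycleOn.sub (hf : IsCocycleOn ρ N f) (hf' : IsCocycleOn ρ N f') :
    IsCocycleOn ρ N fun x => f x - f' x := fun x hx y hy => by
  simp only [hf x hx y hy, hf' x hx y hy, map_sub]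
  abel

theorem IsCocycleOn.smul (hf : IsCocycleOn ρ N f) (r : R) :
    IsCocycleOn ρ N fun x => r • f x := fun x hx y hy => by
  simp only [hf x hx y hy, smul_add, map_smul]

theorem isCocycleOn_coboundary (a : M) : IsCocycleOn ρ N fun x => ρ x a - a := fun x _ y _ => by
  simp only [map_mul, Module.End.mul_apply, map_sub]
  abel

theorem IsCocycleOn.apply_pow (hf : IsCocycleOn ρ N f) (hg : g ∈ N) (i : ℕ) :
    f (g ^ i) = powCocycle ρ g (f g) i := by
  induction i with
  | zero => rw [pow_zero, hf.map_one, powCocycle_zero]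
  | succ i ih => rw [pow_succ, hf _ (N.pow_mem hg i) _ hg, ih, powCocycle_add, powCocycle_one]

/-- A cocycle that vanishes on a normal subgroup `N'` has values in the invariants of `N'`. -/
theorem IsCocycleOn.apply_invariant [N'.Normal] (h : N' ≤ N) (hf : IsCocycleOn ρ N f)
    (h0 : ∀ x ∈ N', f x = 0) {x y : G} (hx : x ∈ N') (hy : y ∈ N) : ρ x (f y) = f y := by
  have hc : y⁻¹ * x * y ∈ N' := by
    simpa using Subgroup.Normal.conj_mem ‹N'.Normal› x hx y⁻¹
  have h1 := hf x (h hx) y hy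
  have h2 := hf y hy _ (h hc)
  have e : y * (y⁻¹ * x * y) = x * y := by group
  rw [e, h0 _ hc, map_zero, add_zero] at h2
  rw [h0 x hx, zero_add, h2] at h1
  exact h1.symm

/-- Two cocycles that agree at `g` and on `N'` agree on all products `g ^ i * h`. -/
theorem IsCocycleOn.eq_of_eq (h : N' ≤ N) (hf : IsCocycleOn ρ N f) (hf' : IsCocycleOn ρ N f')
    (hg : g ∈ N) (hgg : f g = f' g) (hN' : ∀ x ∈ N', f x = f' x) (i : ℕ) {x : G} (hx : x ∈ N') :
    f (g ^ i * x) = f' (g ^ i * x) := by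
  rw [hf _ (N.pow_mem hg i) _ (h hx), hf' _ (N.pow_mem hg i) _ (h hx), hf.apply_pow hg,
    hf'.apply_pow hg, hgg, hN' x hx]

/-- Inner conjugation acts trivially on cohomology: x · f - f is the coboundary of f x. -/
theorem IsCocycleOn.conj_apply [N'.Normal] (hf : IsCocycleOn ρ N' f) {x y : G} (hx : x ∈ N')
    (hy : y ∈ N') : ρ x (f (x⁻¹ * y * x)) - f y = ρ y (f x) - f x := by
  have h2 := hf x hx (x⁻¹ * y * x) (N'.mul_mem (N'.mul_mem (N'.inv_mem hx) hy) hx)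
  have e : x * (x⁻¹ * y * x) = y * x := by group
  rw [e, hf y hy x hx] at h2
  rw [sub_eq_sub_iff_add_eq_add, add_comm, ← h2, add_comm]

/-- The relation `g · f - f = ∂a` yields `g ^ i · f - f = ∂(a + g a + … + g ^ (i - 1) a)`. -/
theorem conj_pow_apply [N'.Normal]
    (ha : ∀ y ∈ N', ρ g (f (g⁻¹ * y * g)) - f y = ρ y a - a) (i : ℕ) :
    ∀ y ∈ N', ρ (g ^ i) (f ((g ^ i)⁻¹ * y * g ^ i)) - f y =
      ρ y (powCocycle ρ g a i) - powCocycle ρ g a i := by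
  induction i with
  | zero => intro y _; simp [powCocycle_zero]
  | succ i ih =>
    intro y hy
    have hc : (g ^ i)⁻¹ * y * g ^ i ∈ N' := by
      simpa using Subgroup.Normal.conj_mem ‹N'.Normal› y hy (g ^ i)⁻¹
    have h1 := ha _ hc
    have e : (g ^ (i + 1))⁻¹ * y * g ^ (i + 1) = g⁻¹ * ((g ^ i)⁻¹ * y * g ^ i) * g := by
      rw [pow_succ]
      group
    have e2 : ρ (g ^ i) (ρ ((g ^ i)⁻¹ * y * g ^ i) a) = ρ y (ρ (g ^ i) a) := by
      rw [← Module.End.mul_apply, ← Module.End.mul_apply, ← map_mul, ← map_mul]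
      congr 2
      group
    rw [e, powCocycle_add, powCocycle_one, pow_succ, map_mul, Module.End.mul_apply, map_add,
      sub_eq_iff_eq_add.1 h1, map_add, map_sub, e2, sub_eq_iff_eq_add.1 (ih y hy)]
    abel

/-- If `g · f - f = ∂a`, then `f (g ^ r)` and `a + g a + … + g ^ (r - 1) a` differ by an
invariant element. -/
theorem IsCocycleOn.apply_pow_sub_invariant [N'.Normal] (hf : IsCocycleOn ρ N' f)
    (ha : ∀ y ∈ N', ρ g (f (g⁻¹ * y * g)) - f y = ρ y a - a) {r : ℕ} (hr : g ^ r ∈ N') {y : G}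
    (hy : y ∈ N') : ρ y (f (g ^ r) - powCocycle ρ g a r) = f (g ^ r) - powCocycle ρ g a r := by
  -- g ^ r · f - f is the coboundary of the power sum and, since g ^ r ∈ N', also of f (g ^ r).
  have h1 := conj_pow_apply ha r y hy
  rw [hf.conj_apply hr hy] at h1
  rw [sub_eq_sub_iff_add_eq_add] at h1
  rw [map_sub, sub_eq_sub_iff_add_eq_add, h1, add_comm]

/-- The difference between f (g ^ r) and the power sum is the H² obstruction to extending f to g.
Being invariant, it gets multiplied by k when r is replaced by r k, so with p-primary coefficients
it dies at a deeper level. -/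
theorem IsCocycleOn.apply_pow_mul [N'.Normal] (hf : IsCocycleOn ρ N' f)
    (ha : ∀ y ∈ N', ρ g (f (g⁻¹ * y * g)) - f y = ρ y a - a) {r : ℕ} (hr : g ^ r ∈ N') (k : ℕ) :
    f (g ^ (r * k)) = powCocycle ρ g a (r * k) + k • (f (g ^ r) - powCocycle ρ g a r) := by
  induction k with
  | zero => simp [hf.map_one, powCocycle_zero]
  | succ k ih =>
    have hk : g ^ (r * k) ∈ N' := by
      rw [pow_mul]
      exact N'.pow_mem hr k
    have hinv := hf.apply_pow_sub_invariant ha hr hr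
    rw [mul_add, mul_one, add_comm (r * k), pow_add, hf _ hr _ hk, ih, powCocycle_add, map_add,
      map_nsmul, hinv, add_comm k, add_smul, one_smul]
    abel

/-- Extension of a cocycle from `N'` to the group generated by `N'` and `g`. -/
theorem IsCocycleOn.exists_extension [N'.Normal] (hf : IsCocycleOn ρ N' f)
    (ha : ∀ y ∈ N', ρ g (f (g⁻¹ * y * g)) - f y = ρ y a - a) {r : ℕ} (hr : g ^ r ∈ N')
    (hr' : ∀ i, g ^ i ∈ N' → r ∣ i) (hfr : f (g ^ r) = powCocycle ρ g a r)
    (hN : ∀ x ∈ N, ∃ i : ℕ, ∃ y ∈ N', x = g ^ i * y) :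
    ∃ F : G → M, IsCocycleOn ρ N F ∧ (∀ x ∈ N', F x = f x) ∧
      ∀ x ∈ N, ∀ y ∈ N', F (x * y) = F x + ρ x (f y) := by
  classical
  have hpow : ∀ k, f (g ^ (r * k)) = powCocycle ρ g a (r * k) := fun k => by
    rw [hf.apply_pow_mul ha hr, hfr, sub_self, smul_zero, add_zero]
  -- Independence of the presentation g ^ i * y: two presentations differ by a power of g lying in
  -- N', where f equals the power sum.
  have haux : ∀ (i k : ℕ) (x y : G), x ∈ N' → y ∈ N' → g ^ i * x = g ^ (i + k) * y →
      powCocycle ρ g a i + ρ (g ^ i) (f x) = powCocycle ρ g a (i + k) + ρ (g ^ (i + k)) (f y) := by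
    intro i k x y hx hy h
    rw [pow_add, mul_assoc, mul_right_inj] at h
    have hk : g ^ k ∈ N' := by
      have := N'.mul_mem hx (N'.inv_mem hy)
      rwa [h, mul_inv_cancel_right] at this
    obtain ⟨l, rfl⟩ := hr' k hk
    rw [h, hf _ hk _ hy, hpow, powCocycle_add, pow_add, map_mul, Module.End.mul_apply, map_add,
      add_assoc]
  have hwd : ∀ (i j : ℕ) (x y : G), x ∈ N' → y ∈ N' → g ^ i * x = g ^ j * y →
      powCocycle ρ g a i + ρ (g ^ i) (f x) = powCocycle ρ g a j + ρ (g ^ j) (f y) := by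
    intro i j x y hx hy h
    rcases le_total i j with hij | hij
    · obtain ⟨k, rfl⟩ := Nat.exists_eq_add_of_le hij
      exact haux i k x y hx hy h
    · obtain ⟨k, rfl⟩ := Nat.exists_eq_add_of_le hij
      exact (haux j k y x hy hx h.symm).symm
  -- The cocycle relation forces the value at g ^ i * y. The default 0 never occurs on N.
  let F : G → M := fun x => if h : ∃ i : ℕ, ∃ y ∈ N', x = g ^ i * y then
    powCocycle ρ g a h.choose + ρ (g ^ h.choose) (f h.choose_spec.choose) else 0
  have hF : ∀ (i : ℕ), ∀ y ∈ N', F (g ^ i * y) = powCocycle ρ g a i + ρ (g ^ i) (f y) := by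
    intro i y hy
    have h : ∃ j : ℕ, ∃ z ∈ N', g ^ i * y = g ^ j * z := ⟨i, y, hy, rfl⟩
    change (if h : ∃ j : ℕ, ∃ z ∈ N', g ^ i * y = g ^ j * z then _ else _) = _
    rw [dif_pos h]
    exact (hwd _ _ _ _ hy h.choose_spec.choose_spec.1 h.choose_spec.choose_spec.2).symm
  have hmul : ∀ x ∈ N, ∀ y ∈ N', F (x * y) = F x + ρ x (f y) := by
    intro x hx y hy
    obtain ⟨i, z, hz, rfl⟩ := hN x hx
    rw [mul_assoc, hF i _ (N'.mul_mem hz hy), hF i z hz, hf z hz y hy, map_add, ← add_assoc,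
      map_mul, Module.End.mul_apply]
  refine ⟨F, fun x hx y hy => ?_, fun x hx => ?_, hmul⟩
  · obtain ⟨i, u, hu, rfl⟩ := hN x hx
    obtain ⟨j, v, hv, rfl⟩ := hN y hy
    have hc : (g ^ j)⁻¹ * u * g ^ j ∈ N' := by
      simpa using Subgroup.Normal.conj_mem ‹N'.Normal› u hu (g ^ j)⁻¹
    have e : g ^ i * u * (g ^ j * v) = g ^ (i + j) * ((g ^ j)⁻¹ * u * g ^ j * v) := by
      rw [pow_add]
      group
    have e2 : ρ (g ^ j) (ρ ((g ^ j)⁻¹ * u * g ^ j) (f v)) = ρ u (ρ (g ^ j) (f v)) := by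
      rw [← Module.End.mul_apply, ← Module.End.mul_apply, ← map_mul, ← map_mul]
      congr 2
      group
    rw [e, hF _ _ (N'.mul_mem hc hv), hF i u hu, hF j v hv, hf _ hc _ hv, powCocycle_add, pow_add,
      map_mul, Module.End.mul_apply, map_add, map_add, e2,
      sub_eq_iff_eq_add.1 (conj_pow_apply ha j u hu), map_mul, Module.End.mul_apply]
    simp only [map_add, map_sub]
    abel
  · have := hF 0 x hx
    simpa [powCocycle_zero] using this

variable [TopologicalSpace G]

/-- The extension by zero of a cocycle on `N`. -/
def Z1.extend (c : Z1 (resRep ρ N)) : G → M := Function.extend Subtype.val c.1 0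

theorem Z1.extend_apply (c : Z1 (resRep ρ N)) (x : N) : Z1.extend c x = c.1 x :=
  Subtype.val_injective.extend_apply _ _ _

theorem Z1.isCocycleOn_extend (c : Z1 (resRep ρ N)) : IsCocycleOn ρ N (Z1.extend c) :=
  fun x hx y hy => by
    rw [Z1.extend_apply c ⟨x, hx⟩, Z1.extend_apply c ⟨y, hy⟩]
    exact (Z1.extend_apply c (⟨x, hx⟩ * ⟨y, hy⟩)).trans (c.2.2 _ _)

theorem H1.mk_eq_zero_iff {c : Z1 (resRep ρ N)} :
    Submodule.Quotient.mk (p := B1 (resRep ρ N)) c = 0 ↔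
      ∃ a, ∀ x ∈ N, Z1.extend c x = ρ x a - a := by
  rw [Submodule.Quotient.mk_eq_zero]
  constructor
  · rintro ⟨a, ha⟩
    exact ⟨a, fun x hx => (Z1.extend_apply c ⟨x, hx⟩).trans (ha ⟨x, hx⟩)⟩
  · rintro ⟨a, ha⟩
    exact ⟨a, fun x => (Z1.extend_apply c x).symm.trans (ha x x.2)⟩

theorem H1.res_mk_eq_zero_iff (h : N' ≤ N) {c : Z1 (resRep ρ N)} :
    H1.res ρ h (Submodule.Quotient.mk c) = 0 ↔ ∃ a, ∀ x ∈ N', Z1.extend c x = ρ x a - a := by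
  have hres : ∀ x : N', Z1.extend c (x : G) = c.1 (Subgroup.inclusion h x) := fun x =>
    Z1.extend_apply c (Subgroup.inclusion h x)
  change Submodule.Quotient.mk (p := B1 (resRep ρ N')) (Z1.map _ _ _ _ c) = 0 ↔ _
  rw [Submodule.Quotient.mk_eq_zero]
  constructor
  · rintro ⟨a, ha⟩
    exact ⟨a, fun x hx => (hres ⟨x, hx⟩).trans (ha ⟨x, hx⟩)⟩
  · rintro ⟨a, ha⟩
    exact ⟨a, fun x => (hres x).symm.trans (ha x x.2)⟩

/-- If an element of the normal subgroup `N'` acts as a scalar `u` such that `u - 1` is a unit,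
then the restriction map `H¹(N, M) → H¹(N', M)` is injective. -/
theorem H1.eq_zero_of_res_eq_zero [N'.Normal] (h : N' ≤ N) {σ : G} (hσ : σ ∈ N') {u : R}
    (hu : IsUnit (u - 1)) (hact : ∀ m, ρ σ m = u • m) {x : H1 (resRep ρ N)}
    (hx : H1.res ρ h x = 0) : x = 0 := by
  induction x using Submodule.Quotient.induction_on with
  | H c =>
    obtain ⟨a, ha⟩ := (H1.res_mk_eq_zero_iff h).1 hx
    refine H1.mk_eq_zero_iff.2 ⟨a, fun y hy => ?_⟩
    -- Minus the coboundary, the cocycle vanishes on N', so its values are fixed by σ; as u - 1 is a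
    -- unit, they are 0.
    have hc := (Z1.isCocycleOn_extend c).sub (isCocycleOn_coboundary (ρ := ρ) (N := N) a)
    have hinv := hc.apply_invariant h (fun x hx => sub_eq_zero.2 (ha x hx)) hσ hy
    rw [← sub_eq_zero]
    refine (hu.smul_eq_zero).1 ?_
    rw [sub_smul, one_smul, sub_eq_zero, ← hact]
    exact hinv

end Cocycles

/-! ### Invariants and coinvariants up to torsion -/

section Torsion

variable {p : ℕ} [Fact p.Prime] {R B : Type*} [CommRing R] [IsDomain R] [IsNoetherianRing R]
  [AddCommGroup B] [Module R B]

/-- The endomorphism of the dual of `B` induced by an endomorphism of `B`. -/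
def DiscreteDual.comap (D : B →ₗ[R] B) : DiscreteDual p B →ₗ[R] DiscreteDual p B where
  toFun φ := AddMonoidHom.comp φ D.toAddMonoidHom
  map_add' _ _ := rfl
  map_smul' r φ := AddMonoidHom.ext fun x => congrArg φ (D.map_smul r x).symm

/-- Let `B` be a `p`-primary module with finitely generated Pontryagin dual, and let `D` be an
endomorphism of `B`. If the dual of `ker D` is torsion, then `coker D` is killed by a nonzero
element of `R`. -/
theorem exists_forall_smul_mem_range (hB : ∀ b : B, ∃ k, p ^ k • b = 0)
    [Module.Finite R (DiscreteDual p B)] (D : B →ₗ[R] B)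
    (hD : ∀ φ : DiscreteDual p B, ∃ r : R, r ≠ 0 ∧ ∀ b, D b = 0 → φ (r • b) = 0) :
    ∃ r : R, r ≠ 0 ∧ ∀ b, ∃ b', r • b = D b' := by
  set D' : DiscreteDual p B →ₗ[R] DiscreteDual p B := DiscreteDual.comap D
  -- A character trivial on ker D factors through D, so this quotient is dual to ker D, hence
  -- torsion.
  have hq : Module.finrank R (DiscreteDual p B ⧸ LinearMap.range D') = 0 := by
    refine Module.finrank_eq_zero_iff.2 fun x => ?_
    obtain ⟨φ, rfl⟩ := Submodule.Quotient.mk_surjective _ x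
    obtain ⟨r, hr, h⟩ := hD φ
    obtain ⟨ψ, hψ⟩ := QpZp.exists_factor D.toAddMonoidHom (r • φ : DiscreteDual p B) h
    refine ⟨r, hr, ?_⟩
    rw [← Submodule.Quotient.mk_smul, Submodule.Quotient.mk_eq_zero]
    exact ⟨ψ, hψ⟩
  -- Rank-nullity: an endomorphism has kernel and cokernel of equal rank.
  have hk : Module.finrank R (LinearMap.ker D') = 0 := by
    have h1 := Submodule.finrank_quotient_add_finrank (LinearMap.range D')
    have h2 := Submodule.finrank_quotient_add_finrank (LinearMap.ker D')
    rw [(LinearMap.quotKerEquivRange D').finrank_eq] at h2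
    omega
  have htors : Module.IsTorsion R (LinearMap.ker D') := fun φ => by
    obtain ⟨r, hr, h⟩ := Module.finrank_eq_zero_iff.1 hk φ
    exact ⟨⟨r, mem_nonZeroDivisors_of_ne_zero hr⟩, h⟩
  -- The kernel of D' is finitely generated, so one r kills all of it. It consists of the characters
  -- of coker D, and these separate points.
  obtain ⟨r, hr, hr0⟩ := Submodule.annihilator_top_inter_nonZeroDivisors htors
  refine ⟨r, nonZeroDivisors.ne_zero hr0, fun b => ?_⟩
  by_contra! hcon
  have hne : (LinearMap.range D).mkQ (r • b) ≠ 0 := fun h => by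
    obtain ⟨b', hb'⟩ := (Submodule.Quotient.mk_eq_zero _).1 h
    exact hcon b' hb'.symm
  obtain ⟨k, hk⟩ := hB (r • b)
  obtain ⟨φ, hφ⟩ := QpZp.exists_apply_ne_zero (p := p) hne (k := k) (by
    rw [← map_nsmul, hk, map_zero])
  let φ' : DiscreteDual p B := φ.comp (LinearMap.range D).mkQ.toAddMonoidHom
  have hφ' : φ' ∈ LinearMap.ker D' := by
    refine AddMonoidHom.ext fun x => ?_
    have hx : (LinearMap.range D).mkQ (D x) = 0 :=
      (Submodule.Quotient.mk_eq_zero _).2 (LinearMap.mem_range_self D x)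
    exact (congrArg φ hx).trans (map_zero φ)
  have hr' : r ∈ (⊤ : Submodule R (LinearMap.ker D')).annihilator := hr
  have hrφ : (r • φ' : DiscreteDual p B) = 0 :=
    congrArg Subtype.val (Submodule.mem_annihilator.1 hr' ⟨φ', hφ'⟩ Submodule.mem_top)
  exact hφ (DFunLike.congr_fun hrφ b)

end Torsion

/-! ### Extending classes from an open subgroup -/

/-- An extension of a continuous cocycle from an open subgroup is continuous. -/
theorem isLocallyConstant_of_extension {R G M : Type*} [CommRing R] [Group G] [TopologicalSpace G]
    [IsTopologicalGroup G] [AddCommGroup M] [Module R M] {ρ : Representation R G M}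
    {N N₁ N₂ : Subgroup G} (h : N₂ ≤ N₁) (ho : IsOpen (N₂ : Set G)) (c : Z1 (resRep ρ N₁))
    {F : G → M} (hF : ∀ x ∈ N, ∀ y ∈ N₂, F (x * y) = F x + ρ x (Z1.extend c y)) :
    IsLocallyConstant fun y : N => F y := by
  obtain ⟨V, hV, hVc⟩ := isOpen_induced_iff.1 (c.2.1.isOpen_fiber 0)
  have hcV : ∀ y (hy : y ∈ N₁), y ∈ V ↔ c.1 ⟨y, hy⟩ = 0 := fun y hy =>
    Set.ext_iff.1 hVc ⟨y, hy⟩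
  have h1 : (1 : G) ∈ V := (hcV 1 N₁.one_mem).2 (by
    rw [← Z1.extend_apply]
    exact (Z1.isCocycleOn_extend c).map_one)
  -- c vanishes on V near 1, so F is constant on the translate y (V ∩ N₂).
  refine (IsLocallyConstant.iff_exists_open _).2 fun y =>
    ⟨(fun z : N => (y : G)⁻¹ * z) ⁻¹' (V ∩ N₂), (hV.inter ho).preimage (by fun_prop), ?_, ?_⟩
  · rw [Set.mem_preimage, inv_mul_cancel]
    exact ⟨h1, N₂.one_mem⟩
  · rintro z ⟨hzV, hzN⟩
    have h0 : Z1.extend c ((y : G)⁻¹ * z) = 0 :=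
      (Z1.extend_apply c ⟨_, h hzN⟩).trans ((hcV _ (h hzN)).1 hzV)
    have := hF y y.2 _ hzN
    rwa [h0, map_zero, add_zero, mul_inv_cancel_left] at this

section Extension

variable {R G M : Type*} [CommRing R] [Group G] [TopologicalSpace G] [IsTopologicalGroup G]
  [AddCommGroup M] [Module R M] {ρ : Representation R G M} {N N₁ N₂ : Subgroup G}

theorem H1.exists_of_conjRep_eq [N.Normal] {g : G} {c : Z1 (resRep ρ N)}
    (hc : H1.conjRep ρ N g (Submodule.Quotient.mk c) = Submodule.Quotient.mk c) :
    ∃ a, ∀ y ∈ N, ρ g (Z1.extend c (g⁻¹ * y * g)) - Z1.extend c y = ρ y a - a := by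
  obtain ⟨a, ha⟩ := (Submodule.Quotient.eq (B1 (resRep ρ N))).1 hc
  refine ⟨a, fun y hy => ?_⟩
  have h1 : ρ g (c.1 (MulAut.conjNormal g⁻¹ ⟨y, hy⟩)) - c.1 ⟨y, hy⟩ = ρ y a - a := ha ⟨y, hy⟩
  rwa [← Z1.extend_apply, ← Z1.extend_apply, MulAut.conjNormal_apply, inv_inv] at h1

theorem H1.exists_res_eq_of_extension (h : N₂ ≤ N₁) (h' : N₂ ≤ N) (ho : IsOpen (N₂ : Set G))
    (c : Z1 (resRep ρ N₁)) {F : G → M} (hF : IsCocycleOn ρ N F)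
    (hFc : ∀ y ∈ N₂, F y = Z1.extend c y)
    (hFm : ∀ x ∈ N, ∀ y ∈ N₂, F (x * y) = F x + ρ x (Z1.extend c y)) :
    ∃ y : H1 (resRep ρ N), H1.res ρ h' y = H1.res ρ h (Submodule.Quotient.mk c) := by
  let c' : Z1 (resRep ρ N) := ⟨fun y => F y, isLocallyConstant_of_extension h ho c hFm,
    fun y z => hF _ y.2 _ z.2⟩
  refine ⟨Submodule.Quotient.mk c', ?_⟩
  refine congrArg (Submodule.Quotient.mk (p := B1 (resRep ρ N₂))) (Subtype.ext (funext fun y => ?_))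
  exact (hFc y y.2).trans (Z1.extend_apply c (Subgroup.inclusion h y))

/-- A class on `N₁` that is invariant under `g` extends to `N` after restriction to `N₂`, if
`g ^ (r * k)` generates `N` modulo `N₂` for suitable `r`, `k`. -/
theorem H1.exists_res_eq [N₁.Normal] [N₂.Normal] (h : N₂ ≤ N₁) (h' : N₂ ≤ N)
    (ho : IsOpen (N₂ : Set G)) {g : G} {c : Z1 (resRep ρ N₁)} {a : M}
    (ha : ∀ y ∈ N₁, ρ g (Z1.extend c (g⁻¹ * y * g)) - Z1.extend c y = ρ y a - a) {r k : ℕ}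
    (hr : g ^ r ∈ N₁) (hk : k • (Z1.extend c (g ^ r) - powCocycle ρ g a r) = 0)
    (hrk : g ^ (r * k) ∈ N₂) (hrk' : ∀ i, g ^ i ∈ N₂ → r * k ∣ i)
    (hN : ∀ x ∈ N, ∃ i : ℕ, (g ^ i)⁻¹ * x ∈ N₂) :
    ∃ y : H1 (resRep ρ N), H1.res ρ h' y = H1.res ρ h (Submodule.Quotient.mk c) := by
  have hf := Z1.isCocycleOn_extend c
  -- Relative to N₂ the relevant power is g ^ (r * k), where the obstruction is k times the original
  -- one, hence zero.
  have hfr := hf.apply_pow_mul ha hr k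
  rw [hk, add_zero] at hfr
  obtain ⟨F, hF, hFc, hFm⟩ := (hf.mono h).exists_extension (N := N) (fun y hy => ha y (h hy)) hrk
    hrk' hfr fun y hy => by
      obtain ⟨i, hi⟩ := hN y hy
      exact ⟨i, _, hi, (mul_inv_cancel_left _ _).symm⟩
  exact H1.exists_res_eq_of_extension h h' ho c hF hFc hFm

end Extension

/-! ### Restriction of cohomology classes in a `ℤ_p`-extension -/

section Restriction

variable {p : ℕ} [hp : Fact p.Prime] {F : Type*} [Field F] (E : ZpExtension p F)
  {R M : Type*} [CommRing R] [AddCommGroup M] [Module R M] (ρ : Representation R (GlobalGal F) M)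

/-- The elements of `M` that are fixed by some `Gal(F̄ / F_m)`. -/
def ZpExtension.invariants : Submodule R M where
  carrier := {b | ∃ m, ∀ x ∈ E.N m, ρ x b = b}
  add_mem' := by
    rintro b c ⟨m, hb⟩ ⟨k, hc⟩
    refine ⟨max m k, fun x hx => ?_⟩
    rw [map_add, hb x (E.N_antitone (le_max_left m k) hx),
      hc x (E.N_antitone (le_max_right m k) hx)]
  zero_mem' := ⟨0, fun x _ => map_zero _⟩
  smul_mem' := by
    rintro r b ⟨m, hb⟩
    exact ⟨m, fun x hx => by rw [map_smul, hb x hx]⟩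

theorem ZpExtension.apply_mem_invariants (σ : GlobalGal F) {b : M} (hb : b ∈ E.invariants ρ) :
    ρ σ b ∈ E.invariants ρ := by
  obtain ⟨m, hb⟩ := hb
  refine ⟨m, fun x hx => ?_⟩
  have hc : σ⁻¹ * x * σ ∈ E.N m := by
    simpa using Subgroup.Normal.conj_mem inferInstance x hx σ⁻¹
  have e : x * σ = σ * (σ⁻¹ * x * σ) := by group
  rw [← Module.End.mul_apply, ← map_mul, e, map_mul, Module.End.mul_apply, hb _ hc]

/-- The endomorphism `γ^(p^n) - 1` of the invariants of `Gal(F̄ / F_∞)`. -/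
def ZpExtension.genSubOne (n : ℕ) : E.invariants ρ →ₗ[R] E.invariants ρ :=
  (ρ (E.gen ^ p ^ n) - 1).restrict fun _ hb =>
    sub_mem (E.apply_mem_invariants ρ _ hb) hb

-- γ^(p^n) generates Gal(F̄/F_n) modulo every Gal(F̄/F_m), in particular modulo one that fixes b. So
-- ker D consists of invariants of Gal(F̄/F_n).
variable {ρ} in
theorem ZpExtension.apply_eq_of_genSubOne_eq_zero {n : ℕ} {b : E.invariants ρ}
    (hb : E.genSubOne ρ n b = 0) {x : GlobalGal F} (hx : x ∈ E.N n) : ρ x b = (b : M) := by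
  have hg : ρ (E.gen ^ p ^ n) b = (b : M) := sub_eq_zero.1 (congrArg Subtype.val hb)
  obtain ⟨m, hm⟩ := b.2
  obtain ⟨i, hi⟩ := E.exists_gen_pow_inv_mul_mem n m hx
  have hgi : ∀ i : ℕ, ρ ((E.gen ^ p ^ n) ^ i) b = (b : M) := fun i => by
    induction i with
    | zero => rw [pow_zero, map_one, Module.End.one_apply]
    | succ i ih => rw [pow_succ, map_mul, Module.End.mul_apply, hg, ih]
  have e : x = (E.gen ^ p ^ n) ^ i * (((E.gen ^ p ^ n) ^ i)⁻¹ * x) := by group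
  rw [e, map_mul, Module.End.mul_apply, hm _ hi, hgi]

theorem ZpExtension.gen_pow_mem {n : ℕ} : E.gen ^ p ^ n ∈ E.N n := E.gen_pow_mem_N.2 dvd_rfl

variable {ρ}

/-- If `r` kills the coinvariants, then it kills the kernel of the restriction maps. -/
theorem ZpExtension.smul_eq_zero_of_res_eq_zero {n m : ℕ} (h : n ≤ m) {r : R}
    (hr : ∀ b, ∃ b', r • b = E.genSubOne ρ n b') {x : H1 (resRep ρ (E.N n))}
    (hx : H1.res ρ (E.N_antitone h) x = 0) : r • x = 0 := by
  induction x using Submodule.Quotient.induction_on with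
  | H c =>
    obtain ⟨a, ha⟩ := (H1.res_mk_eq_zero_iff _).1 hx
    set f := Z1.extend c
    have hf : IsCocycleOn ρ (E.N n) f := Z1.isCocycleOn_extend c
    have hc := hf.sub (isCocycleOn_coboundary (ρ := ρ) (N := E.N n) a)
    have hb : f (E.gen ^ p ^ n) - (ρ (E.gen ^ p ^ n) a - a) ∈ E.invariants ρ :=
      ⟨m, fun x hx => hc.apply_invariant (E.N_antitone h) (fun x hx => sub_eq_zero.2 (ha x hx)) hx
        E.gen_pow_mem⟩
    -- r times the corrected value at γ^(p^n) is D b', with b' fixed from level k on. So r f and the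
    -- coboundary of r a + b' agree at γ^(p^n) and on level max m k, which together generate.
    obtain ⟨⟨b', k, hk⟩, hb'⟩ := hr ⟨_, hb⟩
    have hb'' : r • (f (E.gen ^ p ^ n) - (ρ (E.gen ^ p ^ n) a - a)) = ρ (E.gen ^ p ^ n) b' - b' :=
      congrArg Subtype.val hb'
    refine H1.mk_eq_zero_iff.2 ⟨r • a + b', fun y hy => ?_⟩
    have hrc : ∀ y ∈ E.N n, Z1.extend (r • c) y = r • f y := fun y hy =>
      (Z1.extend_apply _ ⟨y, hy⟩).trans (congrArg (r • ·) (Z1.extend_apply c ⟨y, hy⟩).symm)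
    rw [hrc y hy]
    have hle : E.N (max m k) ≤ E.N n := E.N_antitone (h.trans (le_max_left m k))
    obtain ⟨i, hi⟩ := E.exists_gen_pow_inv_mul_mem n (max m k) hy
    have e : y = (E.gen ^ p ^ n) ^ i * (((E.gen ^ p ^ n) ^ i)⁻¹ * y) := by group
    rw [e]
    refine (hf.smul r).eq_of_eq hle (isCocycleOn_coboundary (ρ := ρ) (N := E.N n) (r • a + b'))
      E.gen_pow_mem ?_ (fun x hx => ?_) i hi
    · rw [smul_sub, sub_eq_iff_eq_add] at hb''
      rw [hb'', map_add, map_smul, smul_sub]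
      abel
    · rw [ha x (E.N_antitone (le_max_left m k) hx), map_add, map_smul,
        hk x (E.N_antitone (le_max_right m k) hx), smul_sub]
      abel

/-- A class over `F_m` that is invariant under `Gal(F_m / F_n)` comes from `F_n`, up to enlarging
`m`. -/
theorem ZpExtension.exists_res_eq (hM : ∀ b : M, ∃ k, p ^ k • b = 0) {n m : ℕ} (h : n ≤ m)
    {x : H1 (resRep ρ (E.N m))} (hx : H1.conjRep ρ (E.N m) (E.gen ^ p ^ n) x = x) :
    ∃ (k : ℕ) (hk : m ≤ k) (y : H1 (resRep ρ (E.N n))),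
      H1.res ρ (E.N_antitone (h.trans hk)) y = H1.res ρ (E.N_antitone hk) x := by
  induction x using Submodule.Quotient.induction_on with
  | H c =>
    obtain ⟨a, ha⟩ := H1.exists_of_conjRep_eq hx
    generalize hg : E.gen ^ p ^ n = g at ha
    -- p ^ j kills the obstruction, so the class descends after restriction to F_(m+j).
    obtain ⟨j, hj⟩ := hM (Z1.extend c (g ^ p ^ (m - n)) - powCocycle ρ g a (p ^ (m - n)))
    have hmem : ∀ {l i : ℕ}, g ^ i ∈ E.N l ↔ p ^ l ∣ p ^ n * i := fun {l i} => by
      rw [← hg, ← pow_mul, E.gen_pow_mem_N]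
    have e : p ^ (m + j) = p ^ n * (p ^ (m - n) * p ^ j) := by
      rw [← mul_assoc, ← pow_add, ← pow_add, Nat.add_sub_cancel' h]
    refine ⟨m + j, Nat.le_add_right m j, ?_⟩
    refine H1.exists_res_eq _ _ (E.isOpen_N (m + j)) ha (hmem.2 ?_) hj (hmem.2 ?_)
      (fun i hi => ?_) (fun x hx => ?_)
    · rw [← pow_add, Nat.add_sub_cancel' h]
    · rw [e]
    · rw [hmem, e] at hi
      exact Nat.dvd_of_mul_dvd_mul_left (pow_pos hp.out.pos n) hi
    · obtain ⟨i, hi⟩ := E.exists_gen_pow_inv_mul_mem n (m + j) hx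
      exact ⟨i, hg ▸ hi⟩

end Restriction

/-! ### Local analysis at the places above `p` -/

theorem ZpExtension.mem_fixingSubgroup_top {p : ℕ} [Fact p.Prime] {F : Type*} [Field F]
    (E : ZpExtension p F) {σ : GlobalGal F} : σ ∈ E.top.fixingSubgroup ↔ E.toZp σ = 1 := by
  rw [← IntermediateField.restrictNormalHom_ker, MonoidHom.mem_ker, toZp_apply]
  exact (map_eq_one_iff _ E.galois_iso.some.injective).symm

section Local

variable {p : ℕ} [hp : Fact p.Prime] {F : Type*} [Field F] [NumberField F]

/-- Prime to p, e is invertible in ℤ_p, so the image of φ is -e times some y in ℤ_p, and total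
ramification realises y by an inertia element. -/
theorem TotallyRamifiedAtP.exists_mem_inertia {E : ZpExtension p F} {ι : Embeddings F}
    (hE : TotallyRamifiedAtP E ι) {v : HeightOneSpectrum (𝓞 F)} (hv : Above p v) {e : ℕ}
    (he : ¬ p ∣ e) (φ : LocalGal v) :
    ∃ τ ∈ inertia v, decomp ι v (φ * τ ^ e) ∈ E.top.fixingSubgroup := by
  obtain ⟨y, hy⟩ : (e : ℤ_[p]) ∣ -(E.toZp (decomp ι v φ)).toAdd := by
    refine IsUnit.dvd ?_
    rw [PadicInt.isUnit_iff, PadicInt.norm_natCast_eq_one_iff]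
    exact (hp.out.coprime_iff_not_dvd.2 he)
  obtain ⟨τ, hτ, h⟩ := hE v hv (E.galois_iso.some.symm (Multiplicative.ofAdd y))
  refine ⟨τ, hτ, E.mem_fixingSubgroup_top.2 (Multiplicative.toAdd.injective ?_)⟩
  have h' : E.toZp (decomp ι v τ) = Multiplicative.ofAdd y := by
    rw [E.toZp_apply, h, ContinuousMulEquiv.apply_symm_apply]
  rw [map_mul, map_pow, map_mul, map_pow, h', toAdd_mul, toAdd_pow, toAdd_ofAdd, nsmul_eq_mul,
    ← hy, toAdd_one, add_neg_cancel]

variable {R : Type*} [CommRing R] [TopologicalSpace R] [IsTopologicalRing R]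
  {T : Type*} [AddCommGroup T] [Module R T] {ρ : Representation R (GlobalGal F) T}
  {ι : Embeddings F} (Fil : Filtration p ρ ι)

theorem Filtration.minusRep_apply_eq_smul {v : HeightOneSpectrum (𝓞 F)} (hv : Above p v)
    {σ : LocalGal v} {w : R} (hw : ∀ t, ρ (decomp ι v σ) t - w • t ∈ Fil.plus v hv)
    (x : DiscMod p R T ⧸ Fil.plusA v hv) : Fil.minusRep v hv σ x = w • x := by
  induction x using Submodule.Quotient.induction_on with
  | H a =>
    refine (Submodule.Quotient.eq (Fil.plusA v hv)).2 ?_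
    change (ρ (decomp ι v σ)).rTensor (ringDual p R) a - w • a ∈ Fil.plusA v hv
    induction a using TensorProduct.induction_on with
    | zero => simp
    | tmul t f =>
      rw [LinearMap.rTensor_tmul, TensorProduct.smul_tmul', ← TensorProduct.sub_tmul]
      exact ⟨⟨_, hw t⟩ ⊗ₜ f, rfl⟩
    | add a b ha hb =>
      rw [map_add, smul_add, add_sub_add_comm]
      exact add_mem ha hb

open IsLocalRing in
/-- For `v ∣ p`, some element of `Gal(F̄_v / F_{∞,v})` acts on `A / F_v^+(A)` as a scalar that is
not congruent to `1` modulo the maximal ideal. -/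
theorem IsOrdinary.exists_minusRep_eq_smul [IsLocalRing R] [Finite (ResidueField R)]
    [CharP (ResidueField R) p] {E : ZpExtension p F} (hE : TotallyRamifiedAtP E ι)
    {Sigma : Set (HeightOneSpectrum (𝓞 F))} {n : ℕ} (hT : IsOrdinary p ρ ι Fil E Sigma n)
    {v : HeightOneSpectrum (𝓞 F)} (hv : Above p v) :
    ∃ σ : LocalGal v, decomp ι v σ ∈ E.top.fixingSubgroup ∧
      ∃ w : R, IsUnit (w - 1) ∧ ∀ x, Fil.minusRep v hv σ x = w • x := by
  obtain ⟨δ, θ, -, -, hδ, ⟨u, hu, hu1⟩, -, ⟨φ, hφ, hθ⟩, hact⟩ := hT.characters v hv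
  have := Fintype.ofFinite (ResidueField R)
  have hcard : p ∣ Fintype.card (ResidueField R) :=
    (CharP.cast_eq_zero_iff (ResidueField R) p _).1 (Nat.cast_card_eq_zero _)
  -- With q the order of the residue field of R, the exponent q - 1 is prime to p and makes θ (τ ^
  -- (q - 1)) residually 1, while δ is trivial on inertia. So φ τ^(q-1) acts by a scalar congruent
  -- to u.
  have he : ¬ p ∣ Fintype.card (ResidueField R) - 1 := fun h => by
    have := (Nat.dvd_sub_iff_right Fintype.card_pos hcard).1 h
    exact hp.out.one_lt.ne' (Nat.dvd_one.1 this)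
  obtain ⟨τ, hτ, hfix⟩ := hE.exists_mem_inertia hv he φ
  refine ⟨_, hfix, _, ?_, Fil.minusRep_apply_eq_smul hv (hact _)⟩
  rw [← notMem_maximalIdeal]
  have hθτ : residue R (θ (φ * τ ^ (Fintype.card (ResidueField R) - 1)) : Rˣ) = 1 := by
    have hφ1 : residue R (θ φ : Rˣ) = 1 := by
      rwa [← sub_eq_zero, ← map_one (residue R), ← map_sub, residue_eq_zero_iff]
    rw [map_mul, map_pow, Units.val_mul, Units.val_pow_eq_pow_val, map_mul, map_pow, hφ1, one_mul]
    exact FiniteField.pow_card_sub_one_eq_one _ (((θ τ).isUnit.map (residue R)).ne_zero)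
  rw [← residue_eq_zero_iff, map_sub, map_one] at hu1 ⊢
  rwa [Units.val_mul, map_mul, hθτ, mul_one, map_mul δ, hδ _ (pow_mem hτ _), mul_one, hu φ hφ]

end Local

section Res

variable {R G M : Type*} [CommRing R] [Group G] [TopologicalSpace G] [AddCommGroup M] [Module R M]
  (ρ : Representation R G M) {N N' N'' : Subgroup G}

theorem H1.res_self (h : N ≤ N) (x : H1 (resRep ρ N)) : H1.res ρ h x = x := by
  induction x using Submodule.Quotient.induction_on with
  | H c => rfl

theorem H1.res_res (h : N' ≤ N) (h' : N'' ≤ N') (x : H1 (resRep ρ N)) :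
    H1.res ρ h' (H1.res ρ h x) = H1.res ρ (h'.trans h) x := by
  induction x using Submodule.Quotient.induction_on with
  | H c => rfl

end Res

/-! ### The kernel and the cokernel of the restriction map -/

section Control

variable {p : ℕ} [hp : Fact p.Prime] {F : Type*} [Field F] [NumberField F]
  {R : Type*} [CommRing R] [TopologicalSpace R] [IsTopologicalRing R]
  {T : Type*} [AddCommGroup T] [Module R T] {ρ : Representation R (GlobalGal F) T}
  {ι : Embeddings F} {Fil : Filtration p ρ ι} {E : ZpExtension p F}

/-- Needed so that vanishing in the direct limit is detected at a finite layer. -/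
instance : DirectedSystem (fun n : ℕ => Fil.selLayer E n)
    (fun _ _ h => Fil.selRes _ _ (E.N_antitone h)) where
  map_self _ x := Subtype.ext (H1.res_self _ _ x.1)
  map_map _ _ _ _ _ x := Subtype.ext (H1.res_res _ _ _ x.1)

theorem Filtration.exists_res_eq_zero {n : ℕ} {c : Fil.selLayer E n} (hc : Fil.toSelTop E n c = 0) :
    ∃ (m : ℕ) (h : n ≤ m), H1.res (discRep p ρ) (E.N_antitone h) c.1 = 0 := by
  obtain ⟨m, h, hm⟩ := Module.DirectLimit.of.zero_exact hc
  exact ⟨m, h, congrArg Subtype.val hm⟩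

theorem Filtration.toSelTop_selRes {n m : ℕ} (h : n ≤ m) (c : Fil.selLayer E n) :
    Fil.toSelTop E m (Fil.selRes _ _ (E.N_antitone h) c) = Fil.toSelTop E n c :=
  Module.DirectLimit.of_f (hij := h)

/-- Classes over `F_n` that satisfy the Selmer conditions over `F_k` satisfy them over `F_n`. -/
theorem Filtration.mem_sel_of_res_mem (hE : UnramifiedOutsideP E ι)
    (hloc : ∀ v (hv : Above p v), ∃ σ : LocalGal v, decomp ι v σ ∈ E.top.fixingSubgroup ∧
      ∃ w : R, IsUnit (w - 1) ∧ ∀ x, Fil.minusRep v hv σ x = w • x) {n k : ℕ} (h : n ≤ k)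
    {y : H1 (resRep (discRep p ρ) (E.N n))}
    (hy : H1.res (discRep p ρ) (E.N_antitone h) y ∈ Fil.sel (E.N k)) : y ∈ Fil.sel (E.N n) := by
  intro g
  obtain ⟨h1, h2⟩ := hy g
  rw [← res_conjRep] at h1 h2
  refine ⟨fun v hv => ?_, fun v hv => ?_⟩
  -- Inertia at v ∤ p fixes F_∞, so the inertia groups over F_n and F_k coincide.
  · have h0 := h1 v hv
    rw [resInertia_res] at h0
    generalize resInertia p ρ ι (E.N n) v _ = z at h0
    induction z using Submodule.Quotient.induction_on with
    | H c =>
      obtain ⟨a, ha⟩ := (H1.res_mk_eq_zero_iff _).1 h0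
      exact H1.mk_eq_zero_iff.2 ⟨a, fun x hx =>
        ha x ⟨hx.1, E.fixingSubgroup_top_le_N k (hE v hv x hx.1)⟩⟩
  -- Since σ fixes F_∞, it lies in the local Galois group of every layer, and local restriction is
  -- injective.
  · obtain ⟨σ, hσ, w, hw, hact⟩ := hloc v hv
    have h0 := h2 v hv
    rw [Fil.resMinus_res] at h0
    exact H1.eq_zero_of_res_eq_zero (N' := localSubgroup ι (E.N k) v) _
      (E.fixingSubgroup_top_le_N k hσ) hw hact h0

/-- Equality in the direct limit is reached at a finite layer, which can be taken above F_n. -/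
theorem Filtration.exists_conjRep_res_eq {m : ℕ} {c : Fil.selLayer E m} {g : GlobalGal F}
    (hc : Fil.selTopRep E g (Fil.toSelTop E m c) = Fil.toSelTop E m c) (n : ℕ) :
    ∃ (k : ℕ) (hk : m ≤ k), n ≤ k ∧ H1.conjRep (discRep p ρ) (E.N k) g
      (H1.res (discRep p ρ) (E.N_antitone hk) c.1) =
        H1.res (discRep p ρ) (E.N_antitone hk) c.1 := by
  have hinv : Fil.toSelTop E m (Fil.selRep (E.N m) g c - c) = 0 := by
    rw [map_sub, ← Fil.selTopRep_toSelTop, hc, sub_self]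
  obtain ⟨k, hmk, hk⟩ := Fil.exists_res_eq_zero hinv
  refine ⟨max n k, hmk.trans (le_max_right n k), le_max_left n k, ?_⟩
  have h1 := congrArg (H1.res (discRep p ρ) (E.N_antitone (le_max_right n k))) hk
  rw [H1.res_res, map_zero, Submodule.coe_sub, map_sub, sub_eq_zero] at h1
  exact (res_conjRep _ _ _ g c.1).symm.trans h1

/-- The restriction map is onto. -/
theorem Filtration.exists_toSelTop_eq (hA : ∀ x : DiscMod p R T, ∃ k, p ^ k • x = 0)
    (hE : UnramifiedOutsideP E ι)
    (hloc : ∀ v (hv : Above p v), ∃ σ : LocalGal v, decomp ι v σ ∈ E.top.fixingSubgroup ∧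
      ∃ w : R, IsUnit (w - 1) ∧ ∀ x, Fil.minusRep v hv σ x = w • x) {n : ℕ} {z : Fil.selTop E}
    (hz : Fil.selTopRep E (E.gen ^ p ^ n) z = z) : ∃ c, Fil.toSelTop E n c = z := by
  obtain ⟨m, c, rfl⟩ : ∃ m c, Fil.toSelTop E m c = z := Module.DirectLimit.exists_of z
  obtain ⟨k, hmk, hnk, hk⟩ := Fil.exists_conjRep_res_eq hz n
  obtain ⟨l, hl, y, hy⟩ := E.exists_res_eq hA hnk hk
  rw [H1.res_res] at hy
  have hy' : H1.res (discRep p ρ) (E.N_antitone (hnk.trans hl)) y =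
    (Fil.selRes _ _ (E.N_antitone (hmk.trans hl)) c).1 := hy
  have hym : y ∈ Fil.sel (E.N n) := Fil.mem_sel_of_res_mem hE hloc (hnk.trans hl) (by
    rw [hy']
    exact Subtype.property _)
  refine ⟨⟨y, hym⟩, ?_⟩
  rw [← Fil.toSelTop_selRes (hmk.trans hl) c, ← Fil.toSelTop_selRes (hnk.trans hl)]
  exact congrArg _ (Subtype.ext hy)

end Control

/-! ### From R-linear statements to R[G]-modules -/

section AsModule

variable {R G V W : Type*} [CommRing R] [Group G] [AddCommMonoid V] [Module R V] [AddCommMonoid W]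
  [Module R W] {σ : Representation R G V} {τ : Representation R G W}

variable (σ) in
theorem asModuleEquiv_algebraMap_smul (r : R) (x : σ.asModule) :
    σ.asModuleEquiv (algebraMap R (MonoidAlgebra R G) r • x) = r • σ.asModuleEquiv x := by
  rw [Representation.asModuleEquiv_map_smul, AlgHom.commutes]
  rfl

theorem asModuleEquiv_equivLinearMapAsModule (f : Representation.IntertwiningMap σ τ)
    (x : σ.asModule) :
    τ.asModuleEquiv (Representation.IntertwiningMap.equivLinearMapAsModule σ τ f x) =
      f.toLinearMap (σ.asModuleEquiv x) := rfl

theorem algebraMap_smul_eq_zero (f : Representation.IntertwiningMap σ τ) {r : R}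
    (hr : ∀ x, f.toLinearMap x = 0 → r • x = 0)
    (x : LinearMap.ker (Representation.IntertwiningMap.equivLinearMapAsModule σ τ f)) :
    algebraMap R (MonoidAlgebra R G) r • x = 0 := by
  obtain ⟨x, hx⟩ := x
  refine Subtype.ext (σ.asModuleEquiv.injective ?_)
  refine (asModuleEquiv_algebraMap_smul σ r x).trans ((hr _ ?_).trans (map_zero _).symm)
  rw [← asModuleEquiv_equivLinearMapAsModule, LinearMap.mem_ker.1 hx, map_zero]

theorem equivLinearMapAsModule_surjective (f : Representation.IntertwiningMap σ τ)
    (hf : Function.Surjective f.toLinearMap) :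
    Function.Surjective (Representation.IntertwiningMap.equivLinearMapAsModule σ τ f) := fun z => by
  obtain ⟨c, hc⟩ := hf (τ.asModuleEquiv z)
  refine ⟨σ.asModuleEquiv.symm c, τ.asModuleEquiv.injective ?_⟩
  rw [asModuleEquiv_equivLinearMapAsModule, LinearEquiv.apply_symm_apply, hc]

end AsModule

/-! ### Annihilators, and pseudo-null and torsion duals -/

section Torsion

variable {p : ℕ} [hp : Fact p.Prime] {F : Type*} [Field F] [NumberField F]
  {R : Type*} [CommRing R] [TopologicalSpace R] [IsTopologicalRing R]
  {T : Type*} [AddCommGroup T] [Module R T] {ρ : Representation R (GlobalGal F) T}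
  {ι : Embeddings F} {Fil : Filtration p ρ ι} {E : ZpExtension p F}

variable (p ρ E) in
/-- The inclusion of `H⁰(F_n, A)` into `H⁰(F_∞, A)`. -/
def H0Layer.toInvariants (n : ℕ) : H0Layer p ρ E n →+ E.invariants (discRep p ρ) where
  toFun x := ⟨((Representation.asModuleEquiv _ x :
    Representation.invariants ((discRep p ρ).comp (E.N n).subtype)) : DiscMod p R T),
    n, fun y hy => (Representation.asModuleEquiv _ x).2 ⟨y, hy⟩⟩
  map_zero' := rfl
  map_add' _ _ := rfl

omit [NumberField F] in
theorem H0Layer.toInvariants_smul {n : ℕ} (r : R) (x : H0Layer p ρ E n) :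
    toInvariants p ρ E n (algebraMap R (MonoidAlgebra R (E.layerGal n)) r • x) =
      r • toInvariants p ρ E n x := by
  have h := congrArg Subtype.val (asModuleEquiv_algebraMap_smul _ r x)
  exact Subtype.ext h

omit [NumberField F] in
theorem H0Layer.exists_toInvariants_eq {n : ℕ} {b : E.invariants (discRep p ρ)}
    (hb : E.genSubOne (discRep p ρ) n b = 0) : ∃ x, toInvariants p ρ E n x = b :=
  ⟨(Representation.asModuleEquiv _).symm
    ⟨b, fun y => E.apply_eq_of_genSubOne_eq_zero hb y.2⟩, rfl⟩

theorem Filtration.smul_resKer_eq_zero {n : ℕ} {r : R}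
    (hr : ∀ (m : ℕ) (h : n ≤ m) (x : H1 (resRep (discRep p ρ) (E.N n))),
      H1.res (discRep p ρ) (E.N_antitone h) x = 0 → r • x = 0) (x : Fil.resKer E n) :
    algebraMap R (MonoidAlgebra R (E.layerGal n)) r • x = 0 := by
  refine algebraMap_smul_eq_zero (Fil.resTop E n) (fun c hc => ?_) x
  obtain ⟨m, hm, h⟩ := Fil.exists_res_eq_zero (congrArg Subtype.val hc)
  exact Subtype.ext (hr m hm _ h)

/-- Invariance under the single element γ^(p^n) is all that lifting uses. -/
theorem Filtration.resTopLinear_surjective (n : ℕ)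
    (h : ∀ z : Fil.selTop E, Fil.selTopRep E (E.gen ^ p ^ n) z = z →
      ∃ c, Fil.toSelTop E n c = z) :
    Function.Surjective (Fil.resTopLinear E n) := by
  refine equivLinearMapAsModule_surjective (Fil.resTop E n) fun z => ?_
  obtain ⟨c, hc⟩ := h z.1 (z.2 ⟨_, E.gen_pow_mem⟩)
  exact ⟨c, Subtype.ext hc⟩

open IsLocalRing

variable [IsDomain R] [IsNoetherianRing R] [IsLocalRing R] [IsAdicComplete (maximalIdeal R) R]
  [Finite (ResidueField R)] [CharP (ResidueField R) p]

-- p lies in 𝔪, and R is 𝔪-adically separated.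
variable (R) in
omit [TopologicalSpace R] [IsTopologicalRing R] [IsDomain R] [IsNoetherianRing R]
  [Finite (ResidueField R)] hp in
theorem eq_zero_of_forall_prime_pow_dvd (r : R) (hr : ∀ k, (p : R) ^ k ∣ r) : r = 0 := by
  refine IsHausdorff.haus (I := maximalIdeal R) inferInstance r fun k => ?_
  rw [SModEq.zero, smul_eq_mul, Ideal.mul_top]
  exact Ideal.mem_of_dvd _ (hr k) (Ideal.pow_mem_pow natCast_prime_mem_maximalIdeal k)

variable [Module.Finite R T] [Module.Free R T]

omit [NumberField F] in
/-- If the dual of `H⁰(F_n, A)` is pseudo-null, the kernels of the restriction maps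
`H¹(F_n, A) → H¹(F_m, A)` are killed by a nonzero element of `R`. -/
theorem exists_smul_eq_zero_of_res_eq_zero (hR : IsAdic (maximalIdeal R)) {n : ℕ}
    (hH : IsPseudoNullVia (E.iwasawaProj R n) (DiscreteDual p (H0Layer p ρ E n))) :
    ∃ r : R, r ≠ 0 ∧ ∀ (m : ℕ) (h : n ≤ m) (x : H1 (resRep (discRep p ρ) (E.N n))),
      H1.res (discRep p ρ) (E.N_antitone h) x = 0 → r • x = 0 := by
  have := t2Space_of_isAdic hR
  have := compactSpace_of_isAdic hR
  have := DiscMod.finite_discreteDual_submodule (p := p) hR (E.invariants (discRep p ρ))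
  obtain ⟨r, hr, h⟩ := exists_forall_smul_mem_range (p := p)
    (fun b : E.invariants (discRep p ρ) => by
      obtain ⟨k, hk⟩ := DiscMod.exists_pow_smul_eq_zero hR b.1
      exact ⟨k, Subtype.ext hk⟩) (E.genSubOne (discRep p ρ) n) (fun φ => by
      -- Restrict φ to ker D = H⁰(F_n, A), whose pseudo-null dual is R-torsion.
      obtain ⟨r, hr, h⟩ := E.torsion_of_isPseudoNullVia (eq_zero_of_forall_prime_pow_dvd R) n hH
        (AddMonoidHom.comp φ (H0Layer.toInvariants p ρ E n))
      refine ⟨r, hr, fun b hb => ?_⟩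
      obtain ⟨x, rfl⟩ := H0Layer.exists_toInvariants_eq hb
      rw [← H0Layer.toInvariants_smul]
      exact DFunLike.congr_fun h x)
  exact ⟨r, hr, fun m hm x hx => E.smul_eq_zero_of_res_eq_zero hm h hx⟩

omit [TopologicalSpace R] [IsTopologicalRing R] [IsNoetherianRing R] [Finite (ResidueField R)]
  [NumberField F] in
/-- A discrete `R[G_n]`-module that is killed by a nonzero element of `R` has a pseudo-null and
torsion dual. -/
theorem isPseudoNullVia_and_isTorsion_of_smul_eq_zero {n : ℕ} {X : Type*} [AddCommGroup X]
    [Module (MonoidAlgebra R (E.layerGal n)) X] {r : R} (hr : r ≠ 0)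
    (h : ∀ x : X, algebraMap R (MonoidAlgebra R (E.layerGal n)) r • x = 0) :
    IsPseudoNullVia (E.iwasawaProj R n) (DiscreteDual p X) ∧
      Module.IsTorsion (MonoidAlgebra R (E.layerGal n)) (DiscreteDual p X) := by
  have h' (φ : DiscreteDual p X) : algebraMap R (MonoidAlgebra R (E.layerGal n)) r • φ = 0 :=
    AddMonoidHom.ext fun x => (congrArg φ (h x)).trans (map_zero φ)
  exact ⟨E.isPseudoNullVia_of_torsion (eq_zero_of_forall_prime_pow_dvd R) n
    fun φ => ⟨r, hr, h' φ⟩, fun φ => ⟨⟨_, GroupRing.algebraMap_mem_nonZeroDivisors hr⟩, h' φ⟩⟩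

end Torsion

end SelmerControl

end

/-! ### The control theorem -/

open SelmerControl IsLocalRing in
theorem mainTheorem4 {p : ℕ} [Fact p.Prime] {F : Type*} [Field F] [NumberField F]
    {R : Type*} [CommRing R] [TopologicalSpace R] [IsTopologicalRing R]
    [IsRegularLocalRing R] (hRadic : IsAdic (maximalIdeal R)) [IsAdicComplete (maximalIdeal R) R]
    (hRdim : 1 ≤ ringKrullDim R) [Finite (ResidueField R)] [CharP (ResidueField R) p]
    (E : ZpExtension p F) (ι : Embeddings F)
    (hE : UnramifiedOutsideP E ι) (hE' : TotallyRamifiedAtP E ι)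
    {T : Type*} [AddCommGroup T] [Module R T] [Module.Finite R T] [Module.Free R T]
    [TopologicalSpace T] [IsModuleTopology R T]
    (ρ : Representation R (GlobalGal F) T)
    (hρ : Continuous fun x : GlobalGal F × T => ρ x.1 x.2)
    (Fil : Filtration p ρ ι)
    (Sigma : Set (IsDedekindDomain.HeightOneSpectrum (NumberField.RingOfIntegers F)))
    (hSigma : Sigma.Finite) (hSigma' : ∀ v, Above p v → v ∈ Sigma)
    (n : ℕ) (hT : IsOrdinary p ρ ι Fil E Sigma n) :
    (IsPseudoNullVia (E.iwasawaProj R n) (DiscreteDual p (Fil.resKer E n)) ∧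
      IsPseudoNullVia (E.iwasawaProj R n) (DiscreteDual p (Fil.resCoker E n))) ∧
    (Module.IsTorsion (MonoidAlgebra R (E.layerGal n)) (DiscreteDual p (Fil.resKer E n)) ∧
      Module.IsTorsion (MonoidAlgebra R (E.layerGal n)) (DiscreteDual p (Fil.resCoker E n))) := by
  have := IsRegularLocalRing.isDomain R
  have hH : IsPseudoNullVia (E.iwasawaProj R n) (DiscreteDual p (H0Layer p ρ E n)) :=
    hT.pseudoNull_H0
  have key := exists_smul_eq_zero_of_res_eq_zero hRadic hH
  obtain ⟨r, hker⟩ := key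
  obtain ⟨hr, hker⟩ := hker
  have h1 := Fil.resTopLinear_surjective n fun _ => Fil.exists_toSelTop_eq
    (DiscMod.exists_pow_smul_eq_zero hRadic) hE fun v hv => hT.exists_minusRep_eq_smul Fil hE' hv
  -- The cokernel is zero, so the same r serves for it.
  have : Subsingleton (Fil.resCoker E n) :=
    Submodule.Quotient.subsingleton_iff.2 (LinearMap.range_eq_top.2 h1)
  have h2 := isPseudoNullVia_and_isTorsion_of_smul_eq_zero (E := E) (n := n)
    (X := Fil.resKer E n) hr
    (Fil.smul_resKer_eq_zero hker)
  have h3 := isPseudoNullVia_and_isTorsion_of_smul_eq_zero (E := E) (n := n)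
    (X := Fil.resCoker E n) hr
    fun _ => Subsingleton.elim _ _
  exact ⟨⟨h2.1, h3.1⟩, h2.2, h3.2⟩
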